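/- **Setting.** Let $K,M,T\ge 1$ and let $G$ be a directed graph on the action set $[K]$ containing all self-loops; write $a\to b$ for an edge and $N_{\mathrm{out}}(D)=\{b:\ a\to b\text{ for some }a\in D\}$. In each round $t\in[T]$ the learner sees a context $c_t\in[M]$ (the sequence $c^T$ is fixed in advance by an oblivious adversary and revealed one term at a time), takes an action $a_t\in[K]$, and then observes $r_{t,c,b}$ for all $c\in[M]$ and all $b$ with $a_t\to b$. The reward arrays $(r_{t,c,a})_{c,a}$ are independent over $t$, have entries in $[0,1]$, and have unknown means $\mathbb E[r_{t,c,a}]=\mu_{c,a}$ not depending on $t$. The regret of a run is $\sum_{t\le T}\big(\max_a\mu_{c_t,a}-\mu_{c_t,a_t}\big)$; $\mathsf R_T(\pi;G,M)$ is the supremum, over all context sequences and all such environments, of the expected regret of the (possibly randomized) policy $\pi$, and $\mathsf R_T^\star(G,M)=\inf_\pi \mathsf R_T(\pi;G,M)$. **Graph quantities.** A set is independent if there is no edge between two distinct elements of it, and acyclic if the subgraph it induces has no directed cycle other than self-loops. For a set $W$ of vertices, $\delta(W)$ is the smallest size of a $J\subseteq W$ with $W\subseteq N_{\mathrm{out}}(J)$.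 Let - $\mathsf m(G)$ be the maximum size of an acyclic set; - $\overline\beta_M(G)$ be the maximum of $\sum_{c=1}^M|I_c|$ over disjoint independent sets $I_1,\dots,I_M$; - $\beta_M(G)$ be the maximum of $\sum_{c=1}^M|I_c|$ over independent sets $I_1,\dots,I_M$ such that there is no edge from $I_i$ to $I_j$ for $i<j$; - $\beta_{\mathsf{dom}}(G,M)$ be the maximum of $\sum_{c=1}^M|B_c|$ over sets $B_1,\dots,B_M$ such that $\bigcup_c B_c$ is acyclic and there are disjoint $V_1,\dots,V_M\subseteq[K]$ with $B_c\subseteq V_c\subseteq N_{\mathrm{out}}(B_c)$ and $|B_c|\le\delta(V_c)(1+\log K)$ for every $c$. **Policy $\pi_\delta$ (layered arm elimination).** Each context $c$ has a current layer $\ell(c)$, initially $1$, and an active set $A_{c,\ell(c)}$, initially $[K]$; each layer $\ell$ has a set $D_\ell$ of actions taken on it, initially empty. In round $t$, with $c=c_t$ and $\ell=\ell(c_t)$, the policy plays the greedy strategy of the sequential dominating game: it takes an action $a_t$ of maximal out-degree in the subgraph induced by $A_{c,\ell}\setminus N_{\mathrm{out}}(D_\ell)$ (ties broken by an arbitrary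 fixed rule), and adds $a_t$ to $D_\ell$. After the observations of the round, for every context $c$ and as long as $A_{c,\ell}\subseteq N_{\mathrm{out}}(D_\ell)$ for $\ell=\ell(c)$, it sets $$A_{c,\ell+1}=\Big\{a\in A_{c,\ell}:\ \bar r_{c,a}\ge\max_{a'\in A_{c,\ell}}\bar r_{c,a'}-2\sqrt{\log(2MKT/\delta)/\ell}\Big\},\qquad \ell(c)\leftarrow\ell+1,$$ where $\bar r_{c,a}$ is the average of all observations of the reward of $a$ under $c$ so far. **Theorem.** There is an absolute constant $C>0$ such that for all $K,M,T\ge1$, all $G$ and all tie-breaking rules the following hold. 1. For every $\delta\in(0,1)$, every context sequence and every environment, with probability at least $1-\delta$ the regret of $\pi_\delta$ is at most $C\sqrt{T\,\beta_{\mathsf{dom}}(G,M)\log(MKT/\delta)}$. 2. The policy $\pi=\pi_{1/(T+1)}$ satisfies $$\mathsf R_T(\pi;G,M)\le C\,\log K\,\sqrt{\log(MKT)}\ \sqrt{\min\{\overline\beta_M(G),\mathsf m(G)\}\,T},$$ that is, $\mathsf R_T(\pi;G,M)=\widetilde O\big(\sqrt{\min\{\overline\beta_M(G),\mathsf m(G)\}\,T}\big)$.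 3. If $G$ is undirected ($a\to b$ implies $b\to a$) or transitively closed ($a\to b$ and $b\to c$ imply $a\to c$), then the same policy satisfies $$\mathsf R_T(\pi;G,M)\le C\sqrt{\log K\,\log(MKT)}\ \sqrt{\beta_M(G)\,T}=\widetilde O\big(\sqrt{\beta_M(G)T}\big),$$ and it is near-optimal: if moreover $T\ge\beta_M(G)^3$, then $$\mathsf R_T(\pi;G,M)\le C\sqrt{\log K\,\log(MKT)}\ \mathsf R_T^\star(G,M).$$ -/

import Mathlib

open MeasureTheory

noncomputable section

namespace GraphBandit

/-! ### Graph-theoretic quantities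

A feedback graph is a directed graph `G : Digraph V`. All self-loops are assumed present where
they matter; self-loops are ignored in independence and acyclicity. -/

section Graph

variable {V : Type*} [Fintype V] [DecidableEq V]

open Classical in
/-- The set `N_out(D)` of all out-neighbours of vertices of `D`. -/
def outNbr (G : Digraph V) (D : Finset V) : Finset V :=
  Finset.univ.filter fun v => ∃ u ∈ D, G.Adj u v

/-- `I` is independent: there is no edge between two distinct vertices of `I`. -/
def IsIndep (G : Digraph V) (I : Finset V) : Prop :=
  ∀ u ∈ I, ∀ v ∈ I, u ≠ v → ¬ G.Adj u v

/-- The subgraph induced by `D` has no directed cycle, apart from self-loops. -/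
def IsAcyclic (G : Digraph V) (D : Finset V) : Prop :=
  ∀ v, ¬ Relation.TransGen (fun u w => u ∈ D ∧ w ∈ D ∧ u ≠ w ∧ G.Adj u w) v v

/-- `δ(W)`: the dominating number of the subgraph induced by `W`. -/
def domNumber (G : Digraph V) (W : Finset V) : ℕ :=
  sInf {n | ∃ J : Finset V, J ⊆ W ∧ W ⊆ outNbr G J ∧ J.card = n}

open Classical in
/-- `m(G)`: the maximum acyclic subgraph number. -/
def masNumber (G : Digraph V) : ℕ :=
  (Finset.univ.filter fun D : Finset V => IsAcyclic G D).sup Finset.card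

open Classical in
/-- `β_M(G)`: the maximum total size of independent sets `I_1, …, I_M` such that there is no edge
from `I_i` to `I_j` for `i < j`. -/
def beta (G : Digraph V) (M : ℕ) : ℕ :=
  (Finset.univ.filter fun I : Fin M → Finset V =>
    (∀ c, IsIndep G (I c)) ∧ ∀ i j, i < j → ∀ u ∈ I i, ∀ v ∈ I j, ¬ G.Adj u v).sup
      fun I => ∑ c, (I c).card

open Classical in
/-- The maximum total size of `M` disjoint independent sets. -/
def betaBar (G : Digraph V) (M : ℕ) : ℕ :=
  (Finset.univ.filter fun I : Fin M → Finset V =>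
    (∀ c, IsIndep G (I c)) ∧ ∀ i j, i ≠ j → Disjoint (I i) (I j)).sup
      fun I => ∑ c, (I c).card

open Classical in
/-- `β_dom(G, M)`: the maximum of `∑ |B_c|` where `⋃ B_c` is acyclic, and there are disjoint
`V_1, …, V_M` such that `B_c ⊆ V_c` dominates `V_c` and `|B_c| ≤ δ(V_c) (1 + log |V|)`. -/
def betaDom (G : Digraph V) (M : ℕ) : ℕ :=
  (Finset.univ.filter fun B : Fin M → Finset V =>
    IsAcyclic G (Finset.univ.biUnion B) ∧
    ∃ W : Fin M → Finset V, (∀ i j, i ≠ j → Disjoint (W i) (W j)) ∧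
      ∀ c, B c ⊆ W c ∧ W c ⊆ outNbr G (B c) ∧
        ((B c).card : ℝ) ≤ domNumber G (W c) * (1 + Real.log (Fintype.card V))).sup
      fun B => ∑ c, (B c).card

end Graph

/-! ### Stochastic contextual bandits with graph feedback and complete cross-learning -/

/-- What the learner knows about a past round: the context, the action taken, and the observed
rewards (set to `0` at the entries that are not observed). -/
abbrev Round (M K : ℕ) : Type := Fin M × Fin K × (Fin M → Fin K → ℝ)

open Classical in
/-- Taking action `a` reveals the rewards of all out-neighbours of `a` under all contexts. -/
def observe {M K : ℕ} (G : Digraph (Fin K)) (a : Fin K) (r : Fin M → Fin K → ℝ) :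
    Fin M → Fin K → ℝ :=
  fun c b => if G.Adj a b then r c b else 0

/-- A (possibly randomized) policy: from a random seed, the past rounds (most recent first) and
the current context, it computes an action. -/
structure Policy (M K : ℕ) where
  /-- the law of the seed -/
  seed : Measure ℝ
  /-- the action chosen -/
  act : ℝ → List (Round M K) → Fin M → Fin K

/-- The policy is a genuine randomized policy: the seed has a probability law, and at every time
the action depends measurably on the seed and the history. -/
def Policy.Admissible {M K : ℕ} (π : Policy M K) : Prop :=
  IsProbabilityMeasure π.seed ∧
    ∀ (n : ℕ) (c : Fin M),
      Measurable fun p : ℝ × (Fin n → Round M K) => π.act p.1 (List.ofFn p.2) c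

/-- A stochastic environment over `T` rounds: the reward arrays of the rounds are independent
(see `Environment.measure`), their entries lie in `[0,1]`, and their means do not depend on
the round. -/
structure Environment (T M K : ℕ) where
  /-- the law of the rewards `(r_{t,c,a})_{c,a}` of round `t` -/
  law : Fin T → Measure (Fin M → Fin K → ℝ)
  isProb : ∀ t, IsProbabilityMeasure (law t)
  bounded : ∀ t, ∀ᵐ r ∂(law t), ∀ c a, r c a ∈ Set.Icc (0 : ℝ) 1
  /-- the mean rewards -/
  mean : Fin M → Fin K → ℝ
  mean_eq : ∀ t c a, ∫ r, r c a ∂(law t) = mean c a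

/-- The joint law of the policy's seed and of the rewards of all rounds. -/
def Environment.measure {T M K : ℕ} (E : Environment T M K) (π : Policy M K) :
    Measure (ℝ × (Fin T → Fin M → Fin K → ℝ)) :=
  π.seed.prod (Measure.pi E.law)

/-- The rounds before round `t` (most recent first) when the policy `π` is run with seed `u` on
the context sequence `ctx` and the rewards `r`. -/
def history {T M K : ℕ} (G : Digraph (Fin K)) (π : Policy M K) (ctx : Fin T → Fin M)
    (u : ℝ) (r : Fin T → Fin M → Fin K → ℝ) : (t : ℕ) → t ≤ T → List (Round M K)
  | 0, _ => []
  | t + 1, h =>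
    let past := history G π ctx u r t (Nat.le_of_succ_le h)
    let c := ctx ⟨t, h⟩
    let a := π.act u past c
    (c, a, observe G a (r ⟨t, h⟩)) :: past

/-- The action `a_t` taken in round `t`. -/
def action {T M K : ℕ} (G : Digraph (Fin K)) (π : Policy M K) (ctx : Fin T → Fin M)
    (u : ℝ) (r : Fin T → Fin M → Fin K → ℝ) (t : Fin T) : Fin K :=
  π.act u (history G π ctx u r t t.isLt.le) (ctx t)

/-- The regret `∑_t (max_a μ_{c_t,a} - μ_{c_t,a_t})` along one run. -/
def regret {T M K : ℕ} (G : Digraph (Fin K)) (π : Policy M K) (μ : Fin M → Fin K → ℝ)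
    (ctx : Fin T → Fin M) (u : ℝ) (r : Fin T → Fin M → Fin K → ℝ) : ℝ :=
  ∑ t : Fin T, ((⨆ a, μ (ctx t) a) - μ (ctx t) (action G π ctx u r t))

/-- The expected regret. -/
def expectedRegret {T M K : ℕ} (G : Digraph (Fin K)) (π : Policy M K) (E : Environment T M K)
    (ctx : Fin T → Fin M) : ℝ :=
  ∫ p, regret G π E.mean ctx p.1 p.2 ∂(E.measure π)

/-- `R_T(π; G, M)`: the worst-case expected regret over all context sequences and environments. -/
def worstRegret {M K : ℕ} (G : Digraph (Fin K)) (π : Policy M K) (T : ℕ) : ℝ :=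
  ⨆ x : (Fin T → Fin M) × Environment T M K, expectedRegret G π x.2 x.1

/-- `R*_T(G, M)`: the minimax regret. -/
def minimaxRegret {K : ℕ} (G : Digraph (Fin K)) (M T : ℕ) : ℝ :=
  ⨅ π : {π : Policy M K // π.Admissible}, worstRegret G π.1 T

/-! ### Layered arm elimination -/

/-- A greedy strategy for the learner in the sequential game where, facing an active set `A` and
the set `D` of vertices taken so far, a vertex of `A` has to be taken until `A ⊆ N_out(D)`: take a
vertex of maximal out-degree in the subgraph induced by `A \ N_out(D)` (ties broken arbitrarily). -/
def IsGreedy {K : ℕ} (G : Digraph (Fin K))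
    (σ : Finset (Fin K) → Finset (Fin K) → Fin K) : Prop :=
  ∀ A D : Finset (Fin K), (A \ outNbr G D).Nonempty →
    σ A D ∈ A \ outNbr G D ∧
    ∀ w ∈ A \ outNbr G D,
      (outNbr G {w} ∩ (A \ outNbr G D)).card ≤ (outNbr G {σ A D} ∩ (A \ outNbr G D)).card

/-- Greedy strategies exist. -/
theorem exists_isGreedy {K : ℕ} (hK : 0 < K) (G : Digraph (Fin K)) : ∃ σ, IsGreedy G σ := by
  have h : ∀ A D : Finset (Fin K), ∃ v : Fin K, (A \ outNbr G D).Nonempty →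
      v ∈ A \ outNbr G D ∧ ∀ w ∈ A \ outNbr G D,
        (outNbr G {w} ∩ (A \ outNbr G D)).card ≤ (outNbr G {v} ∩ (A \ outNbr G D)).card := by
    intro A D
    by_cases hne : (A \ outNbr G D).Nonempty
    · obtain ⟨v, hv, hmax⟩ := Finset.exists_max_image (A \ outNbr G D)
        (fun w => (outNbr G {w} ∩ (A \ outNbr G D)).card) hne
      exact ⟨v, fun _ => ⟨hv, hmax⟩⟩
    · exact ⟨⟨0, hK⟩, fun h => absurd h hne⟩
  choose σ hσ using h
  exact ⟨σ, hσ⟩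

open Classical in
/-- The empirical mean reward of action `a` under context `c`, based on all observations in the
history `h`. -/
def empMean {M K : ℕ} (G : Digraph (Fin K)) (h : List (Round M K)) (c : Fin M) (a : Fin K) : ℝ :=
  (h.map fun x => if G.Adj x.2.1 a then x.2.2 c a else 0).sum /
    (h.map fun x => if G.Adj x.2.1 a then (1 : ℝ) else 0).sum

/-- The internal state of the algorithm: the current layer `ℓ(c)` of each context `c`, the active
set `A_{c,ℓ(c)}` of `c` on its current layer, and the set `D_ℓ` of actions taken on layer `ℓ`. -/
structure AlgState (M K : ℕ) where
  layer : Fin M → ℕ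
  active : Fin M → Finset (Fin K)
  chosen : ℕ → Finset (Fin K)

open Classical in
/-- If the active set `A` on layer `ℓ` has been observed entirely on layer `ℓ`, go to layer `ℓ + 1`
and keep the actions with
`rbar_a ≥ max_{a' ∈ A} rbar_{a'} - 2 √(log(2MKT/δ)/ℓ)`; otherwise change nothing. -/
def advance {M K : ℕ} (G : Digraph (Fin K)) (T : ℕ) (δ : ℝ) (h : List (Round M K))
    (D : ℕ → Finset (Fin K)) (c : Fin M) (s : ℕ × Finset (Fin K)) : ℕ × Finset (Fin K) :=
  if s.2 ⊆ outNbr G (D s.1) then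
    (s.1 + 1, s.2.filter fun a => ∀ a' ∈ s.2,
      empMean G h c a' - 2 * Real.sqrt (Real.log (2 * M * K * T / δ) / s.1) ≤ empMean G h c a)
  else s

/-- The state of the algorithm after the rounds recorded in a history (most recent first).
After each round, every context moves up through the layers as long as its active set has been
observed entirely on its current layer; as a layer can only be left if an action was taken on it,
as many moves as rounds played so far suffice. -/
def algState {M K : ℕ} (G : Digraph (Fin K)) (T : ℕ) (δ : ℝ) :
    List (Round M K) → AlgState M K
  | [] => ⟨fun _ => 1, fun _ => Finset.univ, fun _ => ∅⟩
  | x :: h =>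
    let s := algState G T δ h
    let D := Function.update s.chosen (s.layer x.1) (insert x.2.1 (s.chosen (s.layer x.1)))
    let next := fun c =>
      (advance G T δ (x :: h) D c)^[h.length + 1] (s.layer c, s.active c)
    ⟨fun c => (next c).1, fun c => (next c).2, D⟩

/-- Layered arm elimination with horizon `T`, failure probability `δ` and game strategy `σ`:
under context `c` on layer `ℓ = ℓ(c)`, take the action that `σ` prescribes for the active set
`A_{c,ℓ}` and the set `D_ℓ` of actions taken so far on layer `ℓ`. -/
def armElim {K : ℕ} (G : Digraph (Fin K)) (M T : ℕ) (δ : ℝ)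
    (σ : Finset (Fin K) → Finset (Fin K) → Fin K) : Policy M K where
  seed := Measure.dirac 0
  act _ h c :=
    let s := algState G T δ h
    σ (s.active c) (s.chosen (s.layer c))

end GraphBandit

end

namespace GraphBandit

/-! ### Combinatorics of the sequential dominating game -/

section Game

set_option linter.unusedSectionVars false

variable {V : Type*} [Fintype V] [DecidableEq V] {G : Digraph V}

/-! Upper bounds. The rounds played on one layer form a greedy dominating game (`IsRun.greedyGame`):
every vertex taken is undominated by all vertices taken before it on that layer, under whatever
context. If each such game lasts at most N moves, the regret is O(√(N T log)). Indeed an arm that is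
active on layer ℓ was observed on each of the ℓ - 1 previous layers, hence in at least ℓ - 1
distinct rounds, so on concentrated histories its gap is O(√(log / ℓ)) (`active_of_concentrated`);
with at most N rounds per layer, the sum of 1/√ℓ is O(√(N T)) (`sum_inv_sqrt_layer_le`).
Concentration comes from an exponential supermartingale stopped at the n-th observation of an arm
and a union bound over context, arm, n and sign (`measure_not_concentrated_le`).

It remains to bound the length of the game. Edges between vertices taken point backwards in time, so
these vertices form an acyclic set, whence m(G). Each move gains the vertices it newly dominates,
and gains are disjoint. Under one context greediness makes the gain at time t comparable with all
that is gained from t on: up to a factor D, which may be a domination number or twice the size of an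
independent set. As for greedy set cover, this bounds the number of moves by D (1 + log K)
(`card_le_mul_one_add_log`). Summing over contexts gives β_dom and β̄_M. On undirected graphs the
vertices taken are independent. On transitively closed graphs an edge between two of them forces
different contexts, so paths visit at most M vertices and the height function splits the vertices
into M levels admissible for β_M.

Lower bound. Take a family that attains β_M, set one of its arms aside as a reference arm of reward
1/2, and call the remaining sets J_c. Arms of J_c yield random bits under c, biased by Δ below 1/2,
except possibly one better arm biased above; everything else yields 0. The contexts come in
increasing order, c for |J_c| L rounds. By the edge condition in β_M, before the end of phase c the
arms of J_c are observed only by playing them in that phase or by playing a zero-reward arm at cost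
at least 1/2. A change of measure (`expect_sub_expect_le`), averaged over a product prior on the
better arms, shows that with Δ of order 1/√L the regret is at least of order min(L, n √L), where n =
Σ |J_c| (`bayes_lower_bound`). With L about T / β_M this is of order √(β_M T) once T ≥ β_M³. -/

theorem mem_outNbr {D : Finset V} {v : V} : v ∈ outNbr G D ↔ ∃ u ∈ D, G.Adj u v := by
  simp [outNbr]

theorem mem_outNbr_singleton {u v : V} : v ∈ outNbr G {u} ↔ G.Adj u v := by
  simp [mem_outNbr]

theorem outNbr_mono {D D' : Finset V} (h : D ⊆ D') : outNbr G D ⊆ outNbr G D' := by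
  intro v hv
  obtain ⟨u, hu, huv⟩ := mem_outNbr.1 hv
  exact mem_outNbr.2 ⟨u, h hu, huv⟩

theorem subset_outNbr_self (hG : ∀ a, G.Adj a a) (D : Finset V) : D ⊆ outNbr G D :=
  fun v hv => mem_outNbr.2 ⟨v, hv, hG v⟩

/-- The counting argument behind the analysis of greedy covers. -/
theorem card_le_mul_one_add_log (g : ℕ → ℕ) (D : ℝ) (τ : Finset ℕ) (hne : τ.Nonempty)
    (hg : ∀ t ∈ τ, 1 ≤ g t)
    (h : ∀ t ∈ τ, ((∑ j ∈ τ.filter (t ≤ ·), g j : ℕ) : ℝ) ≤ D * g t) :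
    (τ.card : ℝ) ≤ D * (1 + Real.log (∑ j ∈ τ, g j : ℕ)) := by
  induction τ using Finset.induction_on_min with
  | empty => simp at hne
  | insert t₀ τ ht₀ ih =>
    have hnot : t₀ ∉ τ := fun hm => lt_irrefl _ (ht₀ _ hm)
    have hg0 : 1 ≤ g t₀ := hg _ (Finset.mem_insert_self _ _)
    have hfil : (insert t₀ τ).filter (t₀ ≤ ·) = insert t₀ τ := by
      apply Finset.filter_true_of_mem
      intro x hx
      rcases Finset.mem_insert.1 hx with rfl | hx
      · exact le_rfl
      · exact (ht₀ x hx).le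
    have h0 := h t₀ (Finset.mem_insert_self _ _)
    rw [hfil] at h0
    have hg0' : (1 : ℝ) ≤ g t₀ := by exact_mod_cast hg0
    rw [Finset.sum_insert hnot] at h0 ⊢
    rw [Finset.card_insert_of_notMem hnot]
    have hD : 1 ≤ D := by
      have : (g t₀ : ℝ) ≤ D * g t₀ := le_trans (by push_cast; simp; positivity) h0
      nlinarith
    rcases τ.eq_empty_or_nonempty with rfl | hτ
    · simp only [Finset.sum_empty, add_zero, Finset.card_empty, zero_add, Nat.cast_one]
      have : 0 ≤ Real.log (g t₀) := Real.log_nonneg hg0'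
      nlinarith
    · have ih' := ih hτ (fun t ht => hg t (Finset.mem_insert_of_mem ht)) (fun t ht => by
        have := h t (Finset.mem_insert_of_mem ht)
        rwa [Finset.filter_insert, if_neg (not_le.2 (ht₀ t ht))] at this)
      set s' := ∑ j ∈ τ, g j with hs'
      have hs1 : 1 ≤ s' := by
        obtain ⟨t, ht⟩ := hτ
        exact (hg t (Finset.mem_insert_of_mem ht)).trans
          (Finset.single_le_sum (f := g) (fun _ _ => Nat.zero_le _) ht)
      have hs1' : (1 : ℝ) ≤ s' := by exact_mod_cast hs1
      push_cast at h0 ⊢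
      have hpos : (0 : ℝ) < g t₀ + s' := by linarith
      -- This yields log s' ≤ log (g t₀ + s') - g t₀ / (g t₀ + s'). By hypothesis the subtracted
      -- fraction is at least 1 / D, so the logarithm pays for the move at t₀.
      have hlog := Real.log_le_sub_one_of_pos (x := (s' : ℝ) / (g t₀ + s')) (by positivity)
      rw [Real.log_div (by positivity) hpos.ne'] at hlog
      have h1 : (s' : ℝ) / (g t₀ + s') - 1 = - (g t₀ / (g t₀ + s')) := by
        field_simp; ring
      rw [h1] at hlog
      have h2 : 1 ≤ D * (g t₀ / (g t₀ + s')) := by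
        rw [← mul_div_assoc, le_div_iff₀ hpos]; linarith
      nlinarith

/-- A minimum dominating set of Z covers W by that many out-neighbourhoods, each meeting W in at
most g vertices. -/
theorem card_le_domNumber_mul (hG : ∀ a, G.Adj a a) {W Z : Finset V} {g : ℕ} (hWZ : W ⊆ Z)
    (h : ∀ j ∈ Z, (outNbr G {j} ∩ W).card ≤ g) : W.card ≤ domNumber G Z * g := by
  have hne : {n | ∃ J : Finset V, J ⊆ Z ∧ Z ⊆ outNbr G J ∧ J.card = n}.Nonempty :=
    ⟨Z.card, Z, subset_rfl, subset_outNbr_self hG Z, rfl⟩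
  obtain ⟨J, hJ, hdom, hcard⟩ := Nat.sInf_mem hne
  have hsub : W ⊆ J.biUnion fun j => outNbr G {j} ∩ W := by
    intro w hw
    obtain ⟨u, hu, huw⟩ := mem_outNbr.1 (hdom (hWZ hw))
    exact Finset.mem_biUnion.2 ⟨u, hu, Finset.mem_inter.2 ⟨mem_outNbr_singleton.2 huw, hw⟩⟩
  calc W.card ≤ _ := Finset.card_le_card hsub
    _ ≤ J.card * g := Finset.card_biUnion_le_card_mul _ _ _ fun j hj => h j (hJ hj)
    _ = domNumber G Z * g := by rw [hcard]; rfl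

/-- A digraph whose out-degrees are small has a large independent set. -/
theorem exists_isIndep_card_le (hG : ∀ a, G.Adj a a) {g : ℕ} (W : Finset V)
    (h : ∀ w ∈ W, (outNbr G {w} ∩ W).card ≤ g) :
    ∃ I ⊆ W, IsIndep G I ∧ W.card ≤ 2 * g * I.card := by
  classical
  induction W using Finset.strongInduction with
  | H W ih =>
    rcases W.eq_empty_or_nonempty with rfl | hne
    · exact ⟨∅, subset_rfl, by simp [IsIndep], by simp⟩
    -- a vertex whose total degree is at most the average
    obtain ⟨v, hv, hin⟩ : ∃ v ∈ W, (W.filter fun u => G.Adj u v).card ≤ g := by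
      by_contra! hcon
      have h1 : ∑ v ∈ W, (W.filter fun u => G.Adj u v).card =
          ∑ w ∈ W, (outNbr G {w} ∩ W).card := by
        simp_rw [Finset.card_filter]
        rw [Finset.sum_comm]
        refine Finset.sum_congr rfl fun w _ => ?_
        rw [← Finset.card_filter]
        congr 1
        ext x
        simp [mem_outNbr_singleton, and_comm]
      have h2 : ∑ w ∈ W, (outNbr G {w} ∩ W).card ≤ ∑ w ∈ W, g := Finset.sum_le_sum h
      have h3 : ∑ w ∈ W, g < ∑ v ∈ W, (W.filter fun u => G.Adj u v).card :=
        Finset.sum_lt_sum_of_nonempty hne hcon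
      omega
    -- Putting v into the independent set costs its neighbours in both directions, at most 2 g
    -- vertices.
    set N := (outNbr G {v} ∩ W) ∪ (W.filter fun u => G.Adj u v) with hN
    have hvN : v ∈ N := Finset.mem_union_left _
      (Finset.mem_inter.2 ⟨mem_outNbr_singleton.2 (hG v), hv⟩)
    obtain ⟨I, hI, hind, hcard⟩ := ih (W \ N)
      (Finset.ssubset_iff_subset_ne.2 ⟨Finset.sdiff_subset, fun he => by
        rw [← he] at hv; exact (Finset.mem_sdiff.1 hv).2 hvN⟩)
      (fun w hw => (Finset.card_le_card (Finset.inter_subset_inter_left Finset.sdiff_subset)).trans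
        (h w (Finset.sdiff_subset hw)))
    have hNc : N.card ≤ 2 * g := (Finset.card_union_le _ _).trans (by have := h v hv; omega)
    have hvI : v ∉ I := fun hm => (Finset.mem_sdiff.1 (hI hm)).2 hvN
    refine ⟨insert v I, ?_, ?_, ?_⟩
    · exact Finset.insert_subset hv (hI.trans Finset.sdiff_subset)
    · intro x hx y hy hxy hadj
      rcases Finset.mem_insert.1 hx with hxv | hxI <;>
        rcases Finset.mem_insert.1 hy with hyv | hyI
      · exact hxy (hxv.trans hyv.symm)
      · subst hxv
        have := Finset.mem_sdiff.1 (hI hyI)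
        exact this.2 (Finset.mem_union_left _
          (Finset.mem_inter.2 ⟨mem_outNbr_singleton.2 hadj, this.1⟩))
      · subst hyv
        have := Finset.mem_sdiff.1 (hI hxI)
        exact this.2 (Finset.mem_union_right _ (Finset.mem_filter.2 ⟨this.1, hadj⟩))
      · exact hind x hxI y hyI hxy hadj
    · rw [Finset.card_insert_of_notMem hvI]
      have := Finset.card_le_card_sdiff_add_card (s := W) (t := N)
      nlinarith

/-- A run of the greedy strategy: at every time `t ∈ τ`, under the context `ctx t`, the vertex
`a t` of maximal out-degree in the set `U t` of active undominated vertices is taken. -/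
structure GreedyGame {ι : Type*} (G : Digraph V) (τ : Finset ℕ) (ctx : ℕ → ι) (a : ℕ → V)
    (U : ℕ → Finset V) : Prop where
  mem : ∀ t ∈ τ, a t ∈ U t
  greedy : ∀ t ∈ τ, ∀ w ∈ U t, (outNbr G {w} ∩ U t).card ≤ (outNbr G {a t} ∩ U t).card
  undominated : ∀ s ∈ τ, ∀ t ∈ τ, s < t → Disjoint (outNbr G {a s}) (U t)
  antitone : ∀ s ∈ τ, ∀ t ∈ τ, s < t → ctx s = ctx t → U t ⊆ U s

namespace GreedyGame

variable {ι : Type*} {τ : Finset ℕ} {ctx : ℕ → ι} {a : ℕ → V} {U : ℕ → Finset V}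

theorem not_adj (h : GreedyGame G τ ctx a U) {s t : ℕ} (hs : s ∈ τ) (ht : t ∈ τ) (hst : s < t) :
    ¬ G.Adj (a s) (a t) := fun hadj =>
  Finset.disjoint_left.1 (h.undominated s hs t ht hst) (mem_outNbr_singleton.2 hadj) (h.mem t ht)

theorem injOn (hG : ∀ a, G.Adj a a) (h : GreedyGame G τ ctx a U) : Set.InjOn a τ := by
  intro s hs t ht hst
  by_contra hne
  rcases lt_or_gt_of_ne hne with hlt | hlt
  · exact h.not_adj hs ht hlt (hst ▸ hG _)
  · exact h.not_adj ht hs hlt (hst ▸ hG _)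

theorem subset (h : GreedyGame G τ ctx a U) {τ' : Finset ℕ} (hτ : τ' ⊆ τ) :
    GreedyGame G τ' ctx a U :=
  ⟨fun t ht => h.mem t (hτ ht), fun t ht => h.greedy t (hτ ht),
    fun s hs t ht => h.undominated s (hτ hs) t (hτ ht),
    fun s hs t ht => h.antitone s (hτ hs) t (hτ ht)⟩

/-- Time strictly decreases along edges between distinct vertices taken, and no vertex is taken
twice, so no path returns to its start. -/
theorem isAcyclic (hG : ∀ a, G.Adj a a) (h : GreedyGame G τ ctx a U) :
    IsAcyclic G (τ.image a) := by
  have key : ∀ u w, Relation.TransGen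
      (fun u w => u ∈ τ.image a ∧ w ∈ τ.image a ∧ u ≠ w ∧ G.Adj u w) u w →
      ∃ s ∈ τ, ∃ t ∈ τ, a s = u ∧ a t = w ∧ t < s := by
    intro u w huw
    have step : ∀ u w, (u ∈ τ.image a ∧ w ∈ τ.image a ∧ u ≠ w ∧ G.Adj u w) →
        ∃ s ∈ τ, ∃ t ∈ τ, a s = u ∧ a t = w ∧ t < s := by
      rintro u w ⟨hu, hw, hne, hadj⟩
      obtain ⟨s, hs, rfl⟩ := Finset.mem_image.1 hu
      obtain ⟨t, ht, rfl⟩ := Finset.mem_image.1 hw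
      refine ⟨s, hs, t, ht, rfl, rfl, ?_⟩
      rcases lt_trichotomy s t with hlt | rfl | hlt
      · exact absurd hadj (h.not_adj hs ht hlt)
      · exact absurd rfl hne
      · exact hlt
    induction huw with
    | single h1 => exact step _ _ h1
    | tail _ h2 ih =>
      obtain ⟨s, hs, t, ht, hsu, htw, hlt⟩ := ih
      obtain ⟨s', hs', t', ht', hsu', htw', hlt'⟩ := step _ _ h2
      have : s' = t := h.injOn hG hs' ht (hsu'.trans htw.symm)
      subst this
      exact ⟨s, hs, t', ht', hsu, htw', hlt'.trans hlt⟩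
  intro v hv
  obtain ⟨s, hs, t, ht, hsu, htw, hlt⟩ := key v v hv
  have := h.injOn hG hs ht (hsu.trans htw.symm)
  omega

theorem card_le_masNumber (hG : ∀ a, G.Adj a a) (h : GreedyGame G τ ctx a U) :
    τ.card ≤ masNumber G := by
  classical
  rw [← Finset.card_image_of_injOn (h.injOn hG)]
  exact Finset.le_sup (f := Finset.card)
    (Finset.mem_filter.2 ⟨Finset.mem_univ _, h.isAcyclic hG⟩)

/-- What an earlier move dominates is missing from all later undominated sets, under any context;
hence every vertex is gained at most once. -/
theorem disjoint_gain (h : GreedyGame G τ ctx a U) {s t : ℕ} (hs : s ∈ τ) (ht : t ∈ τ)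
    (hst : s ≠ t) : Disjoint (outNbr G {a s} ∩ U s) (outNbr G {a t} ∩ U t) := by
  rcases lt_or_gt_of_ne hst with hlt | hlt
  · exact (h.undominated s hs t ht hlt).mono Finset.inter_subset_left Finset.inter_subset_right
  · exact ((h.undominated t ht s hs hlt).mono Finset.inter_subset_left
      Finset.inter_subset_right).symm

theorem mem_gain (hG : ∀ a, G.Adj a a) (h : GreedyGame G τ ctx a U) {t : ℕ} (ht : t ∈ τ) :
    a t ∈ outNbr G {a t} ∩ U t :=
  Finset.mem_inter.2 ⟨mem_outNbr_singleton.2 (hG _), h.mem t ht⟩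

theorem sum_gain (h : GreedyGame G τ ctx a U) :
    ∑ t ∈ τ, (outNbr G {a t} ∩ U t).card = (τ.biUnion fun t => outNbr G {a t} ∩ U t).card :=
  (Finset.card_biUnion fun _ hs _ ht hst => h.disjoint_gain hs ht hst).symm

/-- If the vertices newly dominated from time `t` on number at most `D` times those newly
dominated at time `t`, then the game is short. -/
theorem card_le_of_tail_le (hG : ∀ a, G.Adj a a) (h : GreedyGame G τ ctx a U) (D : ℕ)
    (hD : ∀ t ∈ τ, ((τ.filter (t ≤ ·)).biUnion fun t => outNbr G {a t} ∩ U t).card ≤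
      D * (outNbr G {a t} ∩ U t).card) :
    (τ.card : ℝ) ≤ D * (1 + Real.log (Fintype.card V)) := by
  rcases τ.eq_empty_or_nonempty with rfl | hne
  · simp only [Finset.card_empty, Nat.cast_zero]
    have : 0 ≤ Real.log (Fintype.card V : ℝ) := Real.log_natCast_nonneg _
    positivity
  have hpos : ∀ t ∈ τ, 1 ≤ (outNbr G {a t} ∩ U t).card := fun t ht =>
    Finset.card_pos.2 ⟨_, h.mem_gain hG ht⟩
  refine (card_le_mul_one_add_log (fun t => (outNbr G {a t} ∩ U t).card) D τ hne hpos
    fun t ht => ?_).trans ?_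
  · have := hD t ht
    rw [← (h.subset (Finset.filter_subset _ _)).sum_gain] at this
    exact_mod_cast this
  · have h1 : 1 ≤ ∑ t ∈ τ, (outNbr G {a t} ∩ U t).card := by
      obtain ⟨t, ht⟩ := hne
      exact (hpos t ht).trans (Finset.single_le_sum
        (f := fun t => (outNbr G {a t} ∩ U t).card) (fun _ _ => Nat.zero_le _) ht)
    have h2 : ∑ t ∈ τ, (outNbr G {a t} ∩ U t).card ≤ Fintype.card V := by
      rw [h.sum_gain]; exact Finset.card_le_univ _
    gcongr

/-- Under a single context the undominated sets shrink. All later gains were thus available at time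
t and can be compared with the greedy choice made there. -/
theorem tail_subset (h : GreedyGame G τ ctx a U) (hctx : ∀ s ∈ τ, ∀ t ∈ τ, ctx s = ctx t)
    {t : ℕ} (ht : t ∈ τ) :
    ((τ.filter (t ≤ ·)).biUnion fun t => outNbr G {a t} ∩ U t) ⊆ U t := by
  intro v hv
  obtain ⟨s, hs, hvs⟩ := Finset.mem_biUnion.1 hv
  obtain ⟨hs, hts⟩ := Finset.mem_filter.1 hs
  rcases hts.eq_or_lt with rfl | hlt
  · exact (Finset.mem_inter.1 hvs).2
  · exact h.antitone t ht s hs hlt (hctx _ ht _ hs) (Finset.mem_inter.1 hvs).2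

/-- Under a single context, the vertices taken dominate a set which is hard to dominate. -/
theorem exists_dominated (hG : ∀ a, G.Adj a a) (h : GreedyGame G τ ctx a U)
    (hctx : ∀ s ∈ τ, ∀ t ∈ τ, ctx s = ctx t) :
    ∃ Z : Finset V, Z ⊆ (τ.biUnion fun t => outNbr G {a t} ∩ U t) ∧
      τ.image a ⊆ Z ∧ Z ⊆ outNbr G (τ.image a) ∧
      ((τ.image a).card : ℝ) ≤ domNumber G Z * (1 + Real.log (Fintype.card V)) := by
  classical
  rcases τ.eq_empty_or_nonempty with rfl | hne
  · refine ⟨∅, by simp, by simp, by simp, ?_⟩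
    have : 0 ≤ Real.log (Fintype.card V : ℝ) := Real.log_natCast_nonneg _
    simp only [Finset.image_empty, Finset.card_empty, Nat.cast_zero]
    positivity
  set W : ℕ → Finset V := fun t =>
    (τ.filter (t ≤ ·)).biUnion fun t => outNbr G {a t} ∩ U t with hW
  -- One set has to serve for all times. Each time gets a candidate, its tail enlarged by all
  -- vertices taken, and the candidate that is hardest to dominate is selected.
  set Z : ℕ → Finset V := fun t => (τ.image a) ∪ W t with hZ
  obtain ⟨t₀, ht₀, hmax⟩ := Finset.exists_max_image τ (fun t => domNumber G (Z t)) hne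
  have hWsub : ∀ t, W t ⊆ τ.biUnion fun t => outNbr G {a t} ∩ U t := fun t =>
    Finset.biUnion_subset_biUnion_of_subset_left _ (Finset.filter_subset _ _)
  refine ⟨Z t₀, ?_, Finset.subset_union_left, ?_, ?_⟩
  · refine Finset.union_subset ?_ (hWsub _)
    intro v hv
    obtain ⟨t, ht, rfl⟩ := Finset.mem_image.1 hv
    exact Finset.mem_biUnion.2 ⟨t, ht, h.mem_gain hG ht⟩
  · refine Finset.union_subset (subset_outNbr_self hG _) ((hWsub _).trans ?_)
    intro v hv
    obtain ⟨t, ht, hvt⟩ := Finset.mem_biUnion.1 hv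
    exact mem_outNbr.2 ⟨a t, Finset.mem_image_of_mem _ ht,
      mem_outNbr_singleton.1 (Finset.mem_inter.1 hvt).1⟩
  · rw [Finset.card_image_of_injOn (h.injOn hG)]
    refine h.card_le_of_tail_le hG _ fun t ht => ?_
    refine le_trans (card_le_domNumber_mul hG (W := W t) (Z := Z t)
      (g := (outNbr G {a t} ∩ U t).card) Finset.subset_union_right fun j hj => ?_)
      (Nat.mul_le_mul_right _ (hmax t ht))
    have hWU : W t ⊆ U t := h.tail_subset hctx ht
    by_cases hjU : j ∈ U t
    · exact (Finset.card_le_card (Finset.inter_subset_inter_left hWU)).trans (h.greedy t ht j hjU)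
    -- A vertex of the candidate outside `U t` was taken before t, so it dominates nothing of the
    -- tail and greediness is not needed for it.
    · have : ∃ s ∈ τ, s < t ∧ a s = j := by
        rcases Finset.mem_union.1 hj with hj | hj
        · obtain ⟨s, hs, rfl⟩ := Finset.mem_image.1 hj
          refine ⟨s, hs, ?_, rfl⟩
          by_contra hts
          exact hjU (hWU (Finset.mem_biUnion.2
            ⟨s, Finset.mem_filter.2 ⟨hs, not_lt.1 hts⟩, h.mem_gain hG hs⟩))
        · exact absurd (hWU hj) hjU
      obtain ⟨s, hs, hst, rfl⟩ := this
      have hd : Disjoint (outNbr G {a s}) (W t) := (h.undominated s hs t ht hst).mono_right hWU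
      rw [Finset.disjoint_iff_inter_eq_empty.1 hd]
      simp

/-- Out-degrees within the tail at t are at most the gain at t, by greediness, so
`exists_isIndep_card_le` finds an independent set in the tail of size at least tail / (2 · gain). A
largest independent set of gained vertices is at least as large for every t. -/
theorem exists_isIndep (hG : ∀ a, G.Adj a a) (h : GreedyGame G τ ctx a U)
    (hctx : ∀ s ∈ τ, ∀ t ∈ τ, ctx s = ctx t) :
    ∃ I : Finset V, I ⊆ (τ.biUnion fun t => outNbr G {a t} ∩ U t) ∧ IsIndep G I ∧
      (τ.card : ℝ) ≤ (2 * I.card : ℕ) * (1 + Real.log (Fintype.card V)) := by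
  classical
  obtain ⟨I, hI, hmax⟩ := Finset.exists_max_image
    ((τ.biUnion fun t => outNbr G {a t} ∩ U t).powerset.filter fun I => IsIndep G I) Finset.card
    ⟨∅, Finset.mem_filter.2 ⟨Finset.empty_mem_powerset _, by simp [IsIndep]⟩⟩
  obtain ⟨hIsub, hind⟩ := Finset.mem_filter.1 hI
  refine ⟨I, Finset.mem_powerset.1 hIsub, hind, h.card_le_of_tail_le hG _ fun t ht => ?_⟩
  have hWU := h.tail_subset hctx ht
  obtain ⟨I', hI', hind', hcard⟩ := exists_isIndep_card_le hG
    (g := (outNbr G {a t} ∩ U t).card) _ fun w hw =>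
      (Finset.card_le_card (Finset.inter_subset_inter_left hWU)).trans (h.greedy t ht w (hWU hw))
  have hle : I'.card ≤ I.card := hmax I' (Finset.mem_filter.2 ⟨Finset.mem_powerset.2 (hI'.trans
    (Finset.biUnion_subset_biUnion_of_subset_left _ (Finset.filter_subset _ _))), hind'⟩)
  calc _ ≤ _ := hcard
    _ ≤ _ := by nlinarith

end GreedyGame

end Game

end GraphBandit

/-! ### Length of the greedy game with M contexts -/

namespace GraphBandit

namespace GreedyGame

variable {V : Type*} [Fintype V] [DecidableEq V] {G : Digraph V} {M : ℕ} {τ : Finset ℕ}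
  {ctx : ℕ → Fin M} {a : ℕ → V} {U : ℕ → Finset V}

theorem disjoint_gains (h : GreedyGame G τ ctx a U) {i j : Fin M} (hij : i ≠ j) :
    Disjoint ((τ.filter (ctx · = i)).biUnion fun t => outNbr G {a t} ∩ U t)
      ((τ.filter (ctx · = j)).biUnion fun t => outNbr G {a t} ∩ U t) := by
  refine (Finset.disjoint_biUnion_left _ _ _).2 fun s hs =>
    (Finset.disjoint_biUnion_right _ _ _).2 fun t ht => ?_
  obtain ⟨hs, hsi⟩ := Finset.mem_filter.1 hs
  obtain ⟨ht, htj⟩ := Finset.mem_filter.1 ht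
  exact h.disjoint_gain hs ht (by rintro rfl; exact hij (hsi.symm.trans htj))

theorem card_eq_sum (τ : Finset ℕ) (ctx : ℕ → Fin M) :
    τ.card = ∑ c, (τ.filter (ctx · = c)).card :=
  Finset.card_eq_sum_card_fiberwise fun _ _ => Finset.mem_coe.2 (Finset.mem_univ _)

theorem same_ctx (τ : Finset ℕ) (ctx : ℕ → Fin M) (c : Fin M) :
    ∀ s ∈ τ.filter (ctx · = c), ∀ t ∈ τ.filter (ctx · = c), ctx s = ctx t := fun _ hs _ ht =>
  (Finset.mem_filter.1 hs).2.trans (Finset.mem_filter.1 ht).2.symm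

/-- The length of the greedy game is at most `β_dom`. -/
theorem card_le_betaDom (hG : ∀ a, G.Adj a a) (h : GreedyGame G τ ctx a U) :
    τ.card ≤ betaDom G M := by
  classical
  have hsub : ∀ c, τ.filter (ctx · = c) ⊆ τ := fun c => Finset.filter_subset _ _
  choose W hW using fun c => (h.subset (hsub c)).exists_dominated hG (same_ctx τ ctx c)
  have hcard : τ.card = ∑ c, ((τ.filter (ctx · = c)).image a).card := by
    rw [card_eq_sum τ ctx]
    exact Finset.sum_congr rfl fun c _ =>
      (Finset.card_image_of_injOn ((h.subset (hsub c)).injOn hG)).symm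
  rw [hcard]
  refine Finset.le_sup (f := fun B : Fin M → Finset V => ∑ c, (B c).card)
    (b := fun c => (τ.filter (ctx · = c)).image a)
    (Finset.mem_filter.2 ⟨Finset.mem_univ _, ?_, W, fun i j hij => ?_, fun c => (hW c).2⟩)
  · have : (Finset.univ.biUnion fun c => (τ.filter (ctx · = c)).image a) = τ.image a := by
      ext v
      simp only [Finset.mem_biUnion, Finset.mem_image, Finset.mem_filter, Finset.mem_univ, true_and]
      constructor
      · rintro ⟨c, t, ⟨ht, -⟩, rfl⟩
        exact ⟨t, ht, rfl⟩
      · rintro ⟨t, ht, rfl⟩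
        exact ⟨ctx t, t, ⟨ht, rfl⟩, rfl⟩
    convert h.isAcyclic hG
  · exact (h.disjoint_gains hij).mono (hW i).1 (hW j).1

/-- The length of the greedy game is at most `β̄_M` up to a logarithm. -/
theorem card_le_betaBar (hG : ∀ a, G.Adj a a) (h : GreedyGame G τ ctx a U) :
    (τ.card : ℝ) ≤ 2 * (1 + Real.log (Fintype.card V)) * betaBar G M := by
  classical
  have hsub : ∀ c, τ.filter (ctx · = c) ⊆ τ := fun c => Finset.filter_subset _ _
  choose I hI using fun c => (h.subset (hsub c)).exists_isIndep hG (same_ctx τ ctx c)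
  have hle : ∑ c, (I c).card ≤ betaBar G M :=
    Finset.le_sup (f := fun B : Fin M → Finset V => ∑ c, (B c).card) (b := I)
      (Finset.mem_filter.2 ⟨Finset.mem_univ _, fun c => (hI c).2.1, fun i j hij =>
        (h.disjoint_gains hij).mono (hI i).1 (hI j).1⟩)
  have hlog : 0 ≤ Real.log (Fintype.card V : ℝ) := Real.log_natCast_nonneg _
  calc (τ.card : ℝ) = ∑ c, ((τ.filter (ctx · = c)).card : ℝ) := by
        rw [card_eq_sum τ ctx]; push_cast; rfl
    _ ≤ ∑ c, ((2 * (I c).card : ℕ) : ℝ) * (1 + Real.log (Fintype.card V)) :=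
        Finset.sum_le_sum fun c _ => (hI c).2.2
    _ = 2 * (1 + Real.log (Fintype.card V)) * (∑ c, (I c).card : ℕ) := by
        rw [← Finset.sum_mul]; push_cast; rw [← Finset.mul_sum]; ring
    _ ≤ _ := by gcongr

/-- On transitively closed graphs, no two vertices taken under the same context are adjacent. -/
theorem ctx_ne_of_adj (hG : ∀ a, G.Adj a a)
    (htrans : ∀ a b c, G.Adj a b → G.Adj b c → G.Adj a c) (h : GreedyGame G τ ctx a U)
    {s t : ℕ} (hs : s ∈ τ) (ht : t ∈ τ) (hst : s ≠ t) (hadj : G.Adj (a s) (a t)) :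
    ctx s ≠ ctx t := by
  intro hc
  have hts : t < s := by
    rcases lt_or_gt_of_ne hst with hlt | hlt
    · exact absurd hadj (h.not_adj hs ht hlt)
    · exact hlt
  have hU := h.antitone t ht s hs hts hc.symm
  have hmem : a s ∈ U t := hU (h.mem s hs)
  -- The later vertex `a s` would have been the better move at time t: by transitivity it dominates
  -- all that `a t` dominates, and also itself, which `a t` does not.
  have hle := h.greedy t ht (a s) hmem
  refine absurd hle (not_le.2 (Finset.card_lt_card (Finset.ssubset_iff_subset_ne.2 ⟨?_, ?_⟩)))
  · refine Finset.inter_subset_inter_right fun v hv => ?_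
    exact mem_outNbr_singleton.2 (htrans _ _ _ hadj (mem_outNbr_singleton.1 hv))
  · intro he
    have : a s ∈ outNbr G {a t} ∩ U t := by
      rw [he]; exact Finset.mem_inter.2 ⟨mem_outNbr_singleton.2 (hG _), hmem⟩
    exact h.not_adj ht hs hts (mem_outNbr_singleton.1 (Finset.mem_inter.1 this).1)

/-- A level function on the vertices taken shows that the game is at most as long as `β_M`. -/
theorem card_le_beta_of_level (hG : ∀ a, G.Adj a a) (h : GreedyGame G τ ctx a U)
    (lev : ℕ → Fin M)
    (hlev : ∀ s ∈ τ, ∀ t ∈ τ, s ≠ t → G.Adj (a s) (a t) → lev t < lev s) :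
    τ.card ≤ beta G M := by
  classical
  have hsub : ∀ c, τ.filter (lev · = c) ⊆ τ := fun c => Finset.filter_subset _ _
  have hcard : τ.card = ∑ c, ((τ.filter (lev · = c)).image a).card := by
    rw [card_eq_sum τ lev]
    exact Finset.sum_congr rfl fun c _ =>
      (Finset.card_image_of_injOn ((h.subset (hsub c)).injOn hG)).symm
  rw [hcard]
  refine Finset.le_sup (f := fun B : Fin M → Finset V => ∑ c, (B c).card)
    (b := fun c => (τ.filter (lev · = c)).image a)
    (Finset.mem_filter.2 ⟨Finset.mem_univ _, fun c u hu v hv huv hadj => ?_,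
      fun i j hij u hu v hv hadj => ?_⟩)
  · obtain ⟨s, hs, rfl⟩ := Finset.mem_image.1 hu
    obtain ⟨t, ht, rfl⟩ := Finset.mem_image.1 hv
    obtain ⟨hs, hsc⟩ := Finset.mem_filter.1 hs
    obtain ⟨ht, htc⟩ := Finset.mem_filter.1 ht
    have := hlev s hs t ht (by rintro rfl; exact huv rfl) hadj
    rw [hsc, htc] at this
    exact lt_irrefl _ this
  · obtain ⟨s, hs, rfl⟩ := Finset.mem_image.1 hu
    obtain ⟨t, ht, rfl⟩ := Finset.mem_image.1 hv
    obtain ⟨hs, hsc⟩ := Finset.mem_filter.1 hs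
    obtain ⟨ht, htc⟩ := Finset.mem_filter.1 ht
    have := hlev s hs t ht (by rintro rfl; rw [hsc] at htc; exact hij.ne htc) hadj
    rw [hsc, htc] at this
    exact lt_asymm hij this

/-- An edge and its reverse cannot both point backwards in time, so distinct vertices taken are
never adjacent and the contexts serve as levels vacuously. -/
theorem card_le_beta_of_symm (hG : ∀ a, G.Adj a a) (hsymm : ∀ a b, G.Adj a b → G.Adj b a)
    (h : GreedyGame G τ ctx a U) : τ.card ≤ beta G M := by
  refine h.card_le_beta_of_level hG ctx fun s hs t ht hst hadj => ?_
  rcases lt_or_gt_of_ne hst with hlt | hlt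
  · exact absurd hadj (h.not_adj hs ht hlt)
  · exact absurd (hsymm _ _ hadj) (h.not_adj ht hs hlt)

open Classical in
/-- The length of the longest path of vertices taken that starts from `a t`. -/
noncomputable def height (G : Digraph V) (τ : Finset ℕ) (a : ℕ → V) (t : ℕ) : ℕ :=
  ((Finset.range t).attach.filter fun s => s.1 ∈ τ ∧ G.Adj (a t) (a s.1)).sup
    fun s => height G τ a s.1 + 1
termination_by t
decreasing_by exact Finset.mem_range.1 s.2

/-- The recursion for `height` looks at earlier times only; this loses no edge between vertices
taken, as all of them point to earlier times. -/
theorem height_lt (h : GreedyGame G τ ctx a U) {s t : ℕ} (hs : s ∈ τ) (ht : t ∈ τ) (hst : s ≠ t)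
    (hadj : G.Adj (a s) (a t)) : height G τ a t < height G τ a s := by
  classical
  have hts : t < s := by
    rcases lt_or_gt_of_ne hst with hlt | hlt
    · exact absurd hadj (h.not_adj hs ht hlt)
    · exact hlt
  rw [height.eq_1 G τ a s]
  exact Nat.lt_of_succ_le (Finset.le_sup
    (f := fun s' : {x // x ∈ Finset.range s} => height G τ a s'.1 + 1)
    (b := ⟨t, Finset.mem_range.2 hts⟩) (by simp [ht, hadj]))

/-- Along a longest path from `a t`, transitivity makes each vertex adjacent to all later ones on
the path, so `ctx_ne_of_adj` makes the contexts pairwise different. Hence heights stay below the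
number of contexts. -/
theorem exists_contexts (hG : ∀ a, G.Adj a a)
    (htrans : ∀ a b c, G.Adj a b → G.Adj b c → G.Adj a c) (h : GreedyGame G τ ctx a U)
    (t : ℕ) (ht : t ∈ τ) :
    ∃ X : Finset (Fin M), X.card = height G τ a t + 1 ∧
      ∀ c ∈ X, ∃ s ∈ τ, s ≤ t ∧ ctx s = c ∧ G.Adj (a t) (a s) := by
  classical
  induction t using Nat.strong_induction_on with
  | _ t ih =>
    rcases Nat.eq_zero_or_pos (height G τ a t) with h0 | hpos
    · exact ⟨{ctx t}, by simp [h0], by simpa using ⟨t, ht, le_rfl, rfl, hG _⟩⟩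
    · have hne : ((Finset.range t).attach.filter
          fun s => s.1 ∈ τ ∧ G.Adj (a t) (a s.1)).Nonempty := by
        by_contra hcon
        rw [Finset.not_nonempty_iff_eq_empty] at hcon
        rw [height, hcon] at hpos
        simp at hpos
      obtain ⟨⟨s, hst⟩, hs, hsup⟩ := Finset.exists_mem_eq_sup _ hne
        (fun s : {x // x ∈ Finset.range t} => height G τ a s.1 + 1)
      obtain ⟨-, hsτ, hadj⟩ := Finset.mem_filter.1 hs
      rw [← height.eq_1 G τ a t] at hsup
      have hst' := Finset.mem_range.1 hst
      obtain ⟨X, hX, hXs⟩ := ih s hst' hsτ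
      have hnot : ctx t ∉ X := by
        intro hm
        obtain ⟨s', hs', hle, hc, hadj'⟩ := hXs _ hm
        exact h.ctx_ne_of_adj hG htrans ht hs' (by omega) (htrans _ _ _ hadj hadj') hc.symm
      refine ⟨insert (ctx t) X, ?_, fun c hc => ?_⟩
      · rw [Finset.card_insert_of_notMem hnot, hX, hsup]
      · rcases Finset.mem_insert.1 hc with rfl | hc
        · exact ⟨t, ht, le_rfl, rfl, hG _⟩
        · obtain ⟨s', hs', hle, hc, hadj'⟩ := hXs _ hc
          exact ⟨s', hs', by omega, hc, htrans _ _ _ hadj hadj'⟩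

theorem card_le_beta_of_trans (hG : ∀ a, G.Adj a a)
    (htrans : ∀ a b c, G.Adj a b → G.Adj b c → G.Adj a c) (h : GreedyGame G τ ctx a U) :
    τ.card ≤ beta G M := by
  rcases τ.eq_empty_or_nonempty with rfl | ⟨t₀, ht₀⟩
  · simp
  have hlt : ∀ t ∈ τ, height G τ a t < M := fun t ht => by
    obtain ⟨X, hX, -⟩ := h.exists_contexts hG htrans t ht
    have := Finset.card_le_univ X
    rw [Fintype.card_fin] at this
    omega
  refine h.card_le_beta_of_level hG
    -- The minimum only serves to give times outside τ a value in `Fin M`; on τ it equals the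
    -- height.
    (fun t => ⟨min (height G τ a t) (M - 1), by have := hlt t₀ ht₀; omega⟩)
    fun s hs t ht hst hadj => ?_
  have h1 := h.height_lt hs ht hst hadj
  have h2 := hlt s hs
  have h3 := hlt t ht
  simp only [Fin.mk_lt_mk]
  omega

end GreedyGame

theorem greedyGame_single {V ι : Type*} [Fintype V] [DecidableEq V] (G : Digraph V) (c : ι)
    (v : V) : GreedyGame G {0} (fun _ => c) (fun _ => v) (fun _ => {v}) where
  mem := by simp
  greedy := by simp
  undominated := by simp
  antitone := by simp

/-! ### Positivity of the graph quantities, from a game with one move -/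

section Positivity

variable {K M : ℕ} {G : Digraph (Fin K)}

theorem one_le_betaBar (hK : 0 < K) (hM : 0 < M) (hG : ∀ a, G.Adj a a) : 1 ≤ betaBar G M := by
  have := (greedyGame_single G (⟨0, hM⟩ : Fin M) ⟨0, hK⟩).card_le_betaBar hG
  rw [Nat.one_le_iff_ne_zero]
  intro h0
  rw [h0] at this
  norm_num at this

theorem one_le_masNumber (hK : 0 < K) (hG : ∀ a, G.Adj a a) : 1 ≤ masNumber G :=
  (greedyGame_single G () ⟨0, hK⟩).card_le_masNumber hG

theorem one_le_beta (hK : 0 < K) (hM : 0 < M) (hG : ∀ a, G.Adj a a) : 1 ≤ beta G M :=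
  (greedyGame_single G (⟨0, hM⟩ : Fin M) ⟨0, hK⟩).card_le_beta_of_level hG (fun _ => ⟨0, hM⟩)
    (by simp)

theorem one_le_betaDom (hK : 0 < K) (hM : 0 < M) (hG : ∀ a, G.Adj a a) : 1 ≤ betaDom G M :=
  (greedyGame_single G (⟨0, hM⟩ : Fin M) ⟨0, hK⟩).card_le_betaDom hG

end Positivity

end GraphBandit

namespace GraphBandit

/-! ### Deterministic analysis of layered arm elimination -/

open Classical in
/-- The number of observations of the arm `a`. -/
noncomputable def obsCount {M K : ℕ} (G : Digraph (Fin K)) (a : Fin K) (h : List (Round M K)) : ℕ :=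
  (h.map fun x => if G.Adj x.2.1 a then 1 else 0).sum

/-- All empirical means are close to the true means. -/
def Concentrated {M K : ℕ} (G : Digraph (Fin K)) (μ : Fin M → Fin K → ℝ) (B : ℝ)
    (h : List (Round M K)) : Prop :=
  ∀ c a, 0 < obsCount G a h → |empMean G h c a - μ c a| ≤ Real.sqrt (B / obsCount G a h)

section State

variable {M K T : ℕ} {G : Digraph (Fin K)} {δ : ℝ} {h : List (Round M K)} {x : Round M K}

theorem advance_snd_subset (D : ℕ → Finset (Fin K)) (c : Fin M) (s : ℕ × Finset (Fin K)) :
    (advance G T δ h D c s).2 ⊆ s.2 := by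
  unfold advance
  split_ifs
  · exact Finset.filter_subset _ _
  · exact subset_rfl

theorem advance_snd_nonempty (D : ℕ → Finset (Fin K)) (c : Fin M) (s : ℕ × Finset (Fin K))
    (hs : s.2.Nonempty) : (advance G T δ h D c s).2.Nonempty := by
  unfold advance
  split_ifs
  · obtain ⟨a, ha, hmax⟩ := Finset.exists_max_image s.2 (empMean G h c) hs
    refine ⟨a, Finset.mem_filter.2 ⟨ha, fun a' ha' => ?_⟩⟩
    have := hmax a' ha'
    have := Real.sqrt_nonneg (Real.log (2 * M * K * T / δ) / s.1)
    linarith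
  · exact hs

theorem chosen_cons : (algState G T δ (x :: h)).chosen =
    Function.update (algState G T δ h).chosen ((algState G T δ h).layer x.1)
      (insert x.2.1 ((algState G T δ h).chosen ((algState G T δ h).layer x.1))) := rfl

theorem next_eq (c : Fin M) :
    ((algState G T δ (x :: h)).layer c, (algState G T δ (x :: h)).active c) =
      (advance G T δ (x :: h) (algState G T δ (x :: h)).chosen c)^[h.length + 1]
        ((algState G T δ h).layer c, (algState G T δ h).active c) := rfl

theorem chosen_subset_cons (ℓ : ℕ) :
    (algState G T δ h).chosen ℓ ⊆ (algState G T δ (x :: h)).chosen ℓ := by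
  rw [chosen_cons, Function.update_apply]
  split_ifs with hℓ
  · rw [hℓ]; exact Finset.subset_insert _ _
  · exact subset_rfl

theorem mem_chosen_cons :
    x.2.1 ∈ (algState G T δ (x :: h)).chosen ((algState G T δ h).layer x.1) := by
  rw [chosen_cons, Function.update_self]; exact Finset.mem_insert_self _ _

/-- An invariant of `advance` passes from one state of the algorithm to the next. -/
theorem next_induction (c : Fin M) (P : ℕ × Finset (Fin K) → Prop)
    (h0 : P ((algState G T δ h).layer c, (algState G T δ h).active c))
    (hP : ∀ s, P s → P (advance G T δ (x :: h) (algState G T δ (x :: h)).chosen c s)) :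
    P ((algState G T δ (x :: h)).layer c, (algState G T δ (x :: h)).active c) := by
  rw [next_eq]
  exact Function.Iterate.rec P h0 hP _

theorem active_cons_subset (c : Fin M) :
    (algState G T δ (x :: h)).active c ⊆ (algState G T δ h).active c :=
  next_induction (x := x) (h := h) c (fun s => s.2 ⊆ (algState G T δ h).active c) subset_rfl
    fun _ hs => (advance_snd_subset _ _ _).trans hs

/-- Every round writes on one layer only. This limits how far a context can climb after a round. -/
theorem exists_chosen_support (h : List (Round M K)) :
    ∃ X : Finset ℕ, X.card ≤ h.length ∧ ∀ ℓ, ((algState G T δ h).chosen ℓ).Nonempty → ℓ ∈ X := by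
  induction h with
  | nil => exact ⟨∅, by simp, by simp [algState]⟩
  | cons x h ih =>
    obtain ⟨X, hX, hsupp⟩ := ih
    refine ⟨insert ((algState G T δ h).layer x.1) X,
      (Finset.card_insert_le _ _).trans (by simpa using hX), fun ℓ hℓ => ?_⟩
    rw [chosen_cons, Function.update_apply] at hℓ
    split_ifs at hℓ with he
    · exact he ▸ Finset.mem_insert_self _ _
    · exact Finset.mem_insert_of_mem (hsupp ℓ hℓ)

theorem active_nonempty (hK : 0 < K) (h : List (Round M K)) (c : Fin M) :
    ((algState G T δ h).active c).Nonempty := by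
  induction h with
  | nil => exact ⟨⟨0, hK⟩, by simp [algState]⟩
  | cons x h ih =>
    exact next_induction (x := x) (h := h) c (fun s => s.2.Nonempty) ih
      fun _ hs => advance_snd_nonempty _ _ _ hs

theorem outNbr_empty : outNbr G ∅ = ∅ := by
  ext v; simp [mem_outNbr]

/-- After a round, no active set has been observed entirely on its current layer. -/
theorem active_not_subset (hK : 0 < K) (h : List (Round M K)) (c : Fin M) :
    ¬ (algState G T δ h).active c ⊆
      outNbr G ((algState G T δ h).chosen ((algState G T δ h).layer c)) := by
  cases h with
  | nil =>
    intro hsub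
    have : (⟨0, hK⟩ : Fin K) ∈ outNbr G ∅ := hsub (by simp [algState])
    rw [outNbr_empty] at this
    simp at this
  | cons x h =>
    set f := advance G T δ (x :: h) (algState G T δ (x :: h)).chosen c with hf
    set s₀ := ((algState G T δ h).layer c, (algState G T δ h).active c) with hs₀
    have hne : ∀ n, (f^[n] s₀).2.Nonempty := fun n =>
      Function.Iterate.rec (fun s : ℕ × Finset (Fin K) => s.2.Nonempty) (active_nonempty hK h c)
        (fun _ hs => advance_snd_nonempty _ _ _ hs) n
    -- either some step is stuck, or every step moves up through a nonempty layer
    have key : ∀ n, (¬ (f^[n] s₀).2 ⊆ outNbr G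
        ((algState G T δ (x :: h)).chosen (f^[n] s₀).1)) ∨
        ((f^[n] s₀).1 = s₀.1 + n ∧ ∀ j < n,
          ((algState G T δ (x :: h)).chosen (s₀.1 + j)).Nonempty) := by
      intro n
      induction n with
      | zero => exact Or.inr ⟨rfl, by simp⟩
      | succ n ih =>
        rw [Function.iterate_succ_apply']
        by_cases hsub : (f^[n] s₀).2 ⊆ outNbr G
            ((algState G T δ (x :: h)).chosen (f^[n] s₀).1)
        · rcases ih with hc | ⟨h1, h2⟩
          · exact absurd hsub hc
          · right
            refine ⟨?_, fun j hj => ?_⟩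
            · rw [hf, advance, if_pos hsub]
              show (f^[n] s₀).1 + 1 = _
              omega
            · rcases Nat.lt_succ_iff_lt_or_eq.1 hj with hj | rfl
              · exact h2 j hj
              · rw [← h1]
                obtain ⟨a, ha⟩ := hne j
                obtain ⟨u, hu, -⟩ := mem_outNbr.1 (hsub ha)
                exact ⟨u, hu⟩
        · left
          have : f (f^[n] s₀) = f^[n] s₀ := by
            conv_lhs => rw [hf, advance, if_neg hsub]
          rwa [this]
    have hn := next_eq (G := G) (T := T) (δ := δ) (x := x) (h := h) c
    rw [← hf, ← hs₀] at hn
    rcases key (h.length + 1) with hk | ⟨h1, h2⟩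
    · rw [← hn] at hk; exact hk
    · intro hsub
      rw [← hn] at h1
      simp only at h1
      obtain ⟨a, ha⟩ := active_nonempty (T := T) (δ := δ) (G := G) hK (x :: h) c
      obtain ⟨u, hu, -⟩ := mem_outNbr.1 (hsub ha)
      obtain ⟨X, hX, hsupp⟩ := exists_chosen_support (G := G) (T := T) (δ := δ) (x :: h)
      -- The `h.length + 1` layers just left and the current one would all be nonempty: one layer
      -- more than the rounds of `x :: h` can fill.
      have hsubX : (Finset.range (h.length + 2)).image (s₀.1 + ·) ⊆ X := by
        intro ℓ hℓ
        obtain ⟨j, hj, rfl⟩ := Finset.mem_image.1 hℓ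
        refine hsupp _ ?_
        rcases Nat.lt_succ_iff_lt_or_eq.1 (Finset.mem_range.1 hj) with hj | rfl
        · exact h2 j hj
        · rw [← h1]; exact ⟨u, hu⟩
      have := Finset.card_le_card hsubX
      rw [Finset.card_image_of_injective _ (add_right_injective _), Finset.card_range] at this
      simp only [List.length_cons] at hX
      omega

theorem one_le_layer (h : List (Round M K)) (c : Fin M) : 1 ≤ (algState G T δ h).layer c := by
  induction h with
  | nil => simp [algState]
  | cons x h ih =>
    refine next_induction (x := x) (h := h) c (fun s => 1 ≤ s.1) ih fun s hs => ?_
    unfold advance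
    split_ifs
    · exact Nat.le_succ_of_le hs
    · exact hs

/-- An active set has been observed entirely on all previous layers. -/
theorem active_subset_outNbr (h : List (Round M K)) (c : Fin M) :
    ∀ j, 1 ≤ j → j < (algState G T δ h).layer c →
      (algState G T δ h).active c ⊆ outNbr G ((algState G T δ h).chosen j) := by
  induction h with
  | nil => intro j h1 h2; simp [algState] at h2; omega
  | cons x h ih =>
    refine next_induction (x := x) (h := h) c (fun s => ∀ j, 1 ≤ j → j < s.1 →
      s.2 ⊆ outNbr G ((algState G T δ (x :: h)).chosen j))
      (fun j h1 h2 => (ih j h1 h2).trans (outNbr_mono (chosen_subset_cons j)))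
      fun s hs j h1 h2 => ?_
    unfold advance at h2 ⊢
    split_ifs at h2 ⊢ with hsub
    · refine (Finset.filter_subset _ _).trans ?_
      rcases Nat.lt_succ_iff_lt_or_eq.1 h2 with h2 | rfl
      · exact hs j h1 h2
      · exact hsub
    · exact hs j h1 h2

theorem obsCount_cons (a : Fin K) [Decidable (G.Adj x.2.1 a)] :
    obsCount G a (x :: h) = (if G.Adj x.2.1 a then 1 else 0) + obsCount G a h := by
  unfold obsCount
  rw [List.map_cons, List.sum_cons]
  congr

/-- A round belongs to a single layer, so observations of `a` on different layers come from
different rounds. This turns completed layers into sample size. -/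
theorem card_le_obsCount (a : Fin K) (h : List (Round M K)) (Y : Finset ℕ)
    (hY : ∀ j ∈ Y, a ∈ outNbr G ((algState G T δ h).chosen j)) : Y.card ≤ obsCount G a h := by
  classical
  induction h generalizing Y with
  | nil =>
    rcases Y.eq_empty_or_nonempty with rfl | ⟨j, hj⟩
    · simp
    · have h0 : a ∈ outNbr G ∅ := hY j hj
      rw [outNbr_empty] at h0
      simp at h0
  | cons x h ih =>
    rw [obsCount_cons]
    have hcase : ∀ j ∈ Y, j ≠ (algState G T δ h).layer x.1 ∨ ¬ G.Adj x.2.1 a →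
        a ∈ outNbr G ((algState G T δ h).chosen j) := by
      intro j hj hor
      have := hY j hj
      rw [chosen_cons, Function.update_apply] at this
      split_ifs at this with he
      · obtain ⟨u, hu, hua⟩ := mem_outNbr.1 this
        rcases Finset.mem_insert.1 hu with rfl | hu
        · rcases hor with hor | hor
          · exact absurd he hor
          · exact absurd hua hor
        · exact mem_outNbr.2 ⟨u, he ▸ hu, hua⟩
      · exact this
    split_ifs with hadj
    · have := ih (Y.erase ((algState G T δ h).layer x.1)) fun j hj =>
        hcase j (Finset.mem_of_mem_erase hj) (Or.inl (Finset.ne_of_mem_erase hj))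
      have := Finset.pred_card_le_card_erase (s := Y) (a := (algState G T δ h).layer x.1)
      omega
    · rw [zero_add]
      exact ih Y fun j hj => hcase j hj (Or.inr hadj)

/-- On concentrated histories, optimal arms stay active and active arms are nearly optimal. -/
theorem active_of_concentrated {μ : Fin M → Fin K → ℝ} (hδ : 0 ≤ Real.log (2 * M * K * T / δ))
    (h : List (Round M K))
    (hc : ∀ h', h' <:+ h → Concentrated G μ (Real.log (2 * M * K * T / δ)) h') (c : Fin M)
    (a₀ : Fin K) (ha₀ : ∀ a, μ c a ≤ μ c a₀) :
    a₀ ∈ (algState G T δ h).active c ∧ (2 ≤ (algState G T δ h).layer c →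
      ∀ a ∈ (algState G T δ h).active c, μ c a₀ - μ c a ≤
        4 * Real.sqrt (Real.log (2 * M * K * T / δ) / ((algState G T δ h).layer c - 1 : ℕ))) := by
  induction h with
  | nil => simp [algState]
  | cons x h ih =>
    have ih := ih fun h' hs => hc h' (hs.trans (List.suffix_cons x h))
    have hcx := hc _ List.suffix_rfl
    -- A context may leave several layers after one round, and every move needs the observation
    -- counts; complete observation of all lower layers is therefore part of the invariant.
    refine (next_induction (x := x) (h := h) c (fun s =>
      (1 ≤ s.1 ∧ ∀ j, 1 ≤ j → j < s.1 → s.2 ⊆ outNbr G ((algState G T δ (x :: h)).chosen j)) ∧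
      a₀ ∈ s.2 ∧ (2 ≤ s.1 → ∀ a ∈ s.2, μ c a₀ - μ c a ≤
        4 * Real.sqrt (Real.log (2 * M * K * T / δ) / (s.1 - 1 : ℕ)))) ?_ ?_).2
    · exact ⟨⟨one_le_layer h c, fun j h1 h2 =>
        (active_subset_outNbr h c j h1 h2).trans (outNbr_mono (chosen_subset_cons j))⟩, ih⟩
    · rintro s ⟨⟨hs1, hsj⟩, hsa, hsg⟩
      unfold advance
      split_ifs with hsub
      swap
      · exact ⟨⟨hs1, hsj⟩, hsa, hsg⟩
      have hdom : ∀ j, 1 ≤ j → j < s.1 + 1 →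
          s.2 ⊆ outNbr G ((algState G T δ (x :: h)).chosen j) := by
        intro j h1 h2
        rcases Nat.lt_succ_iff_lt_or_eq.1 h2 with h2 | rfl
        · exact hsj j h1 h2
        · exact hsub
      have hdev : ∀ a ∈ s.2, |empMean G (x :: h) c a - μ c a| ≤
          Real.sqrt (Real.log (2 * M * K * T / δ) / s.1) := by
        intro a ha
        have hcount : s.1 ≤ obsCount G a (x :: h) := by
          have := card_le_obsCount (T := T) (δ := δ) a (x :: h) (Finset.Icc 1 s.1) fun j hj => by
            obtain ⟨h1, h2⟩ := Finset.mem_Icc.1 hj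
            exact hdom j h1 (by omega) ha
          simpa using this
        refine (hcx c a (by omega)).trans (Real.sqrt_le_sqrt ?_)
        have : (0 : ℝ) < s.1 := by exact_mod_cast hs1
        gcongr
      refine ⟨⟨by simp, fun j h1 h2 => (Finset.filter_subset _ _).trans (hdom j h1 h2)⟩,
        Finset.mem_filter.2 ⟨hsa, fun a' ha' => ?_⟩, fun _ a ha => ?_⟩
      · have h1 := abs_le.1 (hdev a' ha')
        have h2 := abs_le.1 (hdev a₀ hsa)
        have h3 := ha₀ a'
        linarith [h1.2, h2.1]
      -- The factor 4 is two confidence radii from the elimination threshold and one from each of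
      -- the two empirical means.
      · obtain ⟨ha, hkeep⟩ := Finset.mem_filter.1 ha
        have h1 := abs_le.1 (hdev a ha)
        have h2 := abs_le.1 (hdev a₀ hsa)
        have h3 := hkeep a₀ hsa
        simp only [Nat.add_sub_cancel]
        linarith [h1.2, h2.1]

end State

end GraphBandit

/-! ### From layers of bounded size to a regret bound -/

namespace GraphBandit

theorem sum_inv_sqrt_le (n : ℕ) :
    ∑ ℓ ∈ Finset.Icc 1 n, (1 / Real.sqrt ℓ) ≤ 2 * Real.sqrt n := by
  induction n with
  | zero => simp
  | succ n ih =>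
    rw [Finset.sum_Icc_succ_top (by omega)]
    have h1 : (0 : ℝ) < Real.sqrt ((n + 1 : ℕ) : ℝ) := Real.sqrt_pos.2 (by positivity)
    have h2 := Real.sq_sqrt (Nat.cast_nonneg (α := ℝ) n)
    have h3 := Real.sq_sqrt (Nat.cast_nonneg (α := ℝ) (n + 1))
    have h4 := Real.sqrt_nonneg (n : ℝ)
    have h5 : 1 / Real.sqrt ((n + 1 : ℕ) : ℝ) ≤
        2 * Real.sqrt ((n + 1 : ℕ) : ℝ) - 2 * Real.sqrt n := by
      rw [div_le_iff₀ h1]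
      push_cast at *
      nlinarith [sq_nonneg (Real.sqrt ((n : ℝ) + 1) - Real.sqrt n)]
    linarith

/-- If every layer is used at most `N` times, then `T` rounds cost at most `3 √(N T)`. -/
theorem sum_inv_sqrt_layer_le (T : ℕ) (layer : ℕ → ℕ) (N : ℝ) (hN : 0 < N)
    (h1 : ∀ t < T, 1 ≤ layer t)
    (h2 : ∀ ℓ, (((Finset.range T).filter fun t => layer t = ℓ).card : ℝ) ≤ N) :
    ∑ t ∈ Finset.range T, 1 / Real.sqrt (layer t) ≤ 3 * Real.sqrt (N * T) := by
  rcases Nat.eq_zero_or_pos T with rfl | hT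
  · simp
  have hT' : (0 : ℝ) < T := by exact_mod_cast hT
  -- The sum is largest when layers are filled from below, N rounds each, which takes about T / N
  -- layers. Rounds above this threshold contribute at most √(N / T) each.
  set m := ⌊(T : ℝ) / N⌋₊ with hm
  have hTN : 0 < (T : ℝ) / N := by positivity
  rw [← Finset.sum_filter_add_sum_filter_not _ (fun t => layer t ≤ m)]
  have hlow : ∑ t ∈ (Finset.range T).filter (fun t => layer t ≤ m), 1 / Real.sqrt (layer t) ≤
      2 * Real.sqrt (N * T) := by
    rw [← Finset.sum_fiberwise_of_maps_to (s := (Finset.range T).filter (fun t => layer t ≤ m))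
      (t := Finset.Icc 1 m) (g := layer) (fun t ht => by
        obtain ⟨ht, htm⟩ := Finset.mem_filter.1 ht
        exact Finset.mem_Icc.2 ⟨h1 t (Finset.mem_range.1 ht), htm⟩)]
    calc _ ≤ ∑ ℓ ∈ Finset.Icc 1 m, N * (1 / Real.sqrt ℓ) := by
          refine Finset.sum_le_sum fun ℓ _ => ?_
          rw [Finset.sum_congr rfl (g := fun _ => 1 / Real.sqrt (ℓ : ℝ)) fun t ht => by
            rw [(Finset.mem_filter.1 ht).2], Finset.sum_const, nsmul_eq_mul]
          refine mul_le_mul_of_nonneg_right (le_trans ?_ (h2 ℓ)) (by positivity)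
          exact_mod_cast Finset.card_le_card (Finset.filter_subset_filter _
            (Finset.filter_subset _ _))
      _ = N * ∑ ℓ ∈ Finset.Icc 1 m, 1 / Real.sqrt ℓ := by rw [Finset.mul_sum]
      _ ≤ N * (2 * Real.sqrt m) := by gcongr; exact sum_inv_sqrt_le m
      _ ≤ N * (2 * Real.sqrt (T / N)) := by gcongr; exact Nat.floor_le hTN.le
      _ = 2 * Real.sqrt (N * T) := by
          rw [show N * (T : ℝ) = N ^ 2 * (T / N) by field_simp, Real.sqrt_mul (by positivity),
            Real.sqrt_sq hN.le]
          ring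
  have hhigh : ∑ t ∈ (Finset.range T).filter (fun t => ¬ layer t ≤ m), 1 / Real.sqrt (layer t) ≤
      Real.sqrt (N * T) := by
    calc _ ≤ ∑ t ∈ (Finset.range T).filter (fun t => ¬ layer t ≤ m),
          1 / Real.sqrt (T / N) := by
          refine Finset.sum_le_sum fun t ht => ?_
          have htm := not_le.1 (Finset.mem_filter.1 ht).2
          have : (T : ℝ) / N ≤ layer t := ((Nat.floor_lt hTN.le).1 htm).le
          have h0 := Real.sqrt_pos.2 hTN
          gcongr
      _ ≤ T * (1 / Real.sqrt (T / N)) := by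
          rw [Finset.sum_const, nsmul_eq_mul]
          refine mul_le_mul_of_nonneg_right ?_ (by positivity)
          have := Finset.card_le_card (Finset.filter_subset (fun t => ¬ layer t ≤ m)
            (Finset.range T))
          rw [Finset.card_range] at this
          exact_mod_cast this
      _ = Real.sqrt (N * T) := by
          have h0 := Real.sqrt_pos.2 hTN
          rw [mul_one_div, div_eq_iff h0.ne', ← Real.sqrt_mul (by positivity),
            show N * (T : ℝ) * (T / N) = T ^ 2 by field_simp, Real.sqrt_sq hT'.le]
  linarith

section Run

variable {M K T : ℕ} {G : Digraph (Fin K)} {δ : ℝ} {σ : Finset (Fin K) → Finset (Fin K) → Fin K}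
  {H : ℕ → List (Round M K)} {ctx : ℕ → Fin M}

/-- The histories `H t` (`t ≤ T`) arise from running layered arm elimination on the contexts
`ctx t` (`t < T`). -/
def IsRun (G : Digraph (Fin K)) (T : ℕ) (δ : ℝ) (σ : Finset (Fin K) → Finset (Fin K) → Fin K)
    (ctx : ℕ → Fin M) (H : ℕ → List (Round M K)) : Prop :=
  ∀ t < T, ∃ o, H (t + 1) = (ctx t, (armElim G M T δ σ).act 0 (H t) (ctx t), o) :: H t

theorem IsRun.active_subset (hH : IsRun G T δ σ ctx H) (c : Fin M) {s t : ℕ} (hst : s ≤ t)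
    (htT : t ≤ T) : (algState G T δ (H t)).active c ⊆ (algState G T δ (H s)).active c := by
  induction t, hst using Nat.le_induction with
  | base => exact subset_rfl
  | succ t hst ih =>
    obtain ⟨o, ho⟩ := hH t (by omega)
    rw [ho]
    exact (active_cons_subset c).trans (ih (by omega))

theorem IsRun.chosen_subset (hH : IsRun G T δ σ ctx H) (ℓ : ℕ) {s t : ℕ} (hst : s ≤ t)
    (htT : t ≤ T) : (algState G T δ (H s)).chosen ℓ ⊆ (algState G T δ (H t)).chosen ℓ := by
  induction t, hst using Nat.le_induction with
  | base => exact subset_rfl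
  | succ t hst ih =>
    obtain ⟨o, ho⟩ := hH t (by omega)
    rw [ho]
    exact (ih (by omega)).trans (chosen_subset_cons ℓ)

/-- The rounds played on one layer form a greedy game. -/
theorem IsRun.greedyGame (hK : 0 < K) (hσ : IsGreedy G σ) (hH : IsRun G T δ σ ctx H) (ℓ : ℕ) :
    GreedyGame G ((Finset.range T).filter fun t => (algState G T δ (H t)).layer (ctx t) = ℓ) ctx
      (fun t => (armElim G M T δ σ).act 0 (H t) (ctx t))
      (fun t => (algState G T δ (H t)).active (ctx t) \ outNbr G ((algState G T δ (H t)).chosen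
        ((algState G T δ (H t)).layer (ctx t)))) := by
  have hgreedy := fun t => hσ ((algState G T δ (H t)).active (ctx t))
    ((algState G T δ (H t)).chosen ((algState G T δ (H t)).layer (ctx t)))
    (Finset.sdiff_nonempty.2 (active_not_subset hK (H t) (ctx t)))
  refine ⟨fun t _ => (hgreedy t).1, fun t _ => (hgreedy t).2, fun s hs t ht hst => ?_,
    fun s hs t ht hst hc => ?_⟩
  · obtain ⟨hs, rfl⟩ := Finset.mem_filter.1 hs
    obtain ⟨ht, hℓ⟩ := Finset.mem_filter.1 ht
    have htT := Finset.mem_range.1 ht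
    -- The set of actions taken on a layer is shared by all contexts and only grows, so what `a s`
    -- dominates is excluded at time t under any context.
    refine Finset.disjoint_of_subset_left ?_ Finset.disjoint_sdiff
    rw [hℓ]
    refine outNbr_mono (Finset.singleton_subset_iff.2 (hH.chosen_subset _ hst htT.le ?_))
    obtain ⟨o, ho⟩ := hH s (by omega)
    rw [ho]
    exact mem_chosen_cons (x := (ctx s, (armElim G M T δ σ).act 0 (H s) (ctx s), o))
  · obtain ⟨hs, hℓs⟩ := Finset.mem_filter.1 hs
    obtain ⟨ht, hℓt⟩ := Finset.mem_filter.1 ht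
    have htT := Finset.mem_range.1 ht
    simp only [hℓs, hℓt]
    rw [hc]
    exact Finset.sdiff_subset_sdiff (hH.active_subset _ hst.le htT.le)
      (outNbr_mono (hH.chosen_subset _ hst.le htT.le))

/-- The regret on concentrated runs. -/
theorem IsRun.sum_gap_le (hK : 0 < K) (hσ : IsGreedy G σ) (hH : IsRun G T δ σ ctx H)
    (h0 : H 0 = []) {μ : Fin M → Fin K → ℝ} (hμ : ∀ c a, μ c a ∈ Set.Icc (0 : ℝ) 1)
    (hδ : 1 ≤ Real.log (2 * M * K * T / δ))
    (hc : ∀ t ≤ T, Concentrated G μ (Real.log (2 * M * K * T / δ)) (H t)) (N : ℝ) (hN : 0 < N)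
    (hτ : ∀ ℓ, (((Finset.range T).filter
      fun t => (algState G T δ (H t)).layer (ctx t) = ℓ).card : ℝ) ≤ N) :
    ∑ t ∈ Finset.range T,
        ((⨆ a, μ (ctx t) a) - μ (ctx t) ((armElim G M T δ σ).act 0 (H t) (ctx t))) ≤
      24 * Real.sqrt (Real.log (2 * M * K * T / δ) * (N * T)) := by
  have : Nonempty (Fin K) := ⟨⟨0, hK⟩⟩
  set B := Real.log (2 * M * K * T / δ) with hB
  have hsuff : ∀ t ≤ T, ∀ h', h' <:+ H t → Concentrated G μ B h' := by
    intro t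
    induction t with
    | zero =>
      intro _ h' hh'
      rw [h0] at hh'
      have := hc 0 (Nat.zero_le _)
      rw [h0] at this
      rwa [List.suffix_nil.1 hh']
    | succ t ih =>
      intro htT h' hh'
      obtain ⟨o, ho⟩ := hH t (by omega)
      rw [ho, List.suffix_cons_iff] at hh'
      rcases hh' with rfl | hh'
      · rw [← ho]; exact hc _ htT
      · exact ih (by omega) h' hh'
  have hgap : ∀ t ∈ Finset.range T,
      (⨆ a, μ (ctx t) a) - μ (ctx t) ((armElim G M T δ σ).act 0 (H t) (ctx t)) ≤
        8 * Real.sqrt B * (1 / Real.sqrt ((algState G T δ (H t)).layer (ctx t))) := by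
    intro t ht
    have htT := Finset.mem_range.1 ht
    set c := ctx t
    set ℓ := (algState G T δ (H t)).layer c with hℓ
    set a := (armElim G M T δ σ).act 0 (H t) c with ha
    obtain ⟨a₀, ha₀⟩ := exists_eq_ciSup_of_finite (f := μ c)
    have hbest : ∀ a, μ c a ≤ μ c a₀ := fun a => by
      rw [ha₀]; exact le_ciSup (Set.finite_range _).bddAbove a
    rw [← ha₀]
    have hact : a ∈ (algState G T δ (H t)).active c :=
      (Finset.mem_sdiff.1 ((hH.greedyGame hK hσ ℓ).mem t (Finset.mem_filter.2 ⟨ht, rfl⟩))).1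
    have hℓ1 : 1 ≤ ℓ := one_le_layer (H t) c
    have hℓ0 : (0 : ℝ) < ℓ := by exact_mod_cast hℓ1
    rw [mul_assoc, mul_one_div, ← Real.sqrt_div (by linarith)]
    -- Nothing is known on layer 1, but there the gap is at most 1, which is at most √B.
    rcases hℓ1.eq_or_lt with h1 | h2
    · have : 1 ≤ Real.sqrt (B / ℓ) := by
        rw [← h1]; simpa using hδ
      have h3 := (hμ c a).1
      have h4 := (hμ c a₀).2
      linarith
    · refine ((active_of_concentrated (by linarith) (H t) (hsuff t htT.le) c a₀ hbest).2
        h2 a hact).trans ?_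
      -- Only the ℓ - 1 layers already completed supply samples; from ℓ = 2 on, replacing ℓ - 1 by ℓ
      -- costs a factor of at most 2.
      have h3 : Real.sqrt (B / (ℓ - 1 : ℕ)) ≤ 2 * Real.sqrt (B / ℓ) := by
        have h4 : (2 : ℝ) * Real.sqrt (B / ℓ) = Real.sqrt (4 * (B / ℓ)) := by
          rw [Real.sqrt_mul (by norm_num), show (4 : ℝ) = 2 ^ 2 by norm_num,
            Real.sqrt_sq (by norm_num)]
        rw [h4]
        refine Real.sqrt_le_sqrt ?_
        have h5 : (0 : ℝ) < (ℓ - 1 : ℕ) := by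
          have : 0 < ℓ - 1 := by omega
          exact_mod_cast this
        have h6 : (ℓ : ℝ) ≤ 4 * (ℓ - 1 : ℕ) := by
          have : ℓ ≤ 4 * (ℓ - 1) := by omega
          exact_mod_cast this
        rw [← mul_div_assoc, div_le_div_iff₀ h5 hℓ0]
        nlinarith
      linarith
  calc _ ≤ ∑ t ∈ Finset.range T,
        8 * Real.sqrt B * (1 / Real.sqrt ((algState G T δ (H t)).layer (ctx t))) :=
        Finset.sum_le_sum hgap
    _ = 8 * Real.sqrt B * ∑ t ∈ Finset.range T,
        1 / Real.sqrt ((algState G T δ (H t)).layer (ctx t)) := by rw [Finset.mul_sum]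
    _ ≤ 8 * Real.sqrt B * (3 * Real.sqrt (N * T)) := by
        gcongr
        exact sum_inv_sqrt_layer_le T (fun t => (algState G T δ (H t)).layer (ctx t)) N hN
          (fun t _ => one_le_layer _ _) hτ
    _ = _ := by rw [Real.sqrt_mul (show 0 ≤ B by linarith) (N * T)]; ring

end Run

end GraphBandit

namespace GraphBandit

/-! ### Measurability -/

/-- Sets of arms carry the discrete `σ`-algebra. -/
instance instMeasurableSpaceFinset {α : Type*} : MeasurableSpace (Finset α) := ⊤

instance instDiscreteFinset {α : Type*} : DiscreteMeasurableSpace (Finset α) := ⟨fun _ => trivial⟩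

section

variable {Ω : Type*} [MeasurableSpace Ω] {M K T : ℕ} {G : Digraph (Fin K)}

/-- Random histories of fixed length whose rounds are measurable. -/
inductive MeasurableHistory : (Ω → List (Round M K)) → Prop
  | nil : MeasurableHistory fun _ => []
  | cons {x : Ω → Round M K} {h : Ω → List (Round M K)} (hx : Measurable x)
      (hh : MeasurableHistory h) : MeasurableHistory fun ω => x ω :: h ω

theorem measurableHistory_ofFn {n : ℕ} {p : Ω → Fin n → Round M K} (hp : Measurable p) :
    MeasurableHistory fun ω => List.ofFn (p ω) := by
  induction n with
  | zero => simpa using MeasurableHistory.nil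
  | succ n ih =>
    simp_rw [List.ofFn_succ]
    exact .cons ((measurable_pi_apply 0).comp hp)
      (ih (measurable_pi_iff.2 fun i => (measurable_pi_apply i.succ).comp hp))

/-- Admissibility is stated for tuples of fixed length; this is the bridge from random lists to
them. -/
theorem MeasurableHistory.exists_ofFn {h : Ω → List (Round M K)} (hh : MeasurableHistory h) :
    ∃ n, ∃ p : Ω → Fin n → Round M K, Measurable p ∧ h = fun ω => List.ofFn (p ω) := by
  induction hh with
  | nil => exact ⟨0, fun _ => Fin.elim0, measurable_const, by simp⟩
  | @cons x h hx _ ih =>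
    obtain ⟨n, p, hp, rfl⟩ := ih
    refine ⟨n + 1, fun ω => Fin.cons (x ω) (p ω), measurable_pi_iff.2 fun i => ?_, ?_⟩
    · refine Fin.cases ?_ (fun i => ?_) i
      · simpa using hx
      · simpa using measurable_pi_iff.1 hp i
    · funext ω
      simp [List.ofFn_succ]

theorem measurableSet_setOf_discrete {β : Type*} [MeasurableSpace β] [DiscreteMeasurableSpace β]
    {f : Ω → β} (hf : Measurable f) (P : β → Prop) : MeasurableSet {ω | P (f ω)} :=
  hf (MeasurableSet.of_discrete (s := {b | P b}))

theorem measurable_sum_map {h : Ω → List (Round M K)} (hh : MeasurableHistory h)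
    {φ : Round M K → ℝ} (hφ : Measurable φ) : Measurable fun ω => ((h ω).map φ).sum := by
  induction hh with
  | nil => simp
  | cons hx _ ih =>
    simp only [List.map_cons, List.sum_cons]
    exact (hφ.comp hx).add ih

theorem measurable_empMean {h : Ω → List (Round M K)} (hh : MeasurableHistory h) (c : Fin M)
    (a : Fin K) : Measurable fun ω => empMean G (h ω) c a := by
  classical
  unfold empMean
  have hset : MeasurableSet {x : Round M K | G.Adj x.2.1 a} :=
    measurableSet_setOf_discrete (measurable_fst.comp measurable_snd) fun b => G.Adj b a
  refine (measurable_sum_map hh (Measurable.ite hset ?_ measurable_const)).div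
    (measurable_sum_map hh (Measurable.ite hset measurable_const measurable_const))
  fun_prop

theorem measurable_finset {f : Ω → Finset (Fin K)} (hf : ∀ a, MeasurableSet {ω | a ∈ f ω}) :
    Measurable f := by
  refine measurable_to_countable' fun B => ?_
  have : f ⁻¹' {B} = ⋂ a, {ω | a ∈ f ω ↔ a ∈ B} := by
    ext ω
    simp [Finset.ext_iff]
  rw [this]
  refine MeasurableSet.iInter fun a => ?_
  by_cases ha : a ∈ B
  · simpa [ha] using hf a
  · simp only [ha, iff_false]
    exact (hf a).compl

theorem measurable_apply_countable {ι β : Type*} [Countable ι] [MeasurableSpace ι]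
    [DiscreteMeasurableSpace ι] [MeasurableSpace β] {F : Ω → ι → β} (hF : ∀ i, Measurable fun ω => F ω i)
    {f : Ω → ι} (hf : Measurable f) : Measurable fun ω => F ω (f ω) :=
  (measurable_from_prod_countable_left (f := fun p : Ω × ι => F p.1 p.2) hF).comp
    (measurable_id.prodMk hf)

theorem measurable_advance {h : Ω → List (Round M K)} (hh : MeasurableHistory h) (δ : ℝ)
    {D : Ω → ℕ → Finset (Fin K)} (hD : Measurable D) (c : Fin M)
    {s : Ω → ℕ × Finset (Fin K)} (hs : Measurable s) :
    Measurable fun ω => advance G T δ (h ω) (D ω) c (s ω) := by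
  classical
  refine measurable_apply_countable (F := fun ω s => advance G T δ (h ω) (D ω) c s)
    (fun s₀ => ?_) hs
  unfold advance
  refine Measurable.ite (measurableSet_setOf_discrete (measurable_pi_iff.1 hD s₀.1)
    fun X => s₀.2 ⊆ outNbr G X) (measurable_const.prodMk (measurable_finset fun a => ?_))
    measurable_const
  simp only [Finset.mem_filter]
  refine (MeasurableSet.const (a ∈ s₀.2)).inter ?_
  have : {ω | ∀ a' ∈ s₀.2, empMean G (h ω) c a' -
      2 * Real.sqrt (Real.log (2 * M * K * T / δ) / s₀.1) ≤ empMean G (h ω) c a} =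
      ⋂ a' ∈ s₀.2, {ω | empMean G (h ω) c a' -
      2 * Real.sqrt (Real.log (2 * M * K * T / δ) / s₀.1) ≤ empMean G (h ω) c a} := by
    ext ω; simp
  change MeasurableSet {ω | ∀ a' ∈ s₀.2, _}
  rw [this]
  exact Finset.measurableSet_biInter _ fun a' _ =>
    measurableSet_le ((measurable_empMean hh c a').sub_const _) (measurable_empMean hh c a)

theorem measurable_algState {h : Ω → List (Round M K)} (hh : MeasurableHistory h) (δ : ℝ) :
    (Measurable fun ω => (algState G T δ (h ω)).layer) ∧
    (Measurable fun ω => (algState G T δ (h ω)).active) ∧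
    (Measurable fun ω => (algState G T δ (h ω)).chosen) := by
  classical
  induction hh with
  | nil => exact ⟨measurable_const, measurable_const, measurable_const⟩
  | @cons x h hx hh ih =>
    obtain ⟨hl, ha, hc⟩ := ih
    have hlx : Measurable fun ω => (algState G T δ (h ω)).layer (x ω).1 :=
      measurable_apply_countable (F := fun ω c => (algState G T δ (h ω)).layer c)
        (measurable_pi_iff.1 hl) hx.fst
    have hcl : Measurable fun ω => (algState G T δ (h ω)).chosen
        ((algState G T δ (h ω)).layer (x ω).1) :=
      measurable_apply_countable (F := fun ω ℓ => (algState G T δ (h ω)).chosen ℓ)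
        (measurable_pi_iff.1 hc) hlx
    have hD : Measurable fun ω => (algState G T δ (x ω :: h ω)).chosen := by
      simp_rw [chosen_cons]
      refine measurable_pi_iff.2 fun ℓ => ?_
      simp only [Function.update_apply]
      refine Measurable.ite (measurableSet_setOf_discrete hlx fun n => ℓ = n) ?_
        (measurable_pi_iff.1 hc ℓ)
      exact (Measurable.of_discrete (f := fun p : Fin K × Finset (Fin K) => insert p.1 p.2)).comp
        (hx.snd.fst.prodMk hcl)
    have hlen : ∃ n, ∀ ω, (h ω).length = n := by
      obtain ⟨n, p, -, rfl⟩ := hh.exists_ofFn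
      exact ⟨n, by simp⟩
    obtain ⟨n, hlen⟩ := hlen
    have hnext : ∀ c, Measurable fun ω => ((algState G T δ (x ω :: h ω)).layer c,
        (algState G T δ (x ω :: h ω)).active c) := by
      intro c
      simp_rw [next_eq, hlen]
      generalize n + 1 = m
      induction m with
      | zero => exact (measurable_pi_iff.1 hl c).prodMk (measurable_pi_iff.1 ha c)
      | succ m ihm =>
        simp_rw [Function.iterate_succ_apply']
        exact measurable_advance (.cons hx hh) δ hD c ihm
    exact ⟨measurable_pi_iff.2 fun c => (hnext c).fst, measurable_pi_iff.2 fun c => (hnext c).snd,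
      hD⟩

/-- Layered arm elimination is an admissible policy. -/
theorem armElim_admissible (δ : ℝ) (σ : Finset (Fin K) → Finset (Fin K) → Fin K) :
    (armElim G M T δ σ).Admissible := by
  refine ⟨(inferInstance : IsProbabilityMeasure (Measure.dirac (0 : ℝ))), fun n c => ?_⟩
  obtain ⟨hl, ha, hc⟩ := measurable_algState (G := G) (T := T)
    (measurableHistory_ofFn (M := M) (K := K) (measurable_snd (α := ℝ) (β := Fin n → Round M K))) δ
  have hcl := measurable_apply_countable
    (F := fun (p : ℝ × (Fin n → Round M K)) ℓ => (algState G T δ (List.ofFn p.2)).chosen ℓ)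
    (measurable_pi_iff.1 hc) (measurable_pi_iff.1 hl c)
  exact (Measurable.of_discrete
    (f := fun p : Finset (Fin K) × Finset (Fin K) => σ p.1 p.2)).comp
    ((measurable_pi_iff.1 ha c).prodMk hcl)

theorem measurable_act {π : Policy M K} (hπ : π.Admissible) {h : Ω → List (Round M K)}
    (hh : MeasurableHistory h) {u : Ω → ℝ} (hu : Measurable u) (c : Fin M) :
    Measurable fun ω => π.act (u ω) (h ω) c := by
  obtain ⟨n, p, hp, rfl⟩ := hh.exists_ofFn
  exact (hπ.2 n c).comp (hu.prodMk hp)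

theorem measurable_observe {a : Ω → Fin K} (ha : Measurable a) {r : Ω → Fin M → Fin K → ℝ}
    (hr : Measurable r) : Measurable fun ω => observe G (a ω) (r ω) := by
  classical
  refine measurable_pi_iff.2 fun c => measurable_pi_iff.2 fun b => ?_
  unfold observe
  exact Measurable.ite (measurableSet_setOf_discrete ha fun a => G.Adj a b)
    (measurable_pi_iff.1 (measurable_pi_iff.1 hr c) b) measurable_const

theorem measurableHistory_history {π : Policy M K} (hπ : π.Admissible) (ctx : Fin T → Fin M)
    {u : Ω → ℝ} (hu : Measurable u) {r : Ω → Fin T → Fin M → Fin K → ℝ} (hr : Measurable r)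
    (t : ℕ) (ht : t ≤ T) : MeasurableHistory fun ω => history G π ctx (u ω) (r ω) t ht := by
  induction t with
  | zero => exact .nil
  | succ t ih =>
    have h := ih (by omega)
    have ha := measurable_act hπ h hu (ctx ⟨t, ht⟩)
    exact .cons (measurable_const.prodMk (ha.prodMk (measurable_observe ha
      ((measurable_pi_apply _).comp hr)))) h

theorem measurable_regret {π : Policy M K} (hπ : π.Admissible) (μ : Fin M → Fin K → ℝ)
    (ctx : Fin T → Fin M) {u : Ω → ℝ} (hu : Measurable u) {r : Ω → Fin T → Fin M → Fin K → ℝ}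
    (hr : Measurable r) : Measurable fun ω => regret G π μ ctx (u ω) (r ω) := by
  unfold regret
  refine Finset.measurable_fun_sum _ fun t _ => measurable_const.sub ?_
  exact (Measurable.of_discrete (f := fun a => μ (ctx t) a)).comp
    (measurable_act hπ (measurableHistory_history hπ ctx hu hr t _) hu (ctx t))

end

end GraphBandit

namespace GraphBandit

/-! ### Concentration of the empirical means -/

open Classical in
/-- The logarithm of the exponential supermartingale of the first `n` observations of the reward
of arm `a` under context `c`. -/
noncomputable def expMart {M K : ℕ} (G : Digraph (Fin K)) (c : Fin M) (a : Fin K) (n : ℕ) (lam m : ℝ) :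
    List (Round M K) → ℝ
  | [] => 0
  | x :: h => expMart G c a n lam m h +
      if G.Adj x.2.1 a ∧ obsCount G a h < n then lam * (x.2.2 c a - m) - lam ^ 2 / 8 else 0

section

variable {M K T : ℕ} {G : Digraph (Fin K)} {c : Fin M} {a : Fin K} {n : ℕ} {lam m : ℝ}

theorem obsCount_le_length (h : List (Round M K)) : obsCount G a h ≤ h.length := by
  classical
  induction h with
  | nil => simp [obsCount]
  | cons x h ih =>
    rw [obsCount_cons, List.length_cons]
    split_ifs <;> omega

theorem empMean_mul_obsCount (h : List (Round M K)) (hpos : 0 < obsCount G a h) [DecidableRel G.Adj] :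
    empMean G h c a * obsCount G a h =
      (h.map fun x => if G.Adj x.2.1 a then x.2.2 c a else 0).sum := by
  have h1 : (h.map fun x => if G.Adj x.2.1 a then (1 : ℝ) else 0).sum = obsCount G a h := by
    clear hpos
    induction h with
    | nil => simp [obsCount]
    | cons x h ih =>
      rw [obsCount_cons, List.map_cons, List.sum_cons, ih]
      push_cast
      rfl
  have h2 : (0 : ℝ) < obsCount G a h := by exact_mod_cast hpos
  have h3 : empMean G h c a = (h.map fun x => if G.Adj x.2.1 a then x.2.2 c a else 0).sum /
      (h.map fun x => if G.Adj x.2.1 a then (1 : ℝ) else 0).sum := by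
    unfold empMean
    congr!
  rw [h3, h1, div_mul_cancel₀ _ h2.ne']

/-- Up to the n-th observation no increment is suppressed, so the process has its unstopped closed
form. -/
theorem expMart_eq (h : List (Round M K)) (hn : obsCount G a h ≤ n) [DecidableRel G.Adj] :
    expMart G c a n lam m h =
      lam * ((h.map fun x => if G.Adj x.2.1 a then x.2.2 c a else 0).sum - obsCount G a h * m) -
        obsCount G a h * (lam ^ 2 / 8) := by
  induction h with
  | nil => simp [expMart, obsCount]
  | cons x h ih =>
    rw [obsCount_cons] at hn ⊢
    rw [expMart, ih (by omega), List.map_cons, List.sum_cons]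
    by_cases hadj : G.Adj x.2.1 a
    · simp only [hadj, if_true] at hn ⊢
      rw [if_pos ⟨trivial, by omega⟩]
      push_cast
      ring
    · simp [hadj]

/-- The process is frozen after n observations. Its value at the horizon thus detects a deviation at
any time with exactly n observations, without a union bound over times. -/
theorem expMart_eq_of_suffix {h' h : List (Round M K)} (hs : h' <:+ h)
    (hn : obsCount G a h' = n) : expMart G c a n lam m h = expMart G c a n lam m h' := by
  classical
  have hmono : ∀ h : List (Round M K), h' <:+ h → n ≤ obsCount G a h := by
    intro h hs
    induction h with
    | nil => rw [List.suffix_nil] at hs; rw [← hs]; exact hn.ge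
    | cons x h ih =>
      rcases List.suffix_cons_iff.1 hs with rfl | hs
      · exact hn.ge
      · rw [obsCount_cons]; exact (ih hs).trans (Nat.le_add_left _ _)
  induction h with
  | nil => rw [List.suffix_nil.1 hs]
  | cons x h ih =>
    rcases List.suffix_cons_iff.1 hs with rfl | hs
    · rfl
    · rw [expMart, ih hs, if_neg (fun hc => not_lt.2 (hmono h hs) hc.2), add_zero]

theorem measurable_obsCount {Ω : Type*} [MeasurableSpace Ω] {h : Ω → List (Round M K)}
    (hh : MeasurableHistory h) (a : Fin K) : Measurable fun ω => obsCount G a (h ω) := by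
  classical
  induction hh with
  | nil => simp [obsCount]
  | cons hx _ ih =>
    simp_rw [obsCount_cons]
    exact (Measurable.ite (measurableSet_setOf_discrete hx.snd.fst fun b => G.Adj b a)
      measurable_const measurable_const).add ih

theorem measurable_expMart {Ω : Type*} [MeasurableSpace Ω] {h : Ω → List (Round M K)}
    (hh : MeasurableHistory h) : Measurable fun ω => expMart G c a n lam m (h ω) := by
  classical
  induction hh with
  | nil => exact measurable_const
  | @cons x h hx hh ih =>
    simp_rw [expMart]
    refine ih.add (Measurable.ite ((measurableSet_setOf_discrete hx.snd.fst
      fun b => G.Adj b a).inter (measurableSet_setOf_discrete (measurable_obsCount hh a)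
      fun k => k < n)) ?_ measurable_const)
    exact (((measurable_pi_iff.1 (measurable_pi_iff.1 hx.snd.snd c) a).sub_const _).const_mul
      _).sub_const _

/-- Histories are adapted: this is what permits integrating out one round while its past stays
fixed. -/
theorem history_congr {π : Policy M K} {ctx : Fin T → Fin M} {u : ℝ}
    {r r' : Fin T → Fin M → Fin K → ℝ} (t : ℕ) (ht : t ≤ T)
    (hr : ∀ s : Fin T, s.1 < t → r s = r' s) :
    history G π ctx u r t ht = history G π ctx u r' t ht := by
  induction t with
  | zero => rfl
  | succ t ih =>
    have h1 := ih (by omega) fun s hs => hr s (by omega)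
    have h2 := hr ⟨t, ht⟩ (Nat.lt_succ_self t)
    simp only [history, h1, h2]

theorem length_history {π : Policy M K} {ctx : Fin T → Fin M} {u : ℝ}
    {r : Fin T → Fin M → Fin K → ℝ} (t : ℕ) (ht : t ≤ T) :
    (history G π ctx u r t ht).length = t := by
  induction t with
  | zero => rfl
  | succ t ih => simp [history, ih]

theorem history_suffix {π : Policy M K} {ctx : Fin T → Fin M} {u : ℝ}
    {r : Fin T → Fin M → Fin K → ℝ} (t s : ℕ) (hst : s ≤ t) (ht : t ≤ T) :
    history G π ctx u r s (hst.trans ht) <:+ history G π ctx u r t ht := by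
  induction t, hst using Nat.le_induction with
  | base => exact List.suffix_rfl
  | succ t hst ih => exact (ih (by omega)).trans (List.suffix_cons _ _)

theorem Environment.mean_mem_Icc (E : Environment T M K) (hT : 0 < T) (c : Fin M) (a : Fin K) :
    E.mean c a ∈ Set.Icc (0 : ℝ) 1 := by
  have := E.isProb ⟨0, hT⟩
  have hb := E.bounded ⟨0, hT⟩
  have hm : AEMeasurable (fun r : Fin M → Fin K → ℝ => r c a) (E.law ⟨0, hT⟩) :=
    ((measurable_pi_apply a).comp (measurable_pi_apply c)).aemeasurable
  rw [← E.mean_eq ⟨0, hT⟩]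
  have hb' : ∀ᵐ r ∂(E.law ⟨0, hT⟩), r c a ∈ Set.Icc (0 : ℝ) 1 := hb.mono fun r hr => hr c a
  constructor
  · exact integral_nonneg_of_ae (hb'.mono fun r hr => hr.1)
  · calc _ ≤ ∫ r, (1 : ℝ) ∂(E.law ⟨0, hT⟩) :=
        integral_mono_ae (Integrable.of_mem_Icc 0 1 hm hb') (integrable_const _)
          (hb'.mono fun r hr => hr.2)
      _ = 1 := by simp

/-- Hoeffding's lemma: a variable with values in [0,1] is sub-Gaussian with variance proxy 1/4. -/
theorem Environment.lintegral_exp_le (E : Environment T M K) (t : Fin T) (c : Fin M) (a : Fin K)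
    (lam : ℝ) : ∫⁻ r, ENNReal.ofReal (Real.exp (lam * (r c a - E.mean c a))) ∂(E.law t) ≤
      ENNReal.ofReal (Real.exp (lam ^ 2 / 8)) := by
  have := E.isProb t
  have hm : AEMeasurable (fun r : Fin M → Fin K → ℝ => r c a) (E.law t) :=
    ((measurable_pi_apply a).comp (measurable_pi_apply c)).aemeasurable
  have hsub := ProbabilityTheory.hasSubgaussianMGF_of_mem_Icc hm
    ((E.bounded t).mono fun r hr => hr c a)
  rw [E.mean_eq] at hsub
  rw [← ofReal_integral_eq_lintegral_ofReal (hsub.integrable_exp_mul lam)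
    (ae_of_all _ fun _ => (Real.exp_pos _).le)]
  refine ENNReal.ofReal_le_ofReal ((hsub.mgf_le lam).trans (le_of_eq ?_))
  congr 1
  push_cast
  norm_num
  ring

/-- The exponential process is a supermartingale. -/
theorem lintegral_expMart_le (E : Environment T M K) {π : Policy M K} (hπ : π.Admissible)
    (ctx : Fin T → Fin M) (u : ℝ) (c : Fin M) (a : Fin K) (n : ℕ) (lam : ℝ) (t : ℕ) (ht : t ≤ T) :
    ∫⁻ r, ENNReal.ofReal (Real.exp (expMart G c a n lam (E.mean c a)
      (history G π ctx u r t ht))) ∂(Measure.pi E.law) ≤ 1 := by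
  classical
  have := E.isProb
  have hmeas : ∀ t ht, Measurable fun r => ENNReal.ofReal (Real.exp
      (expMart G c a n lam (E.mean c a) (history G π ctx u r t ht))) := fun t ht =>
    ENNReal.measurable_ofReal.comp (Real.measurable_exp.comp (measurable_expMart
      (measurableHistory_history hπ ctx measurable_const measurable_id t ht)))
  induction t with
  | zero => simp [history, expMart]
  | succ t ih =>
    refine (lintegral_le_of_lmarginal_le {⟨t, ht⟩} (hmeas _ _) (hmeas t (by omega))
      fun r => ?_).trans (ih (by omega))
    rw [lmarginal_singleton, lmarginal_singleton]
    have hpast : ∀ x, history G π ctx u (Function.update r ⟨t, ht⟩ x) t (by omega) =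
        history G π ctx u r t (by omega) := fun x => history_congr t _ fun s hs =>
      Function.update_of_ne (by rintro rfl; simp at hs) _ _
    simp only [history, hpast, Function.update_self]
    set h := history G π ctx u r t (by omega)
    set b := π.act u h (ctx ⟨t, ht⟩)
    simp only [expMart]
    rw [lintegral_const, measure_univ, mul_one]
    by_cases hcond : G.Adj b a ∧ obsCount G a h < n
    · simp only [hcond, and_self, if_true, observe]
      have hsplit : ∀ x : Fin M → Fin K → ℝ,
          ENNReal.ofReal (Real.exp (expMart G c a n lam (E.mean c a) h +
            (lam * (x c a - E.mean c a) - lam ^ 2 / 8))) =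
          ENNReal.ofReal (Real.exp (expMart G c a n lam (E.mean c a) h - lam ^ 2 / 8)) *
            ENNReal.ofReal (Real.exp (lam * (x c a - E.mean c a))) := fun x => by
        rw [← ENNReal.ofReal_mul (Real.exp_pos _).le, ← Real.exp_add]
        congr 2; ring
      simp_rw [hsplit]
      rw [lintegral_const_mul _ (by fun_prop)]
      refine (mul_le_mul_right (E.lintegral_exp_le ⟨t, ht⟩ c a lam) _).trans ?_
      rw [← ENNReal.ofReal_mul (Real.exp_pos _).le, ← Real.exp_add]
      apply le_of_eq
      congr 2; ring
    · simp only [hcond, if_false, add_zero]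
      rw [lintegral_const, measure_univ, mul_one]

/-- One-sided concentration after `n` observations. -/
theorem measure_deviation_le (E : Environment T M K) {π : Policy M K} (hπ : π.Admissible)
    (ctx : Fin T → Fin M) (u : ℝ) (c : Fin M) (a : Fin K) (n : ℕ) (hn : 0 < n) (lam B : ℝ) :
    Measure.pi E.law {r | ∃ t, ∃ ht : t ≤ T, obsCount G a (history G π ctx u r t ht) = n ∧
      B ≤ n * (lam * (empMean G (history G π ctx u r t ht) c a - E.mean c a)) -
        n * (lam ^ 2 / 8)} ≤ ENNReal.ofReal (Real.exp (-B)) := by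
  classical
  have hint := lintegral_expMart_le (G := G) E hπ ctx u c a n lam T le_rfl
  have hmeas : Measurable fun r => ENNReal.ofReal (Real.exp
      (expMart G c a n lam (E.mean c a) (history G π ctx u r T le_rfl))) :=
    ENNReal.measurable_ofReal.comp (Real.measurable_exp.comp (measurable_expMart
      (measurableHistory_history hπ ctx measurable_const measurable_id T le_rfl)))
  have hmarkov := meas_ge_le_lintegral_div (μ := Measure.pi E.law) hmeas.aemeasurable
    (ε := ENNReal.ofReal (Real.exp B)) (by simp [Real.exp_pos]) ENNReal.ofReal_ne_top
  have hsub : {r | ∃ t, ∃ ht : t ≤ T, obsCount G a (history G π ctx u r t ht) = n ∧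
      B ≤ n * (lam * (empMean G (history G π ctx u r t ht) c a - E.mean c a)) -
        n * (lam ^ 2 / 8)} ⊆ {r | ENNReal.ofReal (Real.exp B) ≤ ENNReal.ofReal (Real.exp
      (expMart G c a n lam (E.mean c a) (history G π ctx u r T le_rfl)))} := by
    rintro r ⟨t, ht, hcnt, hB⟩
    refine ENNReal.ofReal_le_ofReal (Real.exp_le_exp.2 ?_)
    rw [expMart_eq_of_suffix (history_suffix T t ht le_rfl) hcnt, expMart_eq _ hcnt.le,
      ← empMean_mul_obsCount _ (by rw [hcnt]; exact hn), hcnt]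
    refine hB.trans (le_of_eq ?_)
    ring
  refine (measure_mono hsub).trans (hmarkov.trans ?_)
  calc _ ≤ 1 / ENNReal.ofReal (Real.exp B) := by gcongr
    _ = _ := by
      rw [Real.exp_neg, one_div, ENNReal.ofReal_inv_of_pos (Real.exp_pos B)]

/-- With high probability, all histories are concentrated. -/
theorem measure_not_concentrated_le (E : Environment T M K) {π : Policy M K} (hπ : π.Admissible)
    (ctx : Fin T → Fin M) (u : ℝ) (B : ℝ) (hB : 0 ≤ B) :
    Measure.pi E.law {r | ¬ ∀ t, ∀ ht : t ≤ T,
      Concentrated G E.mean B (history G π ctx u r t ht)} ≤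
        ENNReal.ofReal (2 * M * K * T * Real.exp (-B)) := by
  -- The index collects context, arm, number of observations minus one, and sign. With n
  -- observations and e = √(B / n), the slopes ±2e give at a deviation above e an exponent of at
  -- least n (2e² - e²/2) = 3B/2, which exceeds what is needed.
  set S : (Fin M × Fin K × Fin T × Bool) → Set (Fin T → Fin M → Fin K → ℝ) := fun i =>
    {r | ∃ t, ∃ ht : t ≤ T, obsCount G i.2.1 (history G π ctx u r t ht) = (i.2.2.1 + 1 : ℕ) ∧
      B ≤ (i.2.2.1 + 1 : ℕ) * ((if i.2.2.2 then 2 * Real.sqrt (B / (i.2.2.1 + 1 : ℕ))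
        else -(2 * Real.sqrt (B / (i.2.2.1 + 1 : ℕ)))) *
        (empMean G (history G π ctx u r t ht) i.1 i.2.1 - E.mean i.1 i.2.1)) -
        (i.2.2.1 + 1 : ℕ) * ((if i.2.2.2 then 2 * Real.sqrt (B / (i.2.2.1 + 1 : ℕ))
        else -(2 * Real.sqrt (B / (i.2.2.1 + 1 : ℕ)))) ^ 2 / 8)} with hS
  have hsub : {r | ¬ ∀ t, ∀ ht : t ≤ T,
      Concentrated G E.mean B (history G π ctx u r t ht)} ⊆ ⋃ i, S i := by
    intro r hr
    simp only [Set.mem_ofPred_eq, Concentrated] at hr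
    push Not at hr
    obtain ⟨t, ht, c, a, hpos, hdev⟩ := hr
    set h := history G π ctx u r t ht with hh
    have hle : obsCount G a h ≤ T :=
      (obsCount_le_length h).trans ((length_history t ht).trans_le ht)
    obtain ⟨k, hk⟩ : ∃ k, obsCount G a h = k + 1 := ⟨obsCount G a h - 1, by omega⟩
    have hk0 : (0 : ℝ) < (k + 1 : ℕ) := by positivity
    rw [hk] at hdev
    have hsq : (k + 1 : ℕ) * Real.sqrt (B / (k + 1 : ℕ)) ^ 2 = B := by
      rw [Real.sq_sqrt (by positivity)]
      field_simp
    have hs0 := Real.sqrt_nonneg (B / (k + 1 : ℕ))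
    set e := Real.sqrt (B / (k + 1 : ℕ))
    refine Set.mem_iUnion.2 ?_
    rcases lt_abs.1 hdev with hd | hd
    · refine ⟨(c, a, ⟨k, by omega⟩, true), t, ht, hk, ?_⟩
      simp only [if_true]
      have : (k + 1 : ℕ) * (e * e) ≤ (k + 1 : ℕ) * (e * (empMean G h c a - E.mean c a)) := by
        gcongr
      nlinarith
    · refine ⟨(c, a, ⟨k, by omega⟩, false), t, ht, hk, ?_⟩
      simp only [Bool.false_eq_true, if_false]
      have : (k + 1 : ℕ) * (e * e) ≤ (k + 1 : ℕ) * (e * -(empMean G h c a - E.mean c a)) := by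
        gcongr
      nlinarith
  calc _ ≤ Measure.pi E.law (⋃ i, S i) := measure_mono hsub
    _ ≤ ∑ i, Measure.pi E.law (S i) := measure_iUnion_fintype_le _ _
    _ ≤ ∑ i : Fin M × Fin K × Fin T × Bool, ENNReal.ofReal (Real.exp (-B)) :=
        Finset.sum_le_sum fun i _ => measure_deviation_le E hπ ctx u i.1 i.2.1 _
          (Nat.succ_pos _) _ B
    _ = _ := by
        rw [Finset.sum_const, Finset.card_univ]
        simp only [Fintype.card_prod, Fintype.card_fin, Fintype.card_bool, nsmul_eq_mul]
        rw [← ENNReal.ofReal_natCast, ← ENNReal.ofReal_mul (by positivity)]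
        congr 1
        push_cast
        ring

end

end GraphBandit

namespace GraphBandit

/-! ### Regret upper bounds -/

section

variable {M K T : ℕ} {G : Digraph (Fin K)} {δ : ℝ} {σ : Finset (Fin K) → Finset (Fin K) → Fin K}

/-- Every greedy game on `G` with `M` contexts ends after at most `N` moves. -/
def GameBound (G : Digraph (Fin K)) (M : ℕ) (N : ℝ) : Prop :=
  ∀ (τ : Finset ℕ) (ctx : ℕ → Fin M) (a : ℕ → Fin K) (U : ℕ → Finset (Fin K)),
    GreedyGame G τ ctx a U → (τ.card : ℝ) ≤ N

theorem regret_le_of_concentrated (hK : 0 < K) (hT : 0 < T) (hσ : IsGreedy G σ)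
    (ctx : Fin T → Fin M) {μ : Fin M → Fin K → ℝ} (hμ : ∀ c a, μ c a ∈ Set.Icc (0 : ℝ) 1)
    (hδ : 1 ≤ Real.log (2 * M * K * T / δ)) (N : ℝ) (hN : 0 < N) (hgame : GameBound G M N)
    (u : ℝ) (r : Fin T → Fin M → Fin K → ℝ)
    (hr : ∀ t, ∀ ht : t ≤ T, Concentrated G μ (Real.log (2 * M * K * T / δ))
      (history G (armElim G M T δ σ) ctx u r t ht)) :
    regret G (armElim G M T δ σ) μ ctx u r ≤
      24 * Real.sqrt (Real.log (2 * M * K * T / δ) * (N * T)) := by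
  -- `IsRun` uses sequences indexed by ℕ; the default values beyond the horizon do not enter the
  -- bound.
  set H : ℕ → List (Round M K) := fun t =>
    if ht : t ≤ T then history G (armElim G M T δ σ) ctx u r t ht else [] with hH
  set ctx' : ℕ → Fin M := fun t => if ht : t < T then ctx ⟨t, ht⟩ else ctx ⟨0, hT⟩ with hctx'
  have hHt : ∀ t (ht : t ≤ T), H t = history G (armElim G M T δ σ) ctx u r t ht :=
    fun t ht => dif_pos ht
  have hct : ∀ t (ht : t < T), ctx' t = ctx ⟨t, ht⟩ := fun t ht => dif_pos ht
  have hrun : IsRun G T δ σ ctx' H := by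
    intro t ht
    refine ⟨observe G ((armElim G M T δ σ).act u (H t) (ctx' t)) (r ⟨t, ht⟩), ?_⟩
    rw [hHt (t + 1) ht, hHt t ht.le, hct t ht]
    rfl
  have hbound := hrun.sum_gap_le hK hσ (by rw [hHt 0 (Nat.zero_le _)]; rfl) hμ hδ
    (fun t ht => by rw [hHt t ht]; exact hr t ht) N hN
    (fun ℓ => hgame _ _ _ _ (hrun.greedyGame hK hσ ℓ))
  refine le_trans (le_of_eq ?_) hbound
  rw [regret, Finset.sum_range]
  refine Finset.sum_congr rfl fun t _ => ?_
  rw [hct t t.2, hHt t t.2.le]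
  rfl

/-- A single action has to be treated apart because the factor log K in the bounds vanishes. -/
theorem regret_eq_zero (hK : K = 1) (π : Policy M K) (μ : Fin M → Fin K → ℝ)
    (ctx : Fin T → Fin M) (u : ℝ) (r : Fin T → Fin M → Fin K → ℝ) :
    regret G π μ ctx u r = 0 := by
  subst hK
  refine Finset.sum_eq_zero fun t _ => ?_
  rw [ciSup_unique, sub_eq_zero]
  congr 1
  exact Subsingleton.elim _ _

theorem regret_le (hK : 0 < K) (π : Policy M K) {μ : Fin M → Fin K → ℝ}
    (hμ : ∀ c a, μ c a ∈ Set.Icc (0 : ℝ) 1) (ctx : Fin T → Fin M) (u : ℝ)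
    (r : Fin T → Fin M → Fin K → ℝ) : regret G π μ ctx u r ≤ T := by
  have : Nonempty (Fin K) := ⟨⟨0, hK⟩⟩
  calc regret G π μ ctx u r ≤ ∑ _t : Fin T, (1 : ℝ) := by
        refine Finset.sum_le_sum fun t _ => ?_
        have h1 : (⨆ a, μ (ctx t) a) ≤ 1 := ciSup_le fun a => (hμ _ a).2
        have h2 := (hμ (ctx t) (action G π ctx u r t)).1
        linarith
    _ = T := by simp

theorem regret_nonneg (π : Policy M K) (μ : Fin M → Fin K → ℝ) (ctx : Fin T → Fin M) (u : ℝ)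
    (r : Fin T → Fin M → Fin K → ℝ) : 0 ≤ regret G π μ ctx u r :=
  Finset.sum_nonneg fun _ _ => sub_nonneg.2 (le_ciSup (Set.finite_range _).bddAbove _)

/-- The high-probability regret bound. -/
theorem le_measure_regret_le (hK : 0 < K) (hM : 0 < M) (hT : 0 < T) (hσ : IsGreedy G σ)
    (hδ0 : 0 < δ) (hδ : 1 ≤ Real.log (2 * M * K * T / δ)) (N : ℝ) (hN : 0 < N)
    (hgame : GameBound G M N) (ctx : Fin T → Fin M) (E : Environment T M K) :
    ENNReal.ofReal (1 - δ) ≤ E.measure (armElim G M T δ σ)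
      {p | regret G (armElim G M T δ σ) E.mean ctx p.1 p.2 ≤
        24 * Real.sqrt (Real.log (2 * M * K * T / δ) * (N * T))} := by
  have := E.isProb
  have hadm := armElim_admissible (M := M) (T := T) (G := G) δ σ
  have hmeas : MeasurableSet {p : ℝ × (Fin T → Fin M → Fin K → ℝ) |
      regret G (armElim G M T δ σ) E.mean ctx p.1 p.2 ≤
        24 * Real.sqrt (Real.log (2 * M * K * T / δ) * (N * T))} :=
    measurableSet_le (measurable_regret hadm E.mean ctx measurable_fst measurable_snd)
      measurable_const
  have hE : E.measure (armElim G M T δ σ) = Measure.map (Prod.mk 0) (Measure.pi E.law) :=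
    Measure.dirac_prod 0
  rw [hE, Measure.map_apply measurable_prodMk_left hmeas]
  have hmeas' := measurable_prodMk_left (x := (0 : ℝ)) hmeas
  have hpos : (0 : ℝ) < 2 * M * K * T / δ := by positivity
  have hbad : Measure.pi E.law (Prod.mk 0 ⁻¹' {p : ℝ × (Fin T → Fin M → Fin K → ℝ) |
      regret G (armElim G M T δ σ) E.mean ctx p.1 p.2 ≤
        24 * Real.sqrt (Real.log (2 * M * K * T / δ) * (N * T))})ᶜ ≤ ENNReal.ofReal δ := by
    refine (measure_mono fun r hr => ?_).trans ((measure_not_concentrated_le (G := G) E hadm ctx 0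
      (Real.log (2 * M * K * T / δ)) (by linarith)).trans (ENNReal.ofReal_le_ofReal (le_of_eq ?_)))
    · intro hc
      exact hr (regret_le_of_concentrated hK hT hσ ctx (E.mean_mem_Icc hT) hδ N hN hgame 0 r hc)
    · rw [Real.exp_neg, Real.exp_log hpos]
      field_simp
  rw [ENNReal.ofReal_sub _ hδ0.le, ENNReal.ofReal_one, tsub_le_iff_right]
  rw [← prob_add_prob_compl (μ := Measure.pi E.law) hmeas']
  gcongr

instance instIsProbabilityMeasureMeasure (E : Environment T M K) (δ : ℝ) :
    IsProbabilityMeasure (E.measure (armElim G M T δ σ)) := by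
  have := E.isProb
  have : IsProbabilityMeasure (armElim G M T δ σ).seed :=
    (inferInstance : IsProbabilityMeasure (Measure.dirac (0 : ℝ)))
  unfold Environment.measure
  infer_instance

/-- The bad event has probability at most δ and costs at most T, which adds δ T ≤ 1. -/
theorem expectedRegret_armElim_le (hK : 0 < K) (hM : 0 < M) (hT : 0 < T) (hσ : IsGreedy G σ)
    (hδ0 : 0 < δ) (hδT : δ * T ≤ 1) (hδ : 1 ≤ Real.log (2 * M * K * T / δ)) (N : ℝ)
    (hN : 0 < N) (hgame : GameBound G M N) (ctx : Fin T → Fin M) (E : Environment T M K) :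
    expectedRegret G (armElim G M T δ σ) E ctx ≤
      24 * Real.sqrt (Real.log (2 * M * K * T / δ) * (N * T)) + 1 := by
  have h := le_measure_regret_le hK hM hT hσ hδ0 hδ N hN hgame ctx E
  set b := 24 * Real.sqrt (Real.log (2 * M * K * T / δ) * (N * T)) with hb
  set P := E.measure (armElim G M T δ σ) with hP
  have hmR := measurable_regret (G := G) (armElim_admissible (M := M) (T := T) (G := G) δ σ) E.mean ctx
    measurable_fst (measurable_snd (α := ℝ) (β := Fin T → Fin M → Fin K → ℝ))
  set S := {p : ℝ × (Fin T → Fin M → Fin K → ℝ) |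
    regret G (armElim G M T δ σ) E.mean ctx p.1 p.2 ≤ b} with hS
  have hmS : MeasurableSet S := measurableSet_le hmR measurable_const
  have hbad : P.real Sᶜ ≤ δ := by
    rw [probReal_compl_eq_one_sub hmS]
    have : 1 - δ ≤ P.real S := (ENNReal.ofReal_le_iff_le_toReal (measure_ne_top _ _)).1 h
    linarith
  have hb0 : 0 ≤ b := by positivity
  calc expectedRegret G (armElim G M T δ σ) E ctx
      ≤ ∫ p, (b + Sᶜ.indicator (fun _ => (T : ℝ)) p) ∂P := by
        refine integral_mono_of_nonneg (ae_of_all _ fun p => regret_nonneg _ _ _ _ _)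
          ((integrable_const _).add ((integrable_const _).indicator hmS.compl))
          (ae_of_all _ fun p => ?_)
        beta_reduce
        by_cases hp : p ∈ S
        · rw [Set.indicator_of_notMem (Set.notMem_compl_iff.2 hp), add_zero]
          exact hp
        · have := regret_le (G := G) hK (armElim G M T δ σ) (E.mean_mem_Icc hT) ctx p.1 p.2
          simp only [Set.mem_compl_iff, hp, not_false_eq_true, Set.indicator_of_mem]
          linarith
    _ = b + P.real Sᶜ * T := by
        rw [integral_add (integrable_const _) ((integrable_const _).indicator hmS.compl),
          integral_indicator_const _ hmS.compl]
        simp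
    _ ≤ b + 1 := by
        have : P.real Sᶜ * T ≤ δ * T := by gcongr
        linarith

theorem one_le_log_of_four_le {x : ℝ} (hx : 4 ≤ x) : 1 ≤ Real.log x := by
  have h1 : Real.log 4 ≤ Real.log x := Real.log_le_log (by norm_num) hx
  have h2 : Real.log 4 = 2 * Real.log 2 := by
    rw [show (4 : ℝ) = 2 ^ 2 by norm_num, Real.log_pow]; norm_num
  have := Real.log_two_gt_d9
  linarith

theorem worstRegret_armElim_le (hK : 2 ≤ K) (hM : 0 < M) (hT : 0 < T) (hσ : IsGreedy G σ)
    (N : ℝ) (hN : 0 < N) (hgame : GameBound G M N) :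
    worstRegret G (armElim G M T (1 / (T + 1)) σ) T ≤
      48 * Real.sqrt (Real.log (M * K * T) * (N * T)) + 1 := by
  have hM' : (1 : ℝ) ≤ M := by exact_mod_cast hM
  have hK' : (2 : ℝ) ≤ K := by exact_mod_cast hK
  have hT' : (1 : ℝ) ≤ T := by exact_mod_cast hT
  have hMK : (2 : ℝ) ≤ M * K := by nlinarith
  have hMKT : (T : ℝ) ≤ M * K * T := by nlinarith
  have hMKT2 : (2 : ℝ) ≤ M * K * T := by nlinarith
  have hlog1 : 1 ≤ Real.log (2 * M * K * T / (1 / (T + 1))) := by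
    refine one_le_log_of_four_le ?_
    rw [div_div_eq_mul_div, div_one]
    nlinarith
  -- With X = M K T ≥ 2 and T + 1 ≤ 2 X, the argument is at most 4 X² ≤ X⁴. The square root of 4
  -- turns 24 into 48.
  have hlog2 : Real.log (2 * M * K * T / (1 / (T + 1))) ≤ 4 * Real.log (M * K * T) := by
    rw [show 4 * Real.log ((M : ℝ) * K * T) = Real.log ((M * K * T) ^ 4) by
      rw [Real.log_pow]; norm_num]
    refine Real.log_le_log (by positivity) ?_
    rw [div_div_eq_mul_div, div_one]
    set X := (M : ℝ) * K * T
    have h1 : 2 * (M : ℝ) * K * T * (T + 1) = 2 * X * (T + 1) := by ring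
    rw [h1]
    have h2 : 2 * X * (T + 1) ≤ 2 * X * (2 * X) := by
      apply mul_le_mul_of_nonneg_left _ (by linarith); linarith
    have h3 : 4 ≤ X ^ 2 := by nlinarith
    nlinarith [mul_nonneg (sq_nonneg X) (sub_nonneg.2 h3)]
  refine Real.iSup_le (fun x => ?_) (by positivity)
  refine (expectedRegret_armElim_le (by omega) hM hT hσ (by positivity) ?_ hlog1 N hN hgame
    x.1 x.2).trans ?_
  · rw [one_div, inv_mul_le_iff₀ (by linarith)]; linarith
  · have h2 : 24 * Real.sqrt (Real.log (2 * M * K * T / (1 / (T + 1))) * (N * T)) ≤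
        24 * Real.sqrt (2 ^ 2 * (Real.log (M * K * T) * (N * T))) := by
      have : 0 ≤ N * T := by positivity
      refine mul_le_mul_of_nonneg_left (Real.sqrt_le_sqrt ?_) (by norm_num)
      nlinarith
    rw [Real.sqrt_mul (show (0 : ℝ) ≤ 2 ^ 2 by norm_num),
      Real.sqrt_sq (show (0 : ℝ) ≤ 2 by norm_num)] at h2
    linarith

theorem worstRegret_eq_zero (hK : K = 1) (π : Policy M K) : worstRegret G π T = 0 := by
  have : ∀ x : (Fin T → Fin M) × Environment T M K, expectedRegret G π x.2 x.1 = 0 := fun x => by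
    unfold expectedRegret
    simp [regret_eq_zero hK]
  simp [worstRegret, this]

/-- The bound T on the regret makes the real supremum a genuine one. -/
theorem expectedRegret_le_worstRegret (hK : 0 < K) (hT : 0 < T) {π : Policy M K}
    (hπ : π.Admissible) (E : Environment T M K) (ctx : Fin T → Fin M) :
    expectedRegret G π E ctx ≤ worstRegret G π T := by
  refine le_ciSup (f := fun x : (Fin T → Fin M) × Environment T M K =>
    expectedRegret G π x.2 x.1) ⟨T, ?_⟩ (ctx, E)
  rintro _ ⟨x, rfl⟩
  have := hπ.1
  have := x.2.isProb
  have : IsProbabilityMeasure (x.2.measure π) := by unfold Environment.measure; infer_instance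
  calc expectedRegret G π x.2 x.1 ≤ ∫ _p, (T : ℝ) ∂(x.2.measure π) :=
        integral_mono_of_nonneg (ae_of_all _ fun p => regret_nonneg _ _ _ _ _)
          (integrable_const _)
          (ae_of_all _ fun p => regret_le hK π (x.2.mean_mem_Icc hT) _ _ _)
    _ = T := by simp

theorem minimaxRegret_nonneg : 0 ≤ minimaxRegret G M T :=
  Real.iInf_nonneg fun _ => Real.iSup_nonneg fun _ => integral_nonneg fun _ =>
    regret_nonneg _ _ _ _ _

end

end GraphBandit

/-! ### Upper bounds in terms of the graph quantities -/

namespace GraphBandit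

section

variable {M K T : ℕ} {G : Digraph (Fin K)} {δ : ℝ} {σ : Finset (Fin K) → Finset (Fin K) → Fin K}

theorem measure_regret_le_betaDom (hK : 0 < K) (hM : 0 < M) (hT : 0 < T)
    (hG : ∀ a, G.Adj a a) (hσ : IsGreedy G σ) (hδ0 : 0 < δ) (hδ1 : δ < 1)
    (ctx : Fin T → Fin M) (E : Environment T M K) :
    ENNReal.ofReal (1 - δ) ≤ E.measure (armElim G M T δ σ)
      {p | regret G (armElim G M T δ σ) E.mean ctx p.1 p.2 ≤
        48 * Real.sqrt (T * betaDom G M * Real.log (M * K * T / δ))} := by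
  -- For K = 1 the logarithm can be arbitrarily small, but the regret vanishes. For K ≥ 2 the
  -- argument x of the logarithm is at least 2, so log (2 x) ≤ 2 log x.
  rcases Nat.lt_or_ge K 2 with hK1 | hK2
  · have hK1 : K = 1 := by omega
    have : {p : ℝ × (Fin T → Fin M → Fin K → ℝ) |
        regret G (armElim G M T δ σ) E.mean ctx p.1 p.2 ≤
        48 * Real.sqrt (T * betaDom G M * Real.log (M * K * T / δ))} = Set.univ := by
      refine Set.eq_univ_of_forall fun p => ?_
      change regret G (armElim G M T δ σ) E.mean ctx p.1 p.2 ≤ _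
      rw [regret_eq_zero hK1]
      positivity
    rw [this, measure_univ]
    exact ENNReal.ofReal_le_one.2 (by linarith)
  have hM' : (1 : ℝ) ≤ M := by exact_mod_cast hM
  have hK' : (2 : ℝ) ≤ K := by exact_mod_cast hK2
  have hT' : (1 : ℝ) ≤ T := by exact_mod_cast hT
  have hMK : (2 : ℝ) ≤ M * K := by nlinarith
  have hMKT : (2 : ℝ) ≤ M * K * T := by nlinarith
  have hx : (2 : ℝ) ≤ M * K * T / δ := by
    rw [le_div_iff₀ hδ0]; linarith
  have h2x : 2 * (M : ℝ) * K * T / δ = 2 * (M * K * T / δ) := by ring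
  have hlog : Real.log (2 * M * K * T / δ) ≤ 2 * Real.log (M * K * T / δ) := by
    rw [h2x, Real.log_mul (by norm_num) (by positivity)]
    have := Real.log_le_log (by norm_num) hx
    linarith
  have hN : (0 : ℝ) < betaDom G M := by
    exact_mod_cast one_le_betaDom hK hM hG
  refine (le_measure_regret_le hK hM hT hσ hδ0 (one_le_log_of_four_le (by rw [h2x]; linarith))
    (betaDom G M) hN (fun τ ctx a U h => by exact_mod_cast h.card_le_betaDom hG) ctx E).trans
    (measure_mono fun p hp => ?_)
  have hp' : regret G (armElim G M T δ σ) E.mean ctx p.1 p.2 ≤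
      24 * Real.sqrt (Real.log (2 * M * K * T / δ) * (betaDom G M * T)) := hp
  refine hp'.trans ?_
  have h2 : Real.sqrt (Real.log (2 * M * K * T / δ) * (betaDom G M * T)) ≤
      Real.sqrt (2 ^ 2 * (T * betaDom G M * Real.log (M * K * T / δ))) := by
    refine Real.sqrt_le_sqrt ?_
    have h3 : 0 ≤ (betaDom G M : ℝ) * T := by positivity
    have h4 : 0 ≤ Real.log (M * K * T / δ) := Real.log_nonneg (by linarith)
    nlinarith [mul_le_mul_of_nonneg_right hlog h3, mul_nonneg h3 h4]
  rw [Real.sqrt_mul (show (0 : ℝ) ≤ 2 ^ 2 by norm_num),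
    Real.sqrt_sq (show (0 : ℝ) ≤ 2 by norm_num)] at h2
  linarith

theorem log_natCast_ge (hK : 2 ≤ K) : 0.69 ≤ Real.log K := by
  have h1 : Real.log 2 ≤ Real.log K := Real.log_le_log (by norm_num) (by exact_mod_cast hK)
  have := Real.log_two_gt_d9
  linarith

theorem log_mul_ge (hK : 2 ≤ K) (hM : 0 < M) (hT : 0 < T) :
    0.69 ≤ Real.log ((M : ℝ) * K * T) := by
  have h := log_natCast_ge (K := M * K * T) (by
    have : 2 ≤ M * K := le_trans hK (Nat.le_mul_of_pos_left _ hM)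
    exact le_trans this (Nat.le_mul_of_pos_right _ hT))
  push_cast at h
  exact h

theorem worstRegret_le_min (hK : 0 < K) (hM : 0 < M) (hT : 0 < T)
    (hG : ∀ a, G.Adj a a) (hσ : IsGreedy G σ) :
    worstRegret G (armElim G M T (1 / (T + 1)) σ) T ≤
      400 * (Real.log K * Real.sqrt (Real.log (M * K * T))) *
        Real.sqrt ((min (betaBar G M) (masNumber G) : ℕ) * T) := by
  rcases Nat.lt_or_ge K 2 with hK1 | hK2
  · rw [worstRegret_eq_zero (by omega)]
    have := Real.log_natCast_nonneg K
    positivity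
  have hlK := log_natCast_ge hK2
  have hlX := log_mul_ge hK2 hM hT
  have hb1 : 1 ≤ min (betaBar G M) (masNumber G) :=
    le_min (one_le_betaBar hK hM hG) (one_le_masNumber hK hG)
  set b : ℕ := min (betaBar G M) (masNumber G) with hb
  have hb1' : (1 : ℝ) ≤ b := by exact_mod_cast hb1
  have hT' : (1 : ℝ) ≤ T := by exact_mod_cast hT
  -- Since log K ≥ 0.69, both 2 (1 + log K) and 1 are at most 6 log K, which covers either value of
  -- the minimum.
  have hgame : GameBound G M (6 * Real.log K * b) := by
    intro τ ctx a U h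
    have h1 : (τ.card : ℝ) ≤ masNumber G := by exact_mod_cast h.card_le_masNumber hG
    have h2 := h.card_le_betaBar hG
    rw [Fintype.card_fin] at h2
    rcases min_choice (betaBar G M) (masNumber G) with he | he
    · rw [hb, he] at *
      nlinarith
    · rw [hb, he] at *
      nlinarith
  have h := worstRegret_armElim_le hK2 hM hT hσ (6 * Real.log K * b) (by positivity) hgame
  refine h.trans ?_
  set x := Real.log K
  set X := Real.log ((M : ℝ) * K * T)
  have hbT : (1 : ℝ) ≤ b * T := by nlinarith
  have hs1 : (0.5 : ℝ) ≤ Real.sqrt X := Real.le_sqrt_of_sq_le (by norm_num; linarith)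
  have hs2 : (1 : ℝ) ≤ Real.sqrt (b * T) := Real.one_le_sqrt.2 hbT
  have hsq : Real.sqrt (X * (6 * x * b * T)) ≤ 4 * (x * Real.sqrt X) * Real.sqrt (b * T) := by
    refine Real.sqrt_le_iff.2 ⟨by positivity, ?_⟩
    rw [mul_pow, mul_pow, mul_pow, Real.sq_sqrt (by linarith), Real.sq_sqrt (by linarith)]
    have : 6 * x ≤ 16 * x ^ 2 := by nlinarith
    have h0 : 0 ≤ X * (b * T) := by positivity
    nlinarith [mul_le_mul_of_nonneg_right this h0]
  -- This absorbs the additive 1 from the bad event.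
  have hone : 0.3 ≤ (x * Real.sqrt X) * Real.sqrt (b * T) := by
    have h1 : 0.3 ≤ x * Real.sqrt X := by nlinarith
    nlinarith
  nlinarith

theorem worstRegret_le_beta (hK : 0 < K) (hM : 0 < M) (hT : 0 < T)
    (hG : ∀ a, G.Adj a a) (hσ : IsGreedy G σ)
    (hcase : (∀ a b, G.Adj a b → G.Adj b a) ∨ (∀ a b c, G.Adj a b → G.Adj b c → G.Adj a c)) :
    worstRegret G (armElim G M T (1 / (T + 1)) σ) T ≤
      100 * Real.sqrt (Real.log K * Real.log (M * K * T)) * Real.sqrt (beta G M * T) := by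
  rcases Nat.lt_or_ge K 2 with hK1 | hK2
  · rw [worstRegret_eq_zero (by omega)]
    positivity
  have hlK := log_natCast_ge hK2
  have hlX := log_mul_ge hK2 hM hT
  have hb1' : (1 : ℝ) ≤ beta G M := by exact_mod_cast one_le_beta hK hM hG
  have hT' : (1 : ℝ) ≤ T := by exact_mod_cast hT
  have hgame : GameBound G M (beta G M) := by
    intro τ ctx a U h
    rcases hcase with hs | ht
    · exact_mod_cast h.card_le_beta_of_symm hG hs
    · exact_mod_cast h.card_le_beta_of_trans hG ht
  have h := worstRegret_armElim_le hK2 hM hT hσ (beta G M) (by positivity) hgame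
  refine h.trans ?_
  set x := Real.log K
  set X := Real.log ((M : ℝ) * K * T)
  have hbT : (1 : ℝ) ≤ beta G M * T := by nlinarith
  have hs2 : (1 : ℝ) ≤ Real.sqrt (beta G M * T) := Real.one_le_sqrt.2 hbT
  have hs1 : (0.5 : ℝ) ≤ Real.sqrt (x * X) := Real.le_sqrt_of_sq_le (by norm_num; nlinarith)
  -- The game bound loses no logarithm here; the factor log K enters only through log K ≥ 1/4.
  have hsq : Real.sqrt (X * (beta G M * T)) ≤ 2 * Real.sqrt (x * X) * Real.sqrt (beta G M * T) := by
    rw [Real.sqrt_mul (show 0 ≤ X by linarith)]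
    refine mul_le_mul_of_nonneg_right ?_ (by positivity)
    refine Real.sqrt_le_iff.2 ⟨by positivity, ?_⟩
    rw [mul_pow, Real.sq_sqrt (by nlinarith)]
    nlinarith
  nlinarith

end

end GraphBandit

namespace GraphBandit

/-! ### Expectations over runs with finitely supported rewards -/

section Expect

variable {M K : ℕ} {X : Type*} [Fintype X]

/-- The expectation of `F` at the end of a run of the deterministic policy `act` that starts from
the history `h` and goes through the contexts `cs`, if the reward array of every round is `R x`
with probability `p x`. -/
noncomputable def expect (G : Digraph (Fin K)) (act : List (Round M K) → Fin M → Fin K)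
    (R : X → Fin M → Fin K → ℝ) (p : X → ℝ) :
    List (Fin M) → List (Round M K) → (List (Round M K) → ℝ) → ℝ
  | [], h, F => F h
  | c :: cs, h, F =>
    ∑ x, p x * expect G act R p cs ((c, act h c, observe G (act h c) (R x)) :: h) F

variable {G : Digraph (Fin K)} {act : List (Round M K) → Fin M → Fin K}
  {R : X → Fin M → Fin K → ℝ} {p : X → ℝ} {F F' : List (Round M K) → ℝ}

/-- Only histories that carry the prescribed contexts have to be compared; this is how the phases of
the context sequence enter the lower bound. -/
theorem expect_mono (hp : ∀ x, 0 ≤ p x) (cs : List (Fin M)) (h : List (Round M K))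
    (hF : ∀ g : List (Round M K), g.map Prod.fst = cs.reverse → F (g ++ h) ≤ F' (g ++ h)) :
    expect G act R p cs h F ≤ expect G act R p cs h F' := by
  induction cs generalizing h with
  | nil => simpa [expect] using hF [] rfl
  | cons c cs ih =>
    refine Finset.sum_le_sum fun x _ => mul_le_mul_of_nonneg_left (ih _ fun g hg => ?_) (hp x)
    have := hF (g ++ [(c, act h c, observe G (act h c) (R x))]) (by simp [hg])
    simpa using this

theorem expect_const (hsum : ∑ x, p x = 1) (cs : List (Fin M)) (h : List (Round M K)) (k : ℝ) :
    expect G act R p cs h (fun _ => k) = k := by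
  induction cs generalizing h with
  | nil => rfl
  | cons c cs ih => simp [expect, ih, ← Finset.sum_mul, hsum]

theorem expect_add (cs : List (Fin M)) (h : List (Round M K)) :
    expect G act R p cs h (fun h => F h + F' h) =
      expect G act R p cs h F + expect G act R p cs h F' := by
  induction cs generalizing h with
  | nil => rfl
  | cons c cs ih => simp [expect, ih, mul_add, Finset.sum_add_distrib]

theorem expect_mul (cs : List (Fin M)) (h : List (Round M K)) (k : ℝ) :
    expect G act R p cs h (fun h => k * F h) = k * expect G act R p cs h F := by
  induction cs generalizing h with
  | nil => rfl
  | cons c cs ih =>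
    simp only [expect, ih, Finset.mul_sum]
    exact Finset.sum_congr rfl fun x _ => by ring

theorem expect_sum {ι : Type*} (s : Finset ι) (f : ι → List (Round M K) → ℝ)
    (cs : List (Fin M)) (h : List (Round M K)) :
    expect G act R p cs h (fun h => ∑ i ∈ s, f i h) = ∑ i ∈ s, expect G act R p cs h (f i) := by
  classical
  induction s using Finset.induction_on with
  | empty =>
    simp only [Finset.sum_empty]
    have := expect_mul (G := G) (act := act) (R := R) (p := p) (F := fun _ => (0 : ℝ)) cs h 0
    simpa using this
  | insert i s hi ih => simp only [Finset.sum_insert hi, expect_add, ih]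

theorem expect_append (cs cs' : List (Fin M)) (h : List (Round M K)) :
    expect G act R p (cs ++ cs') h F =
      expect G act R p cs h fun h' => expect G act R p cs' h' F := by
  induction cs generalizing h with
  | nil => rfl
  | cons c cs ih => simp [expect, ih]

/-- Expectations of functions that only grow along runs. -/
theorem expect_le_expect_append (hp : ∀ x, 0 ≤ p x) (hsum : ∑ x, p x = 1)
    (hF : ∀ x h, F h ≤ F (x :: h)) (cs cs' : List (Fin M)) (h : List (Round M K)) :
    expect G act R p cs h F ≤ expect G act R p (cs ++ cs') h F := by
  rw [expect_append]
  refine expect_mono hp _ _ fun g _ => ?_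
  have hg : ∀ g h, F h ≤ F (g ++ h) := fun g h => by
    induction g with
    | nil => exact le_rfl
    | cons x g ih => exact ih.trans (hF x _)
  rw [← expect_const (G := G) (act := act) (R := R) hsum cs' (g ++ h) (F (g ++ h))]
  exact expect_mono hp _ _ fun g' _ => hg g' _

end Expect

/-! ### Independent bits -/

section Bits

variable {K : ℕ}

/-- The probability of the bits `x` if they are independent and `x a` holds with probability
`ν a`. -/
def bitProb (ν : Fin K → ℝ) (x : Fin K → Bool) : ℝ := ∏ a, if x a then ν a else 1 - ν a

theorem bitProb_nonneg {ν : Fin K → ℝ} (hν : ∀ a, ν a ∈ Set.Icc (0 : ℝ) 1) (x : Fin K → Bool) :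
    0 ≤ bitProb ν x := by
  refine Finset.prod_nonneg fun a _ => ?_
  split_ifs
  · exact (hν a).1
  · linarith [(hν a).2]

theorem sum_bitProb_mul (ν : Fin K → ℝ) (v : Fin K) (f : Bool → ℝ) :
    ∑ x, bitProb ν x * f (x v) = ν v * f true + (1 - ν v) * f false := by
  have h1 : ∀ x : Fin K → Bool, bitProb ν x * f (x v) =
      ∏ a, (if x a then ν a else 1 - ν a) * (if a = v then f (x a) else 1) := fun x => by
    rw [Finset.prod_mul_distrib, Finset.prod_ite_eq' Finset.univ v (fun a => f (x a)), bitProb]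
    simp
  simp_rw [h1]
  have h2 := Finset.prod_univ_sum (fun _ : Fin K => (Finset.univ : Finset Bool))
    (fun a b => (if b then ν a else 1 - ν a) * (if a = v then f b else 1))
  rw [Fintype.piFinset_univ] at h2
  rw [← h2, Finset.prod_eq_single v]
  · simp
  · intro a _ ha
    simp [ha]
  · simp

theorem sum_bitProb (ν : Fin K → ℝ) : ∑ x, bitProb ν x = 1 := by
  have h2 := Finset.prod_univ_sum (fun _ : Fin K => (Finset.univ : Finset Bool))
    (fun a b => (if b then ν a else 1 - ν a))
  rw [Fintype.piFinset_univ] at h2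
  unfold bitProb
  rw [← h2]
  simp

theorem bitProb_update (ν : Fin K → ℝ) (v : Fin K) (q : ℝ) (hv0 : ν v ≠ 0) (hv1 : 1 - ν v ≠ 0)
    (x : Fin K → Bool) : bitProb (Function.update ν v q) x =
      bitProb ν x * (if x v then q / ν v else (1 - q) / (1 - ν v)) := by
  unfold bitProb
  rw [← Finset.mul_prod_erase _ _ (Finset.mem_univ v),
    ← Finset.mul_prod_erase (a := v) _ (fun a => if x a then ν a else 1 - ν a) (Finset.mem_univ v)]
  have : ∏ a ∈ Finset.univ.erase v, (if x a = true then Function.update ν v q a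
      else 1 - Function.update ν v q a) =
      ∏ a ∈ Finset.univ.erase v, (if x a = true then ν a else 1 - ν a) :=
    Finset.prod_congr rfl fun a ha => by
      rw [Function.update_of_ne (Finset.ne_of_mem_erase ha)]
  rw [this, Function.update_self]
  split_ifs
  · field_simp
  · field_simp

/-- The law of a function that does not depend on the bit `v` does not depend on `ν v`. -/
theorem sum_bitProb_update (ν : Fin K → ℝ) (v : Fin K) (q : ℝ) (g : (Fin K → Bool) → ℝ)
    (hg : ∀ x, g (Function.update x v (!x v)) = g x) :
    ∑ x, bitProb (Function.update ν v q) x * g x = ∑ x, bitProb ν x * g x := by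
  have hinv : Function.Involutive fun x : Fin K → Bool => Function.update x v (!x v) := fun x => by
    simp
  have hflip : ∀ ν' : Fin K → ℝ, 2 * ∑ x, bitProb ν' x * g x =
      ∑ x, (bitProb ν' x + bitProb ν' (Function.update x v (!x v))) * g x := fun ν' => by
    have h1 : ∑ x, bitProb ν' (Function.update x v (!x v)) * g x = ∑ x, bitProb ν' x * g x := by
      rw [← Equiv.sum_comp (Function.Involutive.toPerm _ hinv) fun x => bitProb ν' x * g x]
      exact Finset.sum_congr rfl fun x _ => by
        simp only [Function.Involutive.coe_toPerm, hg]
    simp_rw [add_mul, Finset.sum_add_distrib, h1]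
    ring
  -- Pairing x with its flip at v sums out the factor of v, the only one that depends on the bias of
  -- v.
  have hpair : ∀ (ν' : Fin K → ℝ) (x : Fin K → Bool),
      bitProb ν' x + bitProb ν' (Function.update x v (!x v)) =
        ∏ a ∈ Finset.univ.erase v, (if x a then ν' a else 1 - ν' a) := fun ν' x => by
    unfold bitProb
    rw [← Finset.mul_prod_erase _ _ (Finset.mem_univ v),
      ← Finset.mul_prod_erase (a := v) _ (fun a => if Function.update x v (!x v) a then ν' a
        else 1 - ν' a) (Finset.mem_univ v)]
    have : ∏ a ∈ Finset.univ.erase v, (if Function.update x v (!x v) a then ν' a else 1 - ν' a) =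
        ∏ a ∈ Finset.univ.erase v, (if x a then ν' a else 1 - ν' a) :=
      Finset.prod_congr rfl fun a ha => by
        rw [Function.update_of_ne (Finset.ne_of_mem_erase ha)]
    rw [this, ← add_mul, Function.update_self]
    cases x v <;> simp
  have h2 : 2 * ∑ x, bitProb (Function.update ν v q) x * g x = 2 * ∑ x, bitProb ν x * g x := by
    rw [hflip, hflip]
    refine Finset.sum_congr rfl fun x _ => ?_
    rw [hpair, hpair]
    congr 1
    exact Finset.prod_congr rfl fun a ha => by
      rw [Function.update_of_ne (Finset.ne_of_mem_erase ha)]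
  linarith

end Bits

/-! ### Change of measure -/

/-- A pointwise form of Pinsker's inequality, with z a likelihood ratio. For z < 1 and y = 1 - z,
two terms of the logarithmic series give z - 1 - log z ≥ y²/2, and y ≤ 1/4 + y². -/
theorem mul_one_sub_le {f z : ℝ} (hf0 : 0 ≤ f) (hf1 : f ≤ 1) (hz : 0 < z) :
    f - z * f ≤ 1 / 4 + 2 * (z - 1 - Real.log z) := by
  have hlog := Real.log_le_sub_one_of_pos hz
  rcases le_or_gt 1 z with h1 | h1
  · nlinarith
  · have hsum := Real.hasSum_pow_div_log_of_abs_lt_one (x := 1 - z)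
      (by rw [abs_lt]; constructor <;> linarith)
    have h2 := sum_le_hasSum (Finset.range 2) (fun n _ => by
      have : 0 ≤ 1 - z := by linarith
      positivity) hsum
    simp only [Finset.sum_range_succ, Finset.sum_range_zero, sub_sub_cancel] at h2
    norm_num at h2
    nlinarith [sq_nonneg (1 - z - 1 / 2)]

section ChangeOfMeasure

variable {M K : ℕ} {G : Digraph (Fin K)} {act : List (Round M K) → Fin M → Fin K}
  {R : (Fin K → Bool) → Fin M → Fin K → ℝ} {F : List (Round M K) → ℝ}

/-- Raising the mean of the bit `v` from `1/2 - Δ` to `1/2 + Δ` changes expectations by little,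
unless `v` is observed often. -/
theorem expect_sub_expect_le {ν : Fin K → ℝ} (hν : ∀ a, ν a ∈ Set.Icc (0 : ℝ) 1) (v : Fin K)
    {Δ : ℝ} (hΔ0 : 0 ≤ Δ) (hΔ : Δ ≤ 1 / 4) (hv : ν v = 1 / 2 - Δ)
    (hR : ∀ x c b, b ≠ v → R (Function.update x v (!x v)) c b = R x c b)
    (hF0 : ∀ h, 0 ≤ F h) (hF1 : ∀ h, F h ≤ 1) (cs : List (Fin M)) (h : List (Round M K)) (z : ℝ)
    (hz : 0 < z) :
    expect G act R (bitProb ν) cs h F -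
        z * expect G act R (bitProb (Function.update ν v (1 / 2 + Δ))) cs h F ≤
      1 / 4 + 2 * (z - 1 - Real.log z + 16 * Δ ^ 2 *
        (expect G act R (bitProb ν) cs h (fun h => (obsCount G v h : ℝ)) - obsCount G v h)) := by
  classical
  -- Here z is the running likelihood ratio. Each observation of v multiplies it by a factor ρ of
  -- mean 1, so z - 1 - log z grows on average by the mean of -log ρ, a relative entropy.
  induction cs generalizing h z with
  | nil =>
    simp only [expect, sub_self, mul_zero, add_zero]
    exact mul_one_sub_le (hF0 h) (hF1 h) hz
  | cons c cs ih =>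
    simp only [expect]
    set a := act h c with ha
    set hx : (Fin K → Bool) → List (Round M K) := fun x => (c, a, observe G a (R x)) :: h with hhx
    set E0 := fun x => expect G act R (bitProb ν) cs (hx x) F with hE0
    set E1 := fun x => expect G act R (bitProb (Function.update ν v (1 / 2 + Δ))) cs (hx x) F
      with hE1
    set O := fun x => expect G act R (bitProb ν) cs (hx x) (fun h => (obsCount G v h : ℝ)) with hO
    change ∑ x, bitProb ν x * E0 x -
      z * ∑ x, bitProb (Function.update ν v (1 / 2 + Δ)) x * E1 x ≤
      1 / 4 + 2 * (z - 1 - Real.log z + 16 * Δ ^ 2 * (∑ x, bitProb ν x * O x - obsCount G v h))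
    have hp := bitProb_nonneg hν
    have hsum := sum_bitProb ν
    by_cases hadj : G.Adj a v
    · -- the arm is observed
      set ρ : Bool → ℝ := fun b =>
        if b then (1 / 2 + Δ) / (1 / 2 - Δ) else (1 - (1 / 2 + Δ)) / (1 - (1 / 2 - Δ)) with hρ
      have hρpos : ∀ b, 0 < ρ b := fun b => by
        cases b
        · simp only [hρ, Bool.false_eq_true, if_false]
          apply div_pos <;> linarith
        · simp only [hρ, if_true]
          apply div_pos <;> linarith
      have hprob : ∀ x, bitProb (Function.update ν v (1 / 2 + Δ)) x = bitProb ν x * ρ (x v) :=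
        fun x => by
          rw [bitProb_update ν v _ (by rw [hv]; linarith) (by rw [hv]; linarith), hv]
      have hcnt : ∀ x, (obsCount G v (hx x) : ℝ) = obsCount G v h + 1 := fun x => by
        rw [hhx, obsCount_cons, if_pos hadj]; push_cast; ring
      have hstep : ∀ x, bitProb ν x * (E0 x - z * ρ (x v) * E1 x) ≤ bitProb ν x *
          (1 / 4 + 2 * (z * ρ (x v) - 1 - (Real.log z + Real.log (ρ (x v))) + 16 * Δ ^ 2 *
            (O x - (obsCount G v h + 1)))) := fun x => by
        refine mul_le_mul_of_nonneg_left ?_ (hp x)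
        have := ih (hx x) (z * ρ (x v)) (mul_pos hz (hρpos _))
        rw [Real.log_mul hz.ne' (hρpos _).ne', hcnt] at this
        exact this
      have hL : ∑ x, bitProb ν x * E0 x -
          z * ∑ x, bitProb (Function.update ν v (1 / 2 + Δ)) x * E1 x =
          ∑ x, bitProb ν x * (E0 x - z * ρ (x v) * E1 x) := by
        simp_rw [hprob, Finset.mul_sum, ← Finset.sum_sub_distrib]
        exact Finset.sum_congr rfl fun x _ => by ring
      have hSρ : ∑ x, bitProb ν x * ρ (x v) = 1 := by
        simp_rw [← hprob]; exact sum_bitProb _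
      have hSlog := sum_bitProb_mul ν v fun b => Real.log (ρ b)
      have hRs : ∑ x, bitProb ν x *
          (1 / 4 + 2 * (z * ρ (x v) - 1 - (Real.log z + Real.log (ρ (x v))) + 16 * Δ ^ 2 *
            (O x - (obsCount G v h + 1)))) =
          (1 / 4 + 2 * (-1 - Real.log z - 16 * Δ ^ 2 * (obsCount G v h + 1))) * ∑ x, bitProb ν x +
          2 * z * ∑ x, bitProb ν x * ρ (x v) - 2 * ∑ x, bitProb ν x * Real.log (ρ (x v)) +
          2 * (16 * Δ ^ 2) * ∑ x, bitProb ν x * O x := by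
        simp_rw [Finset.mul_sum, ← Finset.sum_add_distrib, ← Finset.sum_sub_distrib,
          ← Finset.sum_add_distrib]
        exact Finset.sum_congr rfl fun x _ => by ring
      have hlogf : Real.log (ρ false) = - Real.log (ρ true) := by
        rw [← Real.log_inv]
        congr 1
        simp only [hρ, Bool.false_eq_true, if_false, if_true, inv_div]
        congr 1 <;> ring
      -- As the two log-ratios are opposite, the entropy per observation is 2 Δ log (ρ true) ≤ 16
      -- Δ².
      have hlogt : Real.log (ρ true) ≤ 8 * Δ := by
        refine (Real.log_le_sub_one_of_pos (hρpos true)).trans ?_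
        simp only [hρ, if_true]
        rw [div_sub_one (by linarith), div_le_iff₀ (by linarith)]
        nlinarith
      rw [hlogf, hv] at hSlog
      rw [hL]
      refine (Finset.sum_le_sum fun x _ => hstep x).trans ?_
      rw [hRs, hsum, hSρ, hSlog]
      nlinarith
    · -- the arm is not observed
      have hobs : ∀ x, observe G a (R (Function.update x v (!x v))) = observe G a (R x) := fun x => by
        funext c' b
        unfold observe
        split_ifs with hb
        · exact hR x c' b (by rintro rfl; exact hadj hb)
        · rfl
      have hcnt : ∀ x, (obsCount G v (hx x) : ℝ) = obsCount G v h := fun x => by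
        rw [hhx, obsCount_cons, if_neg hadj]; push_cast; ring
      rw [sum_bitProb_update ν v _ E1 fun x => by simp only [hE1, hhx, hobs]]
      have hstep : ∀ x, bitProb ν x * (E0 x - z * E1 x) ≤ bitProb ν x *
          (1 / 4 + 2 * (z - 1 - Real.log z + 16 * Δ ^ 2 * (O x - obsCount G v h))) := fun x => by
        refine mul_le_mul_of_nonneg_left ?_ (hp x)
        have := ih (hx x) z hz
        rw [hcnt] at this
        exact this
      have hL : ∑ x, bitProb ν x * E0 x - z * ∑ x, bitProb ν x * E1 x =
          ∑ x, bitProb ν x * (E0 x - z * E1 x) := by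
        simp_rw [Finset.mul_sum, ← Finset.sum_sub_distrib]
        exact Finset.sum_congr rfl fun x _ => by ring
      have hRs : ∑ x, bitProb ν x *
          (1 / 4 + 2 * (z - 1 - Real.log z + 16 * Δ ^ 2 * (O x - obsCount G v h))) =
          (1 / 4 + 2 * (z - 1 - Real.log z - 16 * Δ ^ 2 * obsCount G v h)) * ∑ x, bitProb ν x +
          2 * (16 * Δ ^ 2) * ∑ x, bitProb ν x * O x := by
        simp_rw [Finset.mul_sum, ← Finset.sum_add_distrib]
        exact Finset.sum_congr rfl fun x _ => by ring
      rw [hL]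
      refine (Finset.sum_le_sum fun x _ => hstep x).trans ?_
      rw [hRs, hsum]
      linarith

end ChangeOfMeasure

end GraphBandit

namespace GraphBandit

/-! ### Environments with finitely supported rewards -/

section FiniteEnvironment

variable {M K T : ℕ} {X : Type*} [Fintype X] {G : Digraph (Fin K)}

/-- The law of `R x` if `x` has probability `p x`. -/
noncomputable def finiteLaw (p : X → ℝ) (R : X → Fin M → Fin K → ℝ) :
    Measure (Fin M → Fin K → ℝ) :=
  ∑ x, ENNReal.ofReal (p x) • Measure.dirac (R x)

variable {p : X → ℝ} {R : X → Fin M → Fin K → ℝ}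

theorem lintegral_finiteLaw (f : (Fin M → Fin K → ℝ) → ENNReal) :
    ∫⁻ r, f r ∂(finiteLaw p R) = ∑ x, ENNReal.ofReal (p x) * f (R x) := by
  simp [finiteLaw, lintegral_smul_measure]

theorem isProbabilityMeasure_finiteLaw (hp : ∀ x, 0 ≤ p x) (hsum : ∑ x, p x = 1) :
    IsProbabilityMeasure (finiteLaw p R) := by
  constructor
  rw [← lintegral_one, lintegral_finiteLaw]
  simp only [mul_one]
  rw [← ENNReal.ofReal_sum_of_nonneg fun x _ => hp x, hsum, ENNReal.ofReal_one]

/-- The environment where in every round the reward array is `R x` with probability `p x`. -/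
noncomputable def finiteEnvironment (T : ℕ) (p : X → ℝ) (R : X → Fin M → Fin K → ℝ)
    (hp : ∀ x, 0 ≤ p x) (hsum : ∑ x, p x = 1) (hR : ∀ x c a, R x c a ∈ Set.Icc (0 : ℝ) 1) :
    Environment T M K where
  law _ := finiteLaw p R
  isProb _ := isProbabilityMeasure_finiteLaw hp hsum
  bounded _ := by
    rw [ae_iff]
    simp only [finiteLaw, Measure.coe_finsetSum, Finset.sum_apply, Measure.smul_apply,
      smul_eq_mul]
    refine Finset.sum_eq_zero fun x _ => ?_
    rw [Measure.dirac_apply, Set.indicator_of_notMem (by simpa using hR x), mul_zero]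
  mean c a := ∑ x, p x * R x c a
  mean_eq _ c a := by
    unfold finiteLaw
    rw [integral_finsetSum_measure fun x _ => (integrable_dirac (by simp)).smul_measure (by simp)]
    refine Finset.sum_congr rfl fun x _ => ?_
    rw [integral_smul_measure, integral_dirac, ENNReal.toReal_ofReal (hp x), smul_eq_mul]

theorem measurable_expect {Ω : Type*} [MeasurableSpace Ω] {π : Policy M K} (hπ : π.Admissible)
    {F : List (Round M K) → ℝ}
    (hF : ∀ h : Ω → List (Round M K), MeasurableHistory h → Measurable fun ω => F (h ω))
    {u : Ω → ℝ} (hu : Measurable u) (cs : List (Fin M)) {h : Ω → List (Round M K)}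
    (hh : MeasurableHistory h) :
    Measurable fun ω => expect G (π.act (u ω)) R p cs (h ω) F := by
  induction cs generalizing h with
  | nil => exact hF h hh
  | cons c cs ih =>
    simp only [expect]
    refine Finset.measurable_fun_sum _ fun x _ => (ih (.cons ?_ hh)).const_mul _
    have ha := measurable_act hπ hh hu c
    exact measurable_const.prodMk (ha.prodMk (measurable_observe ha measurable_const))

theorem expect_nonneg (hp : ∀ x, 0 ≤ p x) (hsum : ∑ x, p x = 1)
    {act : List (Round M K) → Fin M → Fin K} {F : List (Round M K) → ℝ} (hF : ∀ h, 0 ≤ F h)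
    (cs : List (Fin M)) (h : List (Round M K)) : 0 ≤ expect G act R p cs h F := by
  rw [← expect_const (G := G) (act := act) (R := R) hsum cs h 0]
  exact expect_mono hp cs h fun g _ => hF _

/-- The expectation of a function of the final history. -/
theorem lintegral_history (hp : ∀ x, 0 ≤ p x) (hsum : ∑ x, p x = 1) {π : Policy M K}
    (hπ : π.Admissible) (u : ℝ) {F : List (Round M K) → ℝ} (hF0 : ∀ h, 0 ≤ F h)
    (hF : ∀ h : (Fin T → Fin M → Fin K → ℝ) → List (Round M K), MeasurableHistory h →
      Measurable fun ω => F (h ω)) (ctx : Fin T → Fin M) :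
    ∫⁻ r, ENNReal.ofReal (F (history G π ctx u r T le_rfl))
      ∂(Measure.pi fun _ : Fin T => finiteLaw p R) =
      ENNReal.ofReal (expect G (π.act u) R p (List.ofFn ctx) [] F) := by
  classical
  have hprob := isProbabilityMeasure_finiteLaw (R := R) hp hsum
  have hhist := fun t ht => measurableHistory_history (G := G) hπ ctx
    (measurable_const (a := u)) (measurable_id (α := Fin T → Fin M → Fin K → ℝ)) t ht
  -- The integral does not depend on the time t at which `expect` takes over from the actual run: t
  -- = T is the claim, t = 0 its value.
  have key : ∀ t, ∀ ht : t ≤ T,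
      ∫⁻ r, ENNReal.ofReal (expect G (π.act u) R p ((List.ofFn ctx).drop t)
        (history G π ctx u r t ht) F) ∂(Measure.pi fun _ : Fin T => finiteLaw p R) =
      ENNReal.ofReal (expect G (π.act u) R p (List.ofFn ctx) [] F) := by
    intro t
    induction t with
    | zero =>
      intro ht
      simp [history]
    | succ t ih =>
      intro ht
      rw [← ih (by omega)]
      refine lintegral_eq_of_lmarginal_eq {⟨t, ht⟩}
        (ENNReal.measurable_ofReal.comp (measurable_expect hπ hF measurable_const _ (hhist _ _)))
        (ENNReal.measurable_ofReal.comp (measurable_expect hπ hF measurable_const _ (hhist _ _)))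
        (funext fun r => ?_)
      rw [lmarginal_singleton, lmarginal_singleton]
      have hpast : ∀ x, history G π ctx u (Function.update r ⟨t, ht⟩ x) t (by omega) =
          history G π ctx u r t (by omega) := fun x => history_congr t _ fun s hs =>
        Function.update_of_ne (by rintro rfl; simp at hs) _ _
      have hdrop : (List.ofFn ctx).drop t = ctx ⟨t, ht⟩ :: (List.ofFn ctx).drop (t + 1) := by
        rw [List.drop_eq_getElem_cons (by simpa using ht)]
        simp
      simp only [history, hpast, Function.update_self]
      rw [lintegral_const, measure_univ, mul_one, lintegral_finiteLaw, hdrop, expect,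
        ENNReal.ofReal_sum_of_nonneg fun x _ =>
          mul_nonneg (hp x) (expect_nonneg hp hsum hF0 _ _)]
      exact Finset.sum_congr rfl fun x _ => (ENNReal.ofReal_mul (hp x)).symm
  rw [← key T le_rfl]
  refine lintegral_congr fun r => ?_
  rw [List.drop_of_length_le (by simp)]
  rfl

/-- The regret accumulated along a history. -/
noncomputable def totalGap (μ : Fin M → Fin K → ℝ) (h : List (Round M K)) : ℝ :=
  (h.map fun x => (⨆ a, μ x.1 a) - μ x.1 x.2.1).sum

theorem gap_nonneg (μ : Fin M → Fin K → ℝ) (c : Fin M) (a : Fin K) : 0 ≤ (⨆ a, μ c a) - μ c a :=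
  sub_nonneg.2 (le_ciSup (Set.finite_range _).bddAbove _)

theorem totalGap_nonneg (μ : Fin M → Fin K → ℝ) (h : List (Round M K)) : 0 ≤ totalGap μ h := by
  refine List.sum_nonneg fun y hy => ?_
  obtain ⟨x, -, rfl⟩ := List.mem_map.1 hy
  exact gap_nonneg _ _ _

theorem measurable_totalGap {Ω : Type*} [MeasurableSpace Ω] (μ : Fin M → Fin K → ℝ)
    {h : Ω → List (Round M K)} (hh : MeasurableHistory h) :
    Measurable fun ω => totalGap μ (h ω) := by
  refine measurable_sum_map hh ?_
  have h1 : Measurable fun p : Fin M × Fin K => (⨆ a, μ p.1 a) - μ p.1 p.2 :=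
    Measurable.of_discrete
  have h2 : Measurable fun x : Round M K => (x.1, x.2.1) :=
    measurable_fst.prodMk measurable_snd.fst
  exact h1.comp h2

theorem regret_eq_totalGap (π : Policy M K) (μ : Fin M → Fin K → ℝ) (ctx : Fin T → Fin M) (u : ℝ)
    (r : Fin T → Fin M → Fin K → ℝ) :
    regret G π μ ctx u r = totalGap μ (history G π ctx u r T le_rfl) := by
  have key : ∀ t, ∀ ht : t ≤ T, totalGap μ (history G π ctx u r t ht) =
      ∑ s : Fin t, ((⨆ a, μ (ctx (Fin.castLE ht s)) a) - μ (ctx (Fin.castLE ht s))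
        (action G π ctx u r (Fin.castLE ht s))) := by
    intro t
    induction t with
    | zero => intro _; simp [history, totalGap]
    | succ t ih =>
      intro ht
      rw [Fin.sum_univ_castSucc]
      have h1 := ih (by omega)
      simp only [history, totalGap, List.map_cons, List.sum_cons] at h1 ⊢
      rw [h1, add_comm]
      rfl
  rw [key T le_rfl]
  rfl

/-- The expected regret as an average over the seeds. -/
theorem expectedRegret_finiteEnvironment (hK : 0 < K) (hT : 0 < T) (hp : ∀ x, 0 ≤ p x)
    (hsum : ∑ x, p x = 1) (hR : ∀ x c a, R x c a ∈ Set.Icc (0 : ℝ) 1) {π : Policy M K}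
    (hπ : π.Admissible) (ctx : Fin T → Fin M) :
    Integrable (fun u => expect G (π.act u) R p (List.ofFn ctx) []
        (totalGap (finiteEnvironment T p R hp hsum hR).mean)) π.seed ∧
      expectedRegret G π (finiteEnvironment T p R hp hsum hR) ctx =
        ∫ u, expect G (π.act u) R p (List.ofFn ctx) []
          (totalGap (finiteEnvironment T p R hp hsum hR).mean) ∂π.seed := by
  set E := finiteEnvironment T p R hp hsum hR with hE
  have := hπ.1
  have := E.isProb
  have hmeas := measurable_regret (G := G) hπ E.mean ctx measurable_fst
    (measurable_snd (α := ℝ) (β := Fin T → Fin M → Fin K → ℝ))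
  have hint : Integrable (fun p : ℝ × (Fin T → Fin M → Fin K → ℝ) =>
      regret G π E.mean ctx p.1 p.2) (π.seed.prod (Measure.pi E.law)) :=
    Integrable.of_mem_Icc 0 T hmeas.aemeasurable (ae_of_all _ fun p =>
      ⟨regret_nonneg _ _ _ _ _, regret_le hK π (E.mean_mem_Icc hT) _ _ _⟩)
  have hinner : ∀ u, ∫ r, regret G π E.mean ctx u r ∂(Measure.pi E.law) =
      expect G (π.act u) R p (List.ofFn ctx) [] (totalGap E.mean) := by
    intro u
    have hm : Measurable fun r => regret G π E.mean ctx u r :=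
      measurable_regret hπ E.mean ctx measurable_const measurable_id
    rw [integral_eq_lintegral_of_nonneg_ae (ae_of_all _ fun r => regret_nonneg _ _ _ _ _)
      hm.aestronglyMeasurable]
    simp_rw [regret_eq_totalGap]
    have := lintegral_history (G := G) (R := R) hp hsum hπ u (totalGap_nonneg E.mean)
      (fun h hh => measurable_totalGap E.mean hh) ctx
    refine (congrArg ENNReal.toReal this).trans (ENNReal.toReal_ofReal ?_)
    exact expect_nonneg hp hsum (totalGap_nonneg _) _ _
  constructor
  · have := hint.integral_prod_left
    simpa only [hinner] using this
  · unfold expectedRegret Environment.measure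
    rw [integral_prod _ hint]
    simp only [hinner]

end FiniteEnvironment

end GraphBandit

namespace GraphBandit

/-! ### The hard instances -/

section Resampling

variable {ι O : Type*} [Fintype ι] [DecidableEq ι] [Fintype O]

/-- Resampling one coordinate does not change averages over a product law. -/
theorem sum_prod_mul_resample (w : ι → O → ℝ) (c : ι) (hw : ∑ o, w c o = 1) (f : (ι → O) → ℝ) :
    ∑ θ : ι → O, (∏ i, w i (θ i)) * ∑ o, w c o * f (Function.update θ c o) =
      ∑ θ : ι → O, (∏ i, w i (θ i)) * f θ := by
  -- Swapping the coordinate c with its fresh copy preserves the joint weight.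
  have hinv : Function.Involutive fun q : (ι → O) × O => (Function.update q.1 c q.2, q.1 c) :=
    fun q => by simp
  have hswap : ∀ q : (ι → O) × O, (∏ i, w i (q.1 i)) * w c q.2 =
      (∏ i, w i (Function.update q.1 c q.2 i)) * w c (q.1 c) := fun q => by
    rw [← Finset.mul_prod_erase _ _ (Finset.mem_univ c),
      ← Finset.mul_prod_erase (a := c) _ (fun i => w i (Function.update q.1 c q.2 i))
        (Finset.mem_univ c)]
    have : ∏ i ∈ Finset.univ.erase c, w i (Function.update q.1 c q.2 i) =
        ∏ i ∈ Finset.univ.erase c, w i (q.1 i) :=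
      Finset.prod_congr rfl fun i hi => by rw [Function.update_of_ne (Finset.ne_of_mem_erase hi)]
    rw [this, Function.update_self]
    ring
  calc ∑ θ : ι → O, (∏ i, w i (θ i)) * ∑ o, w c o * f (Function.update θ c o)
      = ∑ q : (ι → O) × O, (∏ i, w i (q.1 i)) * w c q.2 * f (Function.update q.1 c q.2) := by
        rw [Fintype.sum_prod_type]
        simp_rw [Finset.mul_sum, mul_assoc]
    _ = ∑ q : (ι → O) × O, (∏ i, w i (Function.update q.1 c q.2 i)) * w c (q.1 c) *
          f (Function.update q.1 c q.2) := by simp_rw [hswap]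
    _ = ∑ q : (ι → O) × O, (∏ i, w i (q.1 i)) * w c q.2 * f q.1 :=
        Equiv.sum_comp (Function.Involutive.toPerm _ hinv)
          fun q : (ι → O) × O => (∏ i, w i (q.1 i)) * w c q.2 * f q.1
    _ = ∑ θ : ι → O, (∏ i, w i (θ i)) * f θ := by
        rw [Fintype.sum_prod_type]
        refine Finset.sum_congr rfl fun θ _ => ?_
        simp only
        rw [← Finset.sum_mul, ← Finset.mul_sum, hw, mul_one]

theorem sum_prod_eq_one (w : ι → O → ℝ) (hw : ∀ c, ∑ o, w c o = 1) :
    ∑ θ : ι → O, ∏ i, w i (θ i) = 1 := by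
  classical
  have h := Finset.prod_univ_sum (fun _ : ι => (Finset.univ : Finset O)) w
  rw [Fintype.piFinset_univ] at h
  rw [← h]
  exact Finset.prod_eq_one fun c _ => hw c

end Resampling

section HardInstance

variable {M K : ℕ}

/-- The rewards of the hard instance: the reference arm `r` always yields `1/2`, the arms `J c`
yield random bits under the context `c`, and all other rewards vanish. -/
noncomputable def hardReward (r : Fin K) (J : Fin M → Finset (Fin K)) (x : Fin K → Bool) (c : Fin M)
    (a : Fin K) : ℝ :=
  if a = r then 1 / 2 else if a ∈ J c then (if x a then 1 else 0) else 0

open Classical in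
/-- The biases of the bits: under each context `c`, at most one arm `θ c` is better than `r`. -/
noncomputable def hardBias (J : Fin M → Finset (Fin K)) (Δ : ℝ) (θ : Fin M → Option (Fin K))
    (a : Fin K) : ℝ :=
  if ∃ c, a ∈ J c ∧ θ c = some a then 1 / 2 + Δ else 1 / 2 - Δ

/-- The means of the hard instance. -/
noncomputable def hardMean (r : Fin K) (J : Fin M → Finset (Fin K)) (Δ : ℝ)
    (θ : Fin M → Option (Fin K)) (c : Fin M) (a : Fin K) : ℝ :=
  if a = r then 1 / 2 else if a ∈ J c then hardBias J Δ θ a else 0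

variable {r : Fin K} {J : Fin M → Finset (Fin K)} {Δ : ℝ} {θ : Fin M → Option (Fin K)}

theorem hardReward_mem_Icc (x : Fin K → Bool) (c : Fin M) (a : Fin K) :
    hardReward r J x c a ∈ Set.Icc (0 : ℝ) 1 := by
  unfold hardReward
  split_ifs <;> norm_num

theorem hardBias_mem_Icc (hΔ0 : 0 ≤ Δ) (hΔ : Δ ≤ 1 / 4) (a : Fin K) :
    hardBias J Δ θ a ∈ Set.Icc (0 : ℝ) 1 := by
  unfold hardBias
  split_ifs <;> constructor <;> linarith

theorem sum_bitProb_hardReward (c : Fin M) (a : Fin K) :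
    ∑ x, bitProb (hardBias J Δ θ) x * hardReward r J x c a = hardMean r J Δ θ c a := by
  unfold hardReward hardMean
  split_ifs
  · rw [← Finset.sum_mul, sum_bitProb, one_mul]
  · rw [sum_bitProb_mul (hardBias J Δ θ) a fun b => if b then (1 : ℝ) else 0]
    simp
  · simp

theorem hardReward_update (x : Fin K → Bool) {v b : Fin K} (c : Fin M) (hb : b ≠ v) :
    hardReward r J (Function.update x v (!x v)) c b = hardReward r J x c b := by
  unfold hardReward
  rw [Function.update_of_ne hb]

theorem hardBias_eq (hJ : ∀ c c' v, v ∈ J c → v ∈ J c' → c = c') {c : Fin M} {v : Fin K}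
    (hv : v ∈ J c) [Decidable (θ c = some v)] :
    hardBias J Δ θ v = if θ c = some v then 1 / 2 + Δ else 1 / 2 - Δ := by
  unfold hardBias
  congr 1
  refine propext ⟨?_, fun h => ⟨c, hv, h⟩⟩
  rintro ⟨c', hc', h⟩
  rwa [hJ c c' v hv hc']

/-- Making v the better arm changes a single bias, which is the situation of `expect_sub_expect_le`.
-/
theorem hardBias_update_some {c : Fin M} {v : Fin K} (hv : v ∈ J c) :
    hardBias J Δ (Function.update θ c (some v)) =
      Function.update (hardBias J Δ (Function.update θ c none)) v (1 / 2 + Δ) := by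
  funext a
  by_cases ha : a = v
  · subst ha
    rw [Function.update_self]
    unfold hardBias
    rw [if_pos ⟨c, hv, by simp⟩]
  · rw [Function.update_of_ne ha]
    unfold hardBias
    congr 1
    refine propext (exists_congr fun c' => and_congr_right fun _ => ?_)
    by_cases hc : c' = c
    · subst hc
      simp [Ne.symm ha]
    · simp [Function.update_of_ne hc]

/-- The number of times `v` was taken under the context `c`. -/
def armCount (c : Fin M) (v : Fin K) (h : List (Round M K)) : ℝ :=
  (h.map fun x => if x.1 = c ∧ x.2.1 = v then (1 : ℝ) else 0).sum

/-- The number of times an arm of reward zero was taken. -/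
def costly (r : Fin K) (J : Fin M → Finset (Fin K)) (h : List (Round M K)) : ℝ :=
  (h.map fun x => if x.2.1 ∈ J x.1 ∨ x.2.1 = r then (0 : ℝ) else 1).sum

/-- The regret accumulated under the context `c`. -/
noncomputable def ctxGap (μ : Fin M → Fin K → ℝ) (c : Fin M) (h : List (Round M K)) : ℝ :=
  (h.map fun x => if x.1 = c then (⨆ a, μ x.1 a) - μ x.1 x.2.1 else 0).sum

theorem totalGap_eq_sum (μ : Fin M → Fin K → ℝ) (h : List (Round M K)) :
    totalGap μ h = ∑ c, ctxGap μ c h := by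
  induction h with
  | nil => simp [totalGap, ctxGap]
  | cons x h ih =>
    simp only [totalGap, ctxGap, List.map_cons, List.sum_cons, Finset.sum_add_distrib] at ih ⊢
    rw [ih]
    simp

theorem ctxGap_le_cons (μ : Fin M → Fin K → ℝ) (c : Fin M) (x : Round M K)
    (h : List (Round M K)) : ctxGap μ c h ≤ ctxGap μ c (x :: h) := by
  simp only [ctxGap, List.map_cons, List.sum_cons]
  have := gap_nonneg μ x.1 x.2.1
  split_ifs <;> linarith

theorem ctxGap_nonneg (μ : Fin M → Fin K → ℝ) (c : Fin M) (h : List (Round M K)) :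
    0 ≤ ctxGap μ c h := by
  induction h with
  | nil => simp [ctxGap]
  | cons x h ih => exact ih.trans (ctxGap_le_cons μ c x h)

theorem costly_le_cons (x : Round M K) (h : List (Round M K)) :
    costly r J h ≤ costly r J (x :: h) := by
  simp only [costly, List.map_cons, List.sum_cons]
  split_ifs <;> linarith

theorem hardMean_reference (c : Fin M) : hardMean r J Δ θ c r = 1 / 2 := if_pos rfl

/-- An arm of reward zero has a gap of at least 1/2, because the reference arm is always available.
-/
theorem costly_le (h : List (Round M K)) :
    costly r J h ≤ 2 * totalGap (hardMean r J Δ θ) h := by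
  induction h with
  | nil => simp [costly, totalGap]
  | cons x h ih =>
    simp only [costly, totalGap, List.map_cons, List.sum_cons] at ih ⊢
    have h0 := gap_nonneg (hardMean r J Δ θ) x.1 x.2.1
    split_ifs with hx
    · linarith
    · have h1 : hardMean r J Δ θ x.1 x.2.1 = 0 := by
        unfold hardMean
        rw [if_neg fun h => hx (Or.inr h), if_neg fun h => hx (Or.inl h)]
      have h2 := gap_nonneg (hardMean r J Δ θ) x.1 r
      rw [hardMean_reference] at h2
      rw [h1] at h0 ⊢
      linarith

/-- Without a better arm, taking arms of `J c` is costly. -/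
theorem le_ctxGap_none (hrJ : ∀ c, r ∉ J c) (hJ : ∀ c c' v, v ∈ J c → v ∈ J c' → c = c')
    {c : Fin M} (hθ : θ c = none) (h : List (Round M K)) :
    Δ * ∑ v ∈ J c, armCount c v h ≤ ctxGap (hardMean r J Δ θ) c h := by
  classical
  induction h with
  | nil => simp [armCount, ctxGap]
  | cons x h ih =>
    simp only [armCount, ctxGap, List.map_cons, List.sum_cons, Finset.sum_add_distrib] at ih ⊢
    rw [mul_add]
    refine add_le_add ?_ ih
    have h0 := gap_nonneg (hardMean r J Δ θ) x.1 x.2.1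
    by_cases hc : x.1 = c
    · have hsum : ∑ v ∈ J c, (if x.1 = c ∧ x.2.1 = v then (1 : ℝ) else 0) =
          if x.2.1 ∈ J c then 1 else 0 := by
        simp only [hc, true_and]
        exact Finset.sum_ite_eq _ _ _
      rw [hsum, if_pos hc]
      split_ifs with hx
      · have h1 : hardMean r J Δ θ x.1 x.2.1 = 1 / 2 - Δ := by
          unfold hardMean
          rw [hc, if_neg fun he : x.2.1 = r => hrJ c (he ▸ hx), if_pos hx, hardBias_eq hJ hx, hθ]
          simp
        have h2 := gap_nonneg (hardMean r J Δ θ) x.1 r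
        rw [hardMean_reference] at h2
        linarith
      · simpa using h0
    · simp [hc]

/-- If `v` is the better arm, taking any other arm is costly. -/
theorem le_ctxGap_some (hrJ : ∀ c, r ∉ J c) (hJ : ∀ c c' v, v ∈ J c → v ∈ J c' → c = c')
    (hΔ0 : 0 ≤ Δ) {c : Fin M} {v : Fin K} (hv : v ∈ J c) (hθ : θ c = some v)
    (h : List (Round M K)) :
    Δ * (((h.map Prod.fst).count c : ℝ) - armCount c v h) ≤ ctxGap (hardMean r J Δ θ) c h := by
  classical
  induction h with
  | nil => simp [armCount, ctxGap]
  | cons x h ih =>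
    simp only [armCount, ctxGap, List.map_cons, List.sum_cons, List.count_cons] at ih ⊢
    push_cast
    have h0 := gap_nonneg (hardMean r J Δ θ) x.1 x.2.1
    by_cases hc : x.1 = c
    · simp only [hc, true_and, if_true, beq_self_eq_true] at ih h0 ⊢
      have hbest : hardMean r J Δ θ c v = 1 / 2 + Δ := by
        unfold hardMean
        rw [if_neg fun he : v = r => hrJ c (he ▸ hv), if_pos hv, hardBias_eq hJ hv, hθ]
        simp
      have h2 := gap_nonneg (hardMean r J Δ θ) c v
      rw [hbest] at h2
      split_ifs with hx
      · linarith
      · have h1 : hardMean r J Δ θ c x.2.1 ≤ 1 / 2 := by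
          unfold hardMean
          split_ifs with h3 h4
          · exact le_rfl
          · rw [hardBias_eq hJ h4, hθ, if_neg (by simpa using Ne.symm hx)]
            linarith
          · norm_num
        linarith
    · simp only [hc, false_and, if_false, beq_iff_eq, add_zero, zero_add]
      linarith

end HardInstance

end GraphBandit

/-! ### The Bayesian lower bound for deterministic policies -/

namespace GraphBandit

section LowerBound

variable {M K : ℕ} {G : Digraph (Fin K)} {act : List (Round M K) → Fin M → Fin K} {r : Fin K}
  {J : Fin M → Finset (Fin K)} {Δ : ℝ} {θ : Fin M → Option (Fin K)}

/-- The expectation of `F` when `act` is run on the contexts `cs` in the hard instance `θ`. -/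
noncomputable def hardExpect (G : Digraph (Fin K)) (act : List (Round M K) → Fin M → Fin K)
    (r : Fin K) (J : Fin M → Finset (Fin K)) (Δ : ℝ) (θ : Fin M → Option (Fin K))
    (cs : List (Fin M)) (F : List (Round M K) → ℝ) : ℝ :=
  expect G act (hardReward r J) (bitProb (hardBias J Δ θ)) cs [] F

theorem armCount_nonneg (c : Fin M) (v : Fin K) (h : List (Round M K)) : 0 ≤ armCount c v h := by
  refine List.sum_nonneg fun y hy => ?_
  obtain ⟨x, -, rfl⟩ := List.mem_map.1 hy
  split_ifs <;> norm_num

/-- The regret under the context `c`, averaged over the possible better arms of this context. -/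
theorem phase_lower_bound (hrJ : ∀ c, r ∉ J c) (hJ : ∀ c c' v, v ∈ J c → v ∈ J c' → c = c')
    (hΔ0 : 0 ≤ Δ) (hΔ : Δ ≤ 1 / 4) (c : Fin M) (hne : (J c).Nonempty) (pre post : List (Fin M))
    {L : ℝ} (hL : 0 < L) (hcount : (pre.count c : ℝ) = (J c).card * L)
    (hobs : ∀ h : List (Round M K), h.map Prod.fst = pre.reverse →
      ∑ v ∈ J c, (obsCount G v h : ℝ) ≤ (J c).card * (L + costly r J h)) :
    Δ / 2 * ((J c).card * L) * (3 / 4 - 32 * Δ ^ 2 * L - 64 * Δ ^ 2 *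
        hardExpect G act r J Δ (Function.update θ c none) (pre ++ post)
          (totalGap (hardMean r J Δ (Function.update θ c none)))) ≤
      1 / 2 * hardExpect G act r J Δ (Function.update θ c none) (pre ++ post)
          (ctxGap (hardMean r J Δ (Function.update θ c none)) c) +
        ∑ v ∈ J c, 1 / (2 * (J c).card) *
          hardExpect G act r J Δ (Function.update θ c (some v)) (pre ++ post)
            (ctxGap (hardMean r J Δ (Function.update θ c (some v))) c) := by
  have hp : ∀ θ x, 0 ≤ bitProb (hardBias J Δ θ) x := fun θ =>
    bitProb_nonneg (hardBias_mem_Icc hΔ0 hΔ)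
  have hsum : ∀ θ, ∑ x, bitProb (hardBias J Δ θ) x = 1 := fun θ => sum_bitProb _
  set θ₀ := Function.update θ c none with hθ₀
  set n : ℝ := ((J c).card : ℝ) with hn
  have hn1 : 1 ≤ n := by
    rw [hn]; exact_mod_cast Finset.card_pos.2 hne
  have hnL : 0 < n * L := by positivity
  set V := hardExpect G act r J Δ θ₀ (pre ++ post) (totalGap (hardMean r J Δ θ₀)) with hV
  -- The fraction of the phase not spent on v, truncated to lie in [0,1] on all histories, as the
  -- change of measure demands.
  set f : Fin K → List (Round M K) → ℝ := fun v h => max 0 (1 - armCount c v h / (n * L)) with hf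
  have hmono : ∀ θ, hardExpect G act r J Δ θ pre (ctxGap (hardMean r J Δ θ) c) ≤
      hardExpect G act r J Δ θ (pre ++ post) (ctxGap (hardMean r J Δ θ) c) := fun θ =>
    expect_le_expect_append (hp θ) (hsum θ) (ctxGap_le_cons _ c) pre post []
  have hbase : Δ * ∑ v ∈ J c, hardExpect G act r J Δ θ₀ pre (armCount c v) ≤
      hardExpect G act r J Δ θ₀ (pre ++ post) (ctxGap (hardMean r J Δ θ₀) c) := by
    refine le_trans ?_ (hmono θ₀)
    unfold hardExpect
    rw [← expect_sum, ← expect_mul]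
    exact expect_mono (hp _) _ _ fun g _ => le_ctxGap_none hrJ hJ (by simp [hθ₀]) _
  have halt : ∀ v ∈ J c, Δ * (n * L) * hardExpect G act r J Δ (Function.update θ c (some v)) pre
      (f v) ≤ hardExpect G act r J Δ (Function.update θ c (some v)) (pre ++ post)
        (ctxGap (hardMean r J Δ (Function.update θ c (some v))) c) := by
    intro v hv
    refine le_trans ?_ (hmono _)
    unfold hardExpect
    rw [← expect_mul]
    refine expect_mono (hp _) _ _ fun g hg => ?_
    have h1 := le_ctxGap_some (r := r) (θ := Function.update θ c (some v)) hrJ hJ hΔ0 hv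
      (by simp) (g ++ [])
    have h2 := ctxGap_nonneg (hardMean r J Δ (Function.update θ c (some v))) c (g ++ [])
    rw [List.append_nil] at h1 h2 ⊢
    rw [hg, List.count_reverse, hcount] at h1
    simp only [hf]
    rcases max_choice 0 (1 - armCount c v g / (n * L)) with he | he
    · rw [he, mul_zero]; exact h2
    · rw [he]
      refine le_trans (le_of_eq ?_) h1
      field_simp
  have hchange : ∀ v ∈ J c, 1 - hardExpect G act r J Δ θ₀ pre (armCount c v) / (n * L) -
      (1 / 4 + 32 * Δ ^ 2 * hardExpect G act r J Δ θ₀ pre fun h => (obsCount G v h : ℝ)) ≤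
      hardExpect G act r J Δ (Function.update θ c (some v)) pre (f v) := by
    intro v hv
    -- At the start the likelihood ratio is 1, so z - 1 - log z vanishes and only the observations
    -- of v count.
    have h1 := expect_sub_expect_le (G := G) (act := act) (R := hardReward r J) (F := f v)
      (ν := hardBias J Δ θ₀) (hardBias_mem_Icc hΔ0 hΔ) v hΔ0 hΔ
      (by rw [hardBias_eq hJ hv, hθ₀]; simp) (fun x c b hb => hardReward_update x c hb)
      (fun h => le_max_left _ _) (fun h => max_le (by norm_num) (by
        have := div_nonneg (armCount_nonneg c v h) hnL.le
        linarith)) pre [] 1 one_pos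
    rw [← hardBias_update_some hv] at h1
    have h2 : 1 - hardExpect G act r J Δ θ₀ pre (armCount c v) / (n * L) ≤
        hardExpect G act r J Δ θ₀ pre (f v) := by
      have h3 : 1 - hardExpect G act r J Δ θ₀ pre (armCount c v) / (n * L) =
          hardExpect G act r J Δ θ₀ pre fun h => 1 + (-(1 / (n * L))) * armCount c v h := by
        unfold hardExpect
        rw [expect_add (F := fun _ => (1 : ℝ)), expect_const (hsum _), expect_mul]
        ring
      rw [h3]
      refine expect_mono (hp _) _ _ fun g _ => le_trans (le_of_eq ?_) (le_max_right _ _)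
      ring
    have h4 : (obsCount G v ([] : List (Round M K)) : ℝ) = 0 := by simp [obsCount]
    rw [h4, Real.log_one] at h1
    unfold hardExpect at h2 ⊢
    linarith
  have hobs' : ∑ v ∈ J c, hardExpect G act r J Δ θ₀ pre (fun h => (obsCount G v h : ℝ)) ≤
      n * (L + 2 * V) := by
    have h1 : hardExpect G act r J Δ θ₀ pre (costly r J) ≤ 2 * V := by
      refine (expect_le_expect_append (hp θ₀) (hsum θ₀) costly_le_cons pre post []).trans ?_
      rw [hV]
      unfold hardExpect
      rw [← expect_mul]
      exact expect_mono (hp _) _ _ fun g _ => costly_le _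
    have h2 : ∑ v ∈ J c, hardExpect G act r J Δ θ₀ pre (fun h => (obsCount G v h : ℝ)) ≤
        n * (L + hardExpect G act r J Δ θ₀ pre (costly r J)) := by
      have h3 : n * (L + hardExpect G act r J Δ θ₀ pre (costly r J)) =
          hardExpect G act r J Δ θ₀ pre fun h => n * (L + costly r J h) := by
        unfold hardExpect
        rw [expect_mul, expect_add (F := fun _ => L), expect_const (hsum _)]
      rw [h3]
      unfold hardExpect
      rw [← expect_sum]
      exact expect_mono (hp _) _ _ fun g hg => hobs _ (by simpa using hg)
    refine h2.trans ?_
    gcongr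
  set S := ∑ v ∈ J c, hardExpect G act r J Δ θ₀ pre (armCount c v) with hS
  have hS0 : 0 ≤ S := Finset.sum_nonneg fun v _ =>
    expect_nonneg (hp _) (hsum _) (armCount_nonneg c v) _ _
  have hsumalt : Δ / 2 * L * (3 / 4 * n - S / (n * L) - 32 * Δ ^ 2 * (n * (L + 2 * V))) ≤
      ∑ v ∈ J c, 1 / (2 * n) *
          hardExpect G act r J Δ (Function.update θ c (some v)) (pre ++ post)
            (ctxGap (hardMean r J Δ (Function.update θ c (some v))) c) := by
    calc _ ≤ Δ / 2 * L * ∑ v ∈ J c,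
          (1 - hardExpect G act r J Δ θ₀ pre (armCount c v) / (n * L) - (1 / 4 + 32 * Δ ^ 2 *
            hardExpect G act r J Δ θ₀ pre fun h => (obsCount G v h : ℝ))) := by
          refine mul_le_mul_of_nonneg_left ?_ (by positivity)
          rw [Finset.sum_sub_distrib, Finset.sum_sub_distrib, Finset.sum_add_distrib,
            ← Finset.sum_div, ← Finset.mul_sum, Finset.sum_const, Finset.sum_const,
            nsmul_eq_mul, nsmul_eq_mul]
          have := mul_le_mul_of_nonneg_left hobs' (show 0 ≤ 32 * Δ ^ 2 by positivity)
          linarith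
      _ ≤ ∑ v ∈ J c, 1 / (2 * n) * (Δ * (n * L) *
          hardExpect G act r J Δ (Function.update θ c (some v)) pre (f v)) := by
          rw [Finset.mul_sum]
          refine Finset.sum_le_sum fun v hv => ?_
          have h1 : 1 / (2 * n) * (Δ * (n * L) *
              hardExpect G act r J Δ (Function.update θ c (some v)) pre (f v)) =
              Δ / 2 * L * hardExpect G act r J Δ (Function.update θ c (some v)) pre (f v) := by
            field_simp
          rw [h1]
          exact mul_le_mul_of_nonneg_left (hchange v hv) (by positivity)
      _ ≤ _ := Finset.sum_le_sum fun v hv =>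
          mul_le_mul_of_nonneg_left (halt v hv) (by positivity)
  -- A policy that explores `J c` a lot gains against the alternatives, but without a better arm it
  -- pays Δ S. Half of this payment covers the term with S / (n L).
  have hfin : Δ / 2 * (n * L) * (3 / 4 - 32 * Δ ^ 2 * L - 64 * Δ ^ 2 * V) ≤
      1 / 2 * (Δ * S) +
        Δ / 2 * L * (3 / 4 * n - S / (n * L) - 32 * Δ ^ 2 * (n * (L + 2 * V))) := by
    have h1 : S / (n * L) * L ≤ S := by
      rw [div_mul_eq_mul_div, div_le_iff₀ hnL]
      nlinarith [mul_nonneg hS0 hL.le]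
    nlinarith [mul_le_mul_of_nonneg_left h1 hΔ0]
  linarith

/-- The prior on the better arm of the context `c`. -/
noncomputable def prior (J : Fin M → Finset (Fin K)) (c : Fin M) : Option (Fin K) → ℝ
  | none => if J c = ∅ then 1 else 1 / 2
  | some v => if v ∈ J c then 1 / (2 * (J c).card) else 0

theorem prior_nonneg (c : Fin M) (o : Option (Fin K)) : 0 ≤ prior J c o := by
  cases o <;> unfold prior <;> split_ifs <;> positivity

theorem sum_prior_some_mul (c : Fin M) (g : Fin K → ℝ) :
    ∑ v, prior J c (some v) * g v = ∑ v ∈ J c, 1 / (2 * (J c).card) * g v := by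
  simp [prior, ite_mul, Finset.sum_ite_mem]

theorem sum_prior (c : Fin M) : ∑ o, prior J c o = 1 := by
  rw [Fintype.sum_option]
  have h := sum_prior_some_mul (J := J) c fun _ => 1
  simp only [mul_one] at h
  rw [h, Finset.sum_const, nsmul_eq_mul]
  unfold prior
  rcases (J c).eq_empty_or_nonempty with he | hne
  · simp [he]
  · have : (0 : ℝ) < (J c).card := by exact_mod_cast Finset.card_pos.2 hne
    rw [if_neg hne.ne_empty]
    field_simp
    norm_num

/-- The Bayesian regret of a deterministic policy. -/
theorem bayes_lower_bound (hrJ : ∀ c, r ∉ J c) (hJ : ∀ c c' v, v ∈ J c → v ∈ J c' → c = c')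
    {L : ℝ} (hL : 1 ≤ L) (hΔ : Δ = 1 / (16 * Real.sqrt L)) (cs : List (Fin M))
    (hphase : ∀ c, ∃ pre post, cs = pre ++ post ∧ (pre.count c : ℝ) = (J c).card * L ∧
      ∀ h : List (Round M K), h.map Prod.fst = pre.reverse →
        ∑ v ∈ J c, (obsCount G v h : ℝ) ≤ (J c).card * (L + costly r J h)) :
    min (L / 4) ((∑ c, ((J c).card : ℝ)) * Real.sqrt L / 64) ≤
      ∑ θ : Fin M → Option (Fin K), (∏ c, prior J c (θ c)) *
        hardExpect G act r J Δ θ cs (totalGap (hardMean r J Δ θ)) := by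
  have hsL : 1 ≤ Real.sqrt L := Real.one_le_sqrt.2 hL
  have hsq : Real.sqrt L ^ 2 = L := Real.sq_sqrt (by linarith)
  have hΔ0 : 0 ≤ Δ := by rw [hΔ]; positivity
  have hΔ4 : Δ ≤ 1 / 4 := by
    rw [hΔ, div_le_div_iff₀ (by positivity) (by norm_num)]
    linarith
  -- With this choice 32 Δ² L = 1/8 reduces 3/4 to 5/8, and 64 Δ² V becomes V / (4 L).
  have hΔL : Δ ^ 2 * L = 1 / 256 := by
    rw [hΔ, div_pow, mul_pow, hsq]
    field_simp
    norm_num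
  have hΔL' : Δ * L = Real.sqrt L / 16 := by
    rw [hΔ]
    nth_rewrite 2 [← hsq]
    field_simp
  have hp : ∀ θ x, 0 ≤ bitProb (hardBias J Δ θ) x := fun θ =>
    bitProb_nonneg (hardBias_mem_Icc hΔ0 hΔ4)
  have hsum : ∀ θ, ∑ x, bitProb (hardBias J Δ θ) x = 1 := fun θ => sum_bitProb _
  set V : (Fin M → Option (Fin K)) → ℝ := fun θ =>
    hardExpect G act r J Δ θ cs (totalGap (hardMean r J Δ θ)) with hV
  set VC : Fin M → (Fin M → Option (Fin K)) → ℝ := fun c θ =>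
    hardExpect G act r J Δ θ cs (ctxGap (hardMean r J Δ θ) c) with hVC
  have hV0 : ∀ θ, 0 ≤ V θ := fun θ => expect_nonneg (hp _) (hsum _) (totalGap_nonneg _) _ _
  have hVC0 : ∀ c θ, 0 ≤ VC c θ := fun c θ =>
    expect_nonneg (hp _) (hsum _) (ctxGap_nonneg _ c) _ _
  have hVsum : ∀ θ, V θ = ∑ c, VC c θ := fun θ => by
    simp only [hV, hVC, hardExpect]
    rw [← expect_sum]
    congr 1
    funext h
    exact totalGap_eq_sum _ h
  set W : (Fin M → Option (Fin K)) → ℝ := fun θ => ∏ c, prior J c (θ c) with hW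
  have hW0 : ∀ θ, 0 ≤ W θ := fun θ => Finset.prod_nonneg fun c _ => prior_nonneg c _
  have hW1 : ∑ θ, W θ = 1 := sum_prod_eq_one _ sum_prior
  set S := ∑ θ, W θ * V θ with hS
  have hS0 : 0 ≤ S := Finset.sum_nonneg fun θ _ => mul_nonneg (hW0 θ) (hV0 θ)
  -- removing the better arm of one context at most doubles averages
  have hnone : ∀ c, ∑ θ, W θ * V (Function.update θ c none) ≤ 2 * S := by
    intro c
    rw [hS, ← sum_prod_mul_resample (prior J) c (sum_prior c) V, Finset.mul_sum]
    refine Finset.sum_le_sum fun θ _ => ?_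
    have h1 : prior J c none * V (Function.update θ c none) ≤
        ∑ o, prior J c o * V (Function.update θ c o) :=
      Finset.single_le_sum (f := fun o => prior J c o * V (Function.update θ c o))
        (fun o _ => mul_nonneg (prior_nonneg c o) (hV0 _)) (Finset.mem_univ none)
    have h2 : 1 / 2 ≤ prior J c none := by
      unfold prior
      split_ifs <;> norm_num
    have h3 : V (Function.update θ c none) ≤ 2 * ∑ o, prior J c o * V (Function.update θ c o) := by
      nlinarith [hV0 (Function.update θ c none)]
    nlinarith [mul_le_mul_of_nonneg_left h3 (hW0 θ)]
  have hctx : ∀ c, Δ / 2 * ((J c).card * L) * (5 / 8 - S / (2 * L)) ≤ ∑ θ, W θ * VC c θ := by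
    intro c
    rcases (J c).eq_empty_or_nonempty with he | hne
    · rw [he]
      simp only [Finset.card_empty, Nat.cast_zero, zero_mul, mul_zero]
      exact Finset.sum_nonneg fun θ _ => mul_nonneg (hW0 θ) (hVC0 c θ)
    obtain ⟨pre, post, rfl, hcount, hobs⟩ := hphase c
    rw [← sum_prod_mul_resample (prior J) c (sum_prior c) (VC c)]
    have hstep : ∀ θ, W θ * (Δ / 2 * ((J c).card * L) *
        (5 / 8 - 1 / (4 * L) * V (Function.update θ c none))) ≤
        W θ * ∑ o, prior J c o * VC c (Function.update θ c o) := fun θ => by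
      refine mul_le_mul_of_nonneg_left ?_ (hW0 θ)
      have h1 := phase_lower_bound (G := G) (act := act) (θ := θ) hrJ hJ hΔ0 hΔ4 c hne pre post
        (by linarith) hcount hobs
      rw [Fintype.sum_option, sum_prior_some_mul]
      have h2 : prior J c none = 1 / 2 := if_neg hne.ne_empty
      rw [h2]
      refine le_trans (le_of_eq ?_) h1
      have h3 : Δ ^ 2 = 1 / (256 * L) := by
        field_simp
        linarith
      rw [h3]
      field_simp
      ring
    refine le_trans ?_ (Finset.sum_le_sum fun θ _ => hstep θ)
    have h4 : ∑ θ, W θ * (Δ / 2 * ((J c).card * L) *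
        (5 / 8 - 1 / (4 * L) * V (Function.update θ c none))) =
        Δ / 2 * ((J c).card * L) * (5 / 8 * ∑ θ, W θ -
          1 / (4 * L) * ∑ θ, W θ * V (Function.update θ c none)) := by
      rw [Finset.mul_sum, Finset.mul_sum, ← Finset.sum_sub_distrib, Finset.mul_sum]
      exact Finset.sum_congr rfl fun θ _ => by ring
    rw [h4, hW1]
    have h5 : 1 / (4 * L) * ∑ θ, W θ * V (Function.update θ c none) ≤ S / (2 * L) := by
      refine (mul_le_mul_of_nonneg_left (hnone c) (by positivity)).trans (le_of_eq ?_)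
      field_simp
      norm_num
    gcongr
    linarith
  have hmain : Δ / 2 * ((∑ c, ((J c).card : ℝ)) * L) * (5 / 8 - S / (2 * L)) ≤ S := by
    have h1 : S = ∑ c, ∑ θ, W θ * VC c θ := by
      rw [Finset.sum_comm, hS]
      exact Finset.sum_congr rfl fun θ _ => by rw [hVsum, Finset.mul_sum]
    have h2 : Δ / 2 * ((∑ c, ((J c).card : ℝ)) * L) * (5 / 8 - S / (2 * L)) =
        ∑ c, Δ / 2 * ((J c).card * L) * (5 / 8 - S / (2 * L)) := by
      rw [← Finset.sum_mul, ← Finset.mul_sum, ← Finset.sum_mul]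
    rw [h2]
    exact (Finset.sum_le_sum fun c _ => hctx c).trans h1.ge
  -- Either the average regret is at least L / 4 already, or information from costly arms is
  -- negligible and the bracket is at least 1/2.
  rcases le_or_gt (L / 4) S with hcase | hcase
  · exact (min_le_left _ _).trans hcase
  · refine (min_le_right _ _).trans (le_trans ?_ hmain)
    have h1 : S / (2 * L) ≤ 1 / 8 := by
      rw [div_le_iff₀ (by linarith)]; linarith
    have hn : 0 ≤ ∑ c, ((J c).card : ℝ) := Finset.sum_nonneg fun c _ => Nat.cast_nonneg _
    have h2 : Δ / 2 * ((∑ c, ((J c).card : ℝ)) * L) =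
        (∑ c, ((J c).card : ℝ)) * Real.sqrt L / 32 := by
      have : Δ / 2 * ((∑ c, ((J c).card : ℝ)) * L) = (∑ c, ((J c).card : ℝ)) * (Δ * L) / 2 := by
        ring
      rw [this, hΔL']; ring
    rw [h2]
    have h3 : 0 ≤ (∑ c, ((J c).card : ℝ)) * Real.sqrt L :=
      mul_nonneg hn (Real.sqrt_nonneg L)
    have h4 := mul_le_mul_of_nonneg_left h1 h3
    linarith

end LowerBound

end GraphBandit

/-! ### The minimax lower bound -/

namespace GraphBandit

section Minimax

variable {M K T : ℕ} {G : Digraph (Fin K)} {r : Fin K} {J : Fin M → Finset (Fin K)}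

/-- The worst case dominates the average over the prior. For each seed the policy is deterministic,
so `bayes_lower_bound` applies and is then integrated over the seed. -/
theorem le_worstRegret (hK : 0 < K) (hT : 0 < T) {π : Policy M K} (hπ : π.Admissible)
    (hrJ : ∀ c, r ∉ J c) (hJ : ∀ c c' v, v ∈ J c → v ∈ J c' → c = c') {L : ℝ} (hL : 1 ≤ L)
    (cs : List (Fin M)) (hcs : cs.length = T)
    (hphase : ∀ c, ∃ pre post, cs = pre ++ post ∧ (pre.count c : ℝ) = (J c).card * L ∧
      ∀ h : List (Round M K), h.map Prod.fst = pre.reverse →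
        ∑ v ∈ J c, (obsCount G v h : ℝ) ≤ (J c).card * (L + costly r J h)) :
    min (L / 4) ((∑ c, ((J c).card : ℝ)) * Real.sqrt L / 64) ≤ worstRegret G π T := by
  obtain ⟨ctx, rfl⟩ : ∃ ctx : Fin T → Fin M, List.ofFn ctx = cs := by
    subst hcs
    exact ⟨cs.get, List.ofFn_get cs⟩
  set Δ := 1 / (16 * Real.sqrt L) with hΔ
  have hsL : 1 ≤ Real.sqrt L := Real.one_le_sqrt.2 hL
  have hΔ0 : 0 ≤ Δ := by positivity
  have hΔ4 : Δ ≤ 1 / 4 := by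
    rw [hΔ, div_le_div_iff₀ (by positivity) (by norm_num)]
    linarith
  have hp : ∀ θ x, 0 ≤ bitProb (hardBias J Δ θ) x := fun θ =>
    bitProb_nonneg (hardBias_mem_Icc hΔ0 hΔ4)
  have := hπ.1
  have hexp : ∀ θ : Fin M → Option (Fin K),
      Integrable (fun u => hardExpect G (π.act u) r J Δ θ (List.ofFn ctx)
        (totalGap (hardMean r J Δ θ))) π.seed ∧
      ∫ u, hardExpect G (π.act u) r J Δ θ (List.ofFn ctx) (totalGap (hardMean r J Δ θ)) ∂π.seed ≤
        worstRegret G π T := by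
    intro θ
    have h1 := expectedRegret_finiteEnvironment (G := G) hK hT (hp θ) (sum_bitProb _)
      (hardReward_mem_Icc (r := r) (J := J)) hπ ctx
    have hmean : (finiteEnvironment T (bitProb (hardBias J Δ θ)) (hardReward r J) (hp θ)
        (sum_bitProb _) hardReward_mem_Icc).mean = hardMean r J Δ θ := by
      funext c a
      exact sum_bitProb_hardReward c a
    rw [hmean] at h1
    refine ⟨h1.1, ?_⟩
    have h2 := expectedRegret_le_worstRegret hK hT hπ (G := G)
      (finiteEnvironment T (bitProb (hardBias J Δ θ)) (hardReward r J) (hp θ)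
        (sum_bitProb _) hardReward_mem_Icc) ctx
    rw [h1.2] at h2
    exact h2
  set m := min (L / 4) ((∑ c, ((J c).card : ℝ)) * Real.sqrt L / 64)
  have hint : ∀ θ ∈ (Finset.univ : Finset (Fin M → Option (Fin K))),
      Integrable (fun u => (∏ c, prior J c (θ c)) * hardExpect G (π.act u) r J Δ θ (List.ofFn ctx)
        (totalGap (hardMean r J Δ θ))) π.seed := fun θ _ => (hexp θ).1.const_mul _
  calc m = ∫ _u, m ∂π.seed := by simp
    _ ≤ ∫ u, ∑ θ : Fin M → Option (Fin K), (∏ c, prior J c (θ c)) *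
        hardExpect G (π.act u) r J Δ θ (List.ofFn ctx) (totalGap (hardMean r J Δ θ)) ∂π.seed :=
        integral_mono (integrable_const _) (integrable_finsetSum _ hint) fun u =>
          bayes_lower_bound hrJ hJ hL hΔ _ hphase
    _ = ∑ θ : Fin M → Option (Fin K), (∏ c, prior J c (θ c)) *
        ∫ u, hardExpect G (π.act u) r J Δ θ (List.ofFn ctx)
          (totalGap (hardMean r J Δ θ)) ∂π.seed := by
        rw [integral_finsetSum _ hint]
        exact Finset.sum_congr rfl fun θ _ => integral_const_mul _ _
    _ ≤ ∑ θ : Fin M → Option (Fin K), (∏ c, prior J c (θ c)) * worstRegret G π T :=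
        Finset.sum_le_sum fun θ _ => mul_le_mul_of_nonneg_left (hexp θ).2
          (Finset.prod_nonneg fun c _ => prior_nonneg c _)
    _ = worstRegret G π T := by
        rw [← Finset.sum_mul, sum_prod_eq_one _ sum_prior, one_mul]

/-- The context sequence that repeats the contexts `0, …, k - 1` in this order, each context `c`
for `len c` rounds. -/
def phases (len : Fin M → ℕ) : ℕ → List (Fin M)
  | 0 => []
  | k + 1 => phases len k ++ if h : k < M then List.replicate (len ⟨k, h⟩) ⟨k, h⟩ else []

theorem lt_of_mem_phases (len : Fin M → ℕ) (k : ℕ) {c : Fin M} (hc : c ∈ phases len k) :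
    c.1 < k := by
  induction k with
  | zero => simp [phases] at hc
  | succ k ih =>
    rw [phases, List.mem_append] at hc
    rcases hc with hc | hc
    · exact (ih hc).trans (Nat.lt_succ_self k)
    · split_ifs at hc with hk
      · rw [List.eq_of_mem_replicate hc]; exact Nat.lt_succ_self k
      · simp at hc

theorem count_phases (len : Fin M → ℕ) (c : Fin M) : (phases len (c.1 + 1)).count c = len c := by
  rw [phases, List.count_append, dif_pos c.2, List.count_eq_zero_of_not_mem
    fun h => lt_irrefl _ (lt_of_mem_phases len c.1 h)]
  simp

theorem exists_phases_append (len : Fin M → ℕ) {k m : ℕ} (hkm : k ≤ m) :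
    ∃ post, phases len m = phases len k ++ post := by
  induction m, hkm using Nat.le_induction with
  | base => exact ⟨[], by simp⟩
  | succ m hkm ih =>
    obtain ⟨post, hpost⟩ := ih
    exact ⟨_, by rw [phases, hpost, List.append_assoc]⟩

theorem length_phases (len : Fin M → ℕ) : (phases len M).length = ∑ c, len c := by
  have key : ∀ k, k ≤ M → (phases len k).length =
      ∑ i ∈ Finset.range k, if h : i < M then len ⟨i, h⟩ else 0 := by
    intro k
    induction k with
    | zero => simp [phases]
    | succ k ih =>
      intro hk
      rw [phases, List.length_append, ih (by omega), Finset.sum_range_succ,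
        dif_pos (show k < M by omega), dif_pos (show k < M by omega), List.length_replicate]
  rw [key M le_rfl, Finset.sum_range]
  simp

/-- Up to phase c, an arm of the family or the reference arm reveals at most one arm of `J c`,
namely itself during phase c. A costly arm may reveal all of `J c`. -/
theorem sum_adj_le {c c' : Fin M} (hedge : ∀ c' ≤ c, ∀ a, (a ∈ J c' ∨ a = r) →
      ∀ v ∈ J c, G.Adj a v → c' = c ∧ a = v) (hc' : c' ≤ c) (a : Fin K) [DecidableRel G.Adj] :
    ∑ v ∈ J c, (if G.Adj a v then (1 : ℝ) else 0) ≤ (if (c' == c) = true then 1 else 0) +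
      (J c).card * (if a ∈ J c' ∨ a = r then (0 : ℝ) else 1) := by
  by_cases hgood : a ∈ J c' ∨ a = r
  · rw [if_pos hgood, mul_zero, add_zero]
    by_cases hc : c' = c
    · rw [if_pos (beq_iff_eq.2 hc)]
      calc _ ≤ ∑ v ∈ J c, (if a = v then (1 : ℝ) else 0) := by
            refine Finset.sum_le_sum fun v hv => ?_
            by_cases h1 : G.Adj a v
            · rw [if_pos h1, if_pos (hedge _ hc' _ hgood v hv h1).2]
            · rw [if_neg h1]
              split_ifs <;> norm_num
        _ = if a ∈ J c then 1 else 0 := Finset.sum_ite_eq _ _ _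
        _ ≤ 1 := by split_ifs <;> norm_num
    · rw [Finset.sum_eq_zero fun v hv =>
        if_neg fun h1 => hc (hedge _ hc' _ hgood v hv h1).1]
      split_ifs <;> norm_num
  · rw [if_neg hgood, mul_one]
    have h1 : ∑ v ∈ J c, (if G.Adj a v then (1 : ℝ) else 0) ≤ ∑ v ∈ J c, (1 : ℝ) :=
      Finset.sum_le_sum fun v _ => by split_ifs <;> norm_num
    rw [Finset.sum_const, nsmul_eq_mul, mul_one] at h1
    refine h1.trans (le_add_of_nonneg_left ?_)
    split_ifs <;> norm_num

theorem sum_obsCount_le {c : Fin M} (hedge : ∀ c' ≤ c, ∀ a, (a ∈ J c' ∨ a = r) →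
      ∀ v ∈ J c, G.Adj a v → c' = c ∧ a = v)
    (h : List (Round M K)) (hh : ∀ c' ∈ h.map Prod.fst, c' ≤ c) :
    ∑ v ∈ J c, (obsCount G v h : ℝ) ≤ (h.map Prod.fst).count c + (J c).card * costly r J h := by
  classical
  induction h with
  | nil => simp [obsCount, costly]
  | cons x h ih =>
    have ih := ih fun c' hc' => hh c' (by simp only [List.map_cons]; exact List.mem_cons_of_mem _ hc')
    have hx : x.1 ≤ c := hh x.1 (by simp)
    simp only [obsCount_cons, costly, List.map_cons, List.sum_cons, List.count_cons] at ih ⊢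
    push_cast
    rw [Finset.sum_add_distrib]
    have hstep := sum_adj_le hedge hx x.2.1
    rw [mul_add]
    linarith

theorem costly_nonneg (h : List (Round M K)) : 0 ≤ costly r J h := by
  induction h with
  | nil => simp [costly]
  | cons x h ih => exact ih.trans (costly_le_cons x h)

/-- A lower bound from two arms under a single context. -/
theorem sqrt_le_worstRegret_of_two_le (hK : 2 ≤ K) (hM : 0 < M) (hT : 0 < T) {π : Policy M K}
    (hπ : π.Admissible) : Real.sqrt T / 64 ≤ worstRegret G π T := by
  set c₀ : Fin M := ⟨0, hM⟩ with hc₀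
  set r : Fin K := ⟨0, by omega⟩ with hr
  set v : Fin K := ⟨1, by omega⟩ with hv
  have hrv : r ≠ v := by simp [hr, hv]
  set J : Fin M → Finset (Fin K) := fun c => if c = c₀ then {v} else ∅ with hJ
  have hT' : (1 : ℝ) ≤ T := by exact_mod_cast hT
  have h := le_worstRegret (G := G) (r := r) (J := J) (L := T) (by omega) hT hπ
    (fun c => by simp only [hJ]; split_ifs <;> simp [hrv])
    (fun c c' w h1 h2 => by
      simp only [hJ] at h1 h2
      split_ifs at h1 h2 with h3 h4
      · exact h3.trans h4.symm
      all_goals simp at h1 h2)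
    hT' (List.replicate T c₀) (by simp) (fun c => by
      by_cases hc : c = c₀
      · refine ⟨List.replicate T c₀, [], by simp, by simp [hJ, hc], fun h hh => ?_⟩
        have hlen : h.length = T := by
          have := congrArg List.length hh
          simpa using this
        have h1 : (obsCount G v h : ℝ) ≤ T := by
          have := obsCount_le_length (G := G) (a := v) h
          rw [hlen] at this
          exact_mod_cast this
        have h2 := costly_nonneg (r := r) (J := J) h
        have hJc : J c = {v} := if_pos hc
        rw [hJc]
        simp only [Finset.sum_singleton, Finset.card_singleton, Nat.cast_one, one_mul]
        linarith
      · have hJc : J c = ∅ := if_neg hc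
        exact ⟨[], List.replicate T c₀, by simp, by simp [hJc], fun h _ => by simp [hJc]⟩)
  have hsum : ∑ c, ((J c).card : ℝ) = 1 := by
    simp only [hJ, apply_ite Finset.card, Finset.card_singleton, Finset.card_empty]
    simp
  rw [hsum, one_mul] at h
  refine le_trans (le_min ?_ le_rfl) h
  have h1 : Real.sqrt T ≤ T := Real.sqrt_le_iff.2 ⟨by linarith, by nlinarith⟩
  linarith

theorem exists_sum_card_eq_beta {V : Type*} [Fintype V] [DecidableEq V] (G : Digraph V) (M : ℕ) :
    ∃ I : Fin M → Finset V, (∀ c, IsIndep G (I c)) ∧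
      (∀ i j, i < j → ∀ u ∈ I i, ∀ v ∈ I j, ¬ G.Adj u v) ∧ beta G M = ∑ c, (I c).card := by
  classical
  have hne : (Finset.univ.filter fun I : Fin M → Finset V => (∀ c, IsIndep G (I c)) ∧
      ∀ i j, i < j → ∀ u ∈ I i, ∀ v ∈ I j, ¬ G.Adj u v).Nonempty :=
    ⟨fun _ => ∅, Finset.mem_filter.2 ⟨Finset.mem_univ _, by simp [IsIndep], by simp⟩⟩
  obtain ⟨I, hI, hIβ⟩ := Finset.exists_mem_eq_sup _ hne fun I => ∑ c, (I c).card
  obtain ⟨-, hind, hcross⟩ := Finset.mem_filter.1 hI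
  refine ⟨I, hind, hcross, ?_⟩
  rw [← hIβ, beta]

/-- An extremal family for `beta`, with one of its arms set aside as a reference arm. -/
theorem exists_reference_arm (hG : ∀ a, G.Adj a a) (hβ1 : 1 ≤ beta G M) :
    ∃ (r : Fin K) (J : Fin M → Finset (Fin K)), (∀ c, r ∉ J c) ∧
      (∀ c c' v, v ∈ J c → v ∈ J c' → c = c') ∧
      (∀ c, ∀ c' ≤ c, ∀ a, (a ∈ J c' ∨ a = r) → ∀ v ∈ J c, G.Adj a v → c' = c ∧ a = v) ∧
      ∑ c, (J c).card ≤ beta G M ∧ beta G M ≤ ∑ c, (J c).card + 1 := by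
  classical
  obtain ⟨I, hind, hcross, hIβ⟩ := exists_sum_card_eq_beta G M
  -- the reference arm
  have hne : (Finset.univ.filter fun c => (I c).Nonempty).Nonempty := by
    by_contra hcon
    rw [Finset.not_nonempty_iff_eq_empty, Finset.filter_eq_empty_iff] at hcon
    have : ∑ c, (I c).card = 0 := Finset.sum_eq_zero fun c hc => by
      simpa using hcon hc
    omega
  -- An arm from the first nonempty set has no edge to any other arm of the family, so playing it
  -- reveals nothing about the others.
  obtain ⟨c₁, hc₁, hmin⟩ := Finset.exists_min_image _ id hne
  obtain ⟨r, hr⟩ := (Finset.mem_filter.1 hc₁).2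
  have hmin' : ∀ c v, v ∈ I c → c₁ ≤ c := fun c v hv =>
    hmin c (Finset.mem_filter.2 ⟨Finset.mem_univ _, v, hv⟩)
  -- Self-loops make the sets of the family disjoint: a common vertex would give a forbidden edge.
  have hIdisj : ∀ c c' v, v ∈ I c → v ∈ I c' → c = c' := by
    intro c c' v hv hv'
    rcases lt_trichotomy c c' with h | h | h
    · exact absurd (hG v) (hcross _ _ h v hv v hv')
    · exact h
    · exact absurd (hG v) (hcross _ _ h v hv' v hv)
  set J : Fin M → Finset (Fin K) := fun c => (I c).erase r with hJ
  have hrJ : ∀ c, r ∉ J c := fun c => Finset.notMem_erase _ _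
  have hJI : ∀ c, J c ⊆ I c := fun c => Finset.erase_subset _ _
  have hJdisj : ∀ c c' v, v ∈ J c → v ∈ J c' → c = c' := fun c c' v h h' =>
    hIdisj c c' v (hJI c h) (hJI c' h')
  have hedge : ∀ c, ∀ c' ≤ c, ∀ a, (a ∈ J c' ∨ a = r) → ∀ v ∈ J c, G.Adj a v →
      c' = c ∧ a = v := by
    intro c c' hc' a ha v hv hadj
    rcases ha with ha | rfl
    · rcases hc'.eq_or_lt with rfl | hlt
      · refine ⟨rfl, ?_⟩
        by_contra hav
        exact hind c' a (hJI _ ha) v (hJI _ hv) hav hadj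
      · exact absurd hadj (hcross _ _ hlt a (hJI _ ha) v (hJI _ hv))
    · exfalso
      rcases (hmin' c v (hJI _ hv)).eq_or_lt with rfl | hlt
      · exact hind c₁ a hr v (hJI _ hv) (Finset.ne_of_mem_erase hv).symm hadj
      · exact hcross _ _ hlt a hr v (hJI _ hv) hadj
  -- the number of arms in use
  have hnle : ∑ c, (J c).card ≤ beta G M := by
    rw [hIβ]
    exact Finset.sum_le_sum fun c _ => Finset.card_le_card (hJI c)
  have hnge : beta G M ≤ ∑ c, (J c).card + 1 := by
    have h1 : ∀ c, (I c).card ≤ (J c).card + if c = c₁ then 1 else 0 := by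
      intro c
      split_ifs with hc
      · have := Finset.pred_card_le_card_erase (s := I c) (a := r)
        simp only [hJ]
        omega
      · simp only [hJ]
        rw [Finset.erase_eq_of_notMem fun h => hc (hIdisj _ _ r h hr)]
        omega
    rw [hIβ]
    refine (Finset.sum_le_sum fun c _ => h1 c).trans ?_
    rw [Finset.sum_add_distrib]
    simp
  exact ⟨r, J, hrJ, hJdisj, hedge, hnle, hnge⟩

/-- With ℓ of order T / β, the second term is of order √(β T) since n is at least β / 2. The first,
of order T / β, reaches √(β T) exactly in the regime of T at least of order β³. -/
theorem sqrt_mul_div_le_min {β n ℓ T : ℝ} (hβ : 2 ≤ β) (hℓ : 1 ≤ ℓ) (hT : 0 ≤ T)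
    (hTℓ : T ≤ 2 * β * ℓ) (hβT : β ^ 3 ≤ T) (hn : β ≤ 2 * n) :
    Real.sqrt (β * T) / 200 ≤ min (ℓ / 4) (n * Real.sqrt ℓ / 64) := by
  have hn0 : 0 ≤ n := by linarith
  refine le_min ?_ ?_
  · rw [div_le_iff₀ (by norm_num)]
    refine Real.sqrt_le_iff.2 ⟨by linarith, ?_⟩
    have h1 : β ^ 2 * (β * T) ≤ β ^ 2 * (4 * ℓ ^ 2) := by
      calc β ^ 2 * (β * T) = β ^ 3 * T := by ring
        _ ≤ T * T := by gcongr
        _ ≤ (2 * β * ℓ) * (2 * β * ℓ) := by gcongr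
        _ = _ := by ring
    have h2 : β * T ≤ 4 * ℓ ^ 2 := le_of_mul_le_mul_left h1 (by positivity)
    have h3 := sq_nonneg ℓ
    have h4 : (ℓ / 4 * 200) ^ 2 = 2500 * ℓ ^ 2 := by ring
    linarith
  · rw [div_le_iff₀ (by norm_num)]
    refine Real.sqrt_le_iff.2 ⟨by positivity, ?_⟩
    have h1 : (n * Real.sqrt ℓ / 64 * 200) ^ 2 = n ^ 2 * ℓ * (200 / 64) ^ 2 := by
      rw [mul_pow, div_pow, mul_pow, Real.sq_sqrt (by linarith)]
      ring
    rw [h1]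
    have h2 : β * T ≤ 8 * (n ^ 2 * ℓ) := by
      calc β * T ≤ β * (2 * β * ℓ) := by gcongr
        _ = 2 * (β * β) * ℓ := by ring
        _ ≤ 2 * ((2 * n) * (2 * n)) * ℓ := by gcongr
        _ = _ := by ring
    have h3 : 0 ≤ n ^ 2 * ℓ := by positivity
    linarith

/-- The minimax lower bound for a fixed policy. -/
theorem sqrt_beta_le_worstRegret (hK : 2 ≤ K) (hM : 0 < M) (hT : 0 < T)
    (hG : ∀ a, G.Adj a a) (hβT : beta G M ^ 3 ≤ T) {π : Policy M K} (hπ : π.Admissible) :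
    Real.sqrt (beta G M * T) / 200 ≤ worstRegret G π T := by
  classical
  have hβ1 : 1 ≤ beta G M := one_le_beta (by omega) hM hG
  have hT' : (1 : ℝ) ≤ T := by exact_mod_cast hT
  -- For β = 1 setting the reference arm aside would leave no arm to hide, so two arbitrary arms are
  -- used instead.
  rcases hβ1.eq_or_lt with hβ | hβ2
  · rw [← hβ]
    refine le_trans ?_ (sqrt_le_worstRegret_of_two_le hK hM hT hπ)
    have := Real.sqrt_nonneg (T : ℝ)
    rw [Nat.cast_one, one_mul]
    linarith
  obtain ⟨r, J, hrJ, hJdisj, hedge, hnle, hnge⟩ := exists_reference_arm (M := M) hG hβ1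
  generalize beta G M = β at *
  -- Rounds per arm, rounded down. As ℓ ≥ 1, rounding loses at most a factor 2; leftover rounds are
  -- appended after all phases.
  set ℓ := T / β with hℓ
  have hβT' : β ≤ T := le_trans (Nat.le_self_pow (by norm_num) β) hβT
  have hℓ1 : 1 ≤ ℓ := (Nat.one_le_div_iff (by omega)).2 hβT'
  have hℓT : β * ℓ ≤ T := Nat.mul_div_le T β
  have hTℓ : T ≤ 2 * β * ℓ := by
    have := Nat.lt_mul_div_succ T (show 0 < β by omega)
    rw [← hℓ] at this
    nlinarith
  set len : Fin M → ℕ := fun c => (J c).card * ℓ with hlen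
  have hlenT : ∑ c, len c ≤ T := by
    simp only [hlen]
    rw [← Finset.sum_mul]
    exact (Nat.mul_le_mul_right _ hnle).trans hℓT
  have h := le_worstRegret (G := G) (r := r) (J := J) (L := (ℓ : ℝ)) (by omega) hT hπ hrJ hJdisj
    (by exact_mod_cast hℓ1)
    (phases len M ++ List.replicate (T - ∑ c, len c) ⟨0, hM⟩)
    (by rw [List.length_append, length_phases, List.length_replicate]; omega)
    (fun c => by
      obtain ⟨post, hpost⟩ := exists_phases_append len (show c.1 + 1 ≤ M from c.2)
      refine ⟨phases len (c.1 + 1), post ++ List.replicate (T - ∑ c, len c) ⟨0, hM⟩,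
        by rw [hpost, List.append_assoc], ?_, fun g hg => ?_⟩
      · rw [count_phases]; simp [hlen]
      · have h1 := sum_obsCount_le (hedge c) g fun c' hc' => by
          rw [hg, List.mem_reverse] at hc'
          exact Nat.lt_succ_iff.1 (lt_of_mem_phases len _ hc')
        rw [hg, List.count_reverse, count_phases] at h1
        simp only [hlen] at h1
        push_cast at h1
        linarith)
  refine le_trans ?_ h
  have hβ2' : (2 : ℝ) ≤ β := by exact_mod_cast hβ2
  have hℓ1' : (1 : ℝ) ≤ ℓ := by exact_mod_cast hℓ1
  have hTℓ' : (T : ℝ) ≤ 2 * β * ℓ := by exact_mod_cast hTℓ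
  have hβT3 : (β : ℝ) ^ 3 ≤ T := by exact_mod_cast hβT
  have hn : (β : ℝ) ≤ 2 * ∑ c, ((J c).card : ℝ) := by
    have : β ≤ 2 * ∑ c, (J c).card := by omega
    exact_mod_cast this
  exact sqrt_mul_div_le_min hβ2' hℓ1' (by positivity) hTℓ' hβT3 hn

theorem sqrt_beta_le_minimaxRegret (hK : 2 ≤ K) (hM : 0 < M) (hT : 0 < T)
    (hG : ∀ a, G.Adj a a) (hβT : beta G M ^ 3 ≤ T) :
    Real.sqrt (beta G M * T) / 200 ≤ minimaxRegret G M T := by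
  have : Nonempty {π : Policy M K // π.Admissible} :=
    ⟨⟨armElim G M T 1 fun _ _ => ⟨0, by omega⟩, armElim_admissible _ _⟩⟩
  exact le_ciInf fun π => sqrt_beta_le_worstRegret hK hM hT hG hβT π.2

end Minimax

end GraphBandit

/-! ### The main theorem -/

theorem theorem4 :
    ∃ C : ℝ, 0 < C ∧
      ∀ (K M T : ℕ) (G : Digraph (Fin K)) (σ : Finset (Fin K) → Finset (Fin K) → Fin K),
        0 < K → 0 < M → 0 < T → (∀ a, G.Adj a a) → GraphBandit.IsGreedy G σ →
        -- for every failure probability, the algorithm is an admissible policy with small regret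
        (∀ δ : ℝ, 0 < δ → δ < 1 →
          (GraphBandit.armElim G M T δ σ).Admissible ∧
          ∀ (ctx : Fin T → Fin M) (E : GraphBandit.Environment T M K),
            ENNReal.ofReal (1 - δ) ≤
              E.measure (GraphBandit.armElim G M T δ σ)
                {p | GraphBandit.regret G (GraphBandit.armElim G M T δ σ) E.mean ctx p.1 p.2 ≤
                  C * Real.sqrt (T * GraphBandit.betaDom G M * Real.log (M * K * T / δ))}) ∧
        -- worst-case expected regret on general graphs
        GraphBandit.worstRegret G (GraphBandit.armElim G M T (1 / (T + 1)) σ) T ≤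
          C * (Real.log K * Real.sqrt (Real.log (M * K * T))) *
            Real.sqrt ((min (GraphBandit.betaBar G M) (GraphBandit.masNumber G) : ℕ) * T) ∧
        -- undirected or transitively closed graphs: upper bound and near-optimality
        (((∀ a b, G.Adj a b → G.Adj b a) ∨ (∀ a b c, G.Adj a b → G.Adj b c → G.Adj a c)) →
          GraphBandit.worstRegret G (GraphBandit.armElim G M T (1 / (T + 1)) σ) T ≤
            C * Real.sqrt (Real.log K * Real.log (M * K * T)) *
              Real.sqrt (GraphBandit.beta G M * T) ∧
          (GraphBandit.beta G M ^ 3 ≤ T →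
            GraphBandit.worstRegret G (GraphBandit.armElim G M T (1 / (T + 1)) σ) T ≤
              C * Real.sqrt (Real.log K * Real.log (M * K * T)) *
                GraphBandit.minimaxRegret G M T)) := by
  -- Near-optimality dictates the constant: 100 from the upper bound times 200 from the lower bound.
  -- The other parts need only 48, 400 and 100.
  refine ⟨20000, by norm_num, fun K M T G σ hK hM hT hG hσ =>
    ⟨fun δ hδ0 hδ1 => ⟨GraphBandit.armElim_admissible δ σ, fun ctx E => ?_⟩, ?_,
      fun hcase => ⟨?_, fun hβ => ?_⟩⟩⟩
  · refine (GraphBandit.measure_regret_le_betaDom hK hM hT hG hσ hδ0 hδ1 ctx E).trans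
      (measure_mono (Set.ofPred_subset_ofPred.2 fun p hp => hp.trans ?_))
    gcongr
    norm_num
  · refine (GraphBandit.worstRegret_le_min hK hM hT hG hσ).trans ?_
    have := Real.log_natCast_nonneg K
    gcongr
    norm_num
  · refine (GraphBandit.worstRegret_le_beta hK hM hT hG hσ hcase).trans ?_
    gcongr
    norm_num
  · rcases Nat.lt_or_ge K 2 with hK1 | hK2
    · rw [GraphBandit.worstRegret_eq_zero (by omega)]
      have := GraphBandit.minimaxRegret_nonneg (G := G) (M := M) (T := T)
      positivity
    · refine (GraphBandit.worstRegret_le_beta hK hM hT hG hσ hcase).trans ?_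
      have h := GraphBandit.sqrt_beta_le_minimaxRegret hK2 hM hT hG hβ
      have h0 := Real.sqrt_nonneg (Real.log K * Real.log (M * K * T))
      have h1 := mul_le_mul_of_nonneg_left h h0
      nlinarith
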